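/- Let $M$ be an $n$-dimensional smooth manifold-with-boundary (Hausdorff, second countable, $n\ge 1$), with interior $\mathring M$ and boundary $\partial M$, equipped with a smooth free action of the circle group $S^1$ on an open neighbourhood $U_M$ of $\partial M$. Let $M_{\mathrm{cut}}=M/{\sim}$, where distinct points are equivalent if and only if both lie in $\partial M$ and they lie in the same $S^1$-orbit; let $c\colon M\to M_{\mathrm{cut}}$ be the quotient map, and equip $M_{\mathrm{cut}}$ with the quotient topology. An \emph{invariant boundary defining function} is a smooth function $f\colon M\to\mathbb R_{\ge 0}$ such that $f^{-1}(0)=\partial M$, such that $df$ does not vanish at any point of $\partial M$, and such that $f$ is $S^1$-invariant on some $S^1$-invariant neighbourhood of $\partial M$ in $U_M$. Given such an $f$, let $\mathcal F_M$ be the set of functions $h\colon M_{\mathrm{cut}}\to\mathbb R$ for which $\widehat h:=h\circ c$ satisfies: (F1) $\widehat h|_{\mathring M}$ is smooth; (F2) there exist an $S^1$-invariant open neighbourhood $V$ of $\partial M$ in $U_M$ and a smooth function $H\colon V\times\mathbb C\to\mathbb R$ such that $H(a\cdot x,z)=H(x,az)$ for all $a\in S^1$ and $(x,z)\in V\times\mathbb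 C$, and $\widehat h(x)=H\bigl(x,\sqrt{f(x)}\bigr)$ for all $x\in V$. Then: 1. Invariant boundary defining functions exist, and the set $\mathcal F_M$ does not depend on the choice of $f$. 2. $M_{\mathrm{cut}}$ is Hausdorff and second countable, and there exists a unique structure of a smooth manifold (without boundary) on the topological space $M_{\mathrm{cut}}$ whose set of real-valued smooth functions is exactly $\mathcal F_M$; it has dimension $n$. 3. $\mathring M_{\mathrm{cut}}:=c(\mathring M)$ is open and dense in $M_{\mathrm{cut}}$. 4. $M_{\mathrm{red}}:=c(\partial M)$, which is the (homeomorphic) image of $(\partial M)/S^1$ under the map induced by $c$, is a closed subset of $M_{\mathrm{cut}}$ and an embedded submanifold of codimension two. -/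

import Mathlib

open Set TopologicalSpace
open scoped Manifold ContDiff Topology

noncomputable section

namespace SmoothCut

/-! Throughout, `M` is an `n`-dimensional manifold-with-boundary (charts in the half-space `𝓡∂ n`),
`U` is an open subset of `M` (a neighbourhood of `∂M`), and the circle group acts on `U`. -/

/-- A smooth and free circle action on an open neighbourhood `U` of the boundary of `M`. -/
structure IsFreeCircleActionNearBoundary (n : ℕ) [NeZero n] {M : Type*} [TopologicalSpace M]
    [ChartedSpace (EuclideanHalfSpace n) M] (U : Opens M) [MulAction Circle U] : Prop where
  boundary_subset : (𝓡∂ n).boundary M ⊆ (U : Set M)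
  smooth : ContMDiff ((𝓡 1).prod (𝓡∂ n)) (𝓡∂ n) ∞ (fun p : Circle × U => p.1 • p.2)
  free : ∀ (a : Circle) (x : U), a • x = x → a = 1

/-- `V` is a circle-invariant open neighbourhood of `∂M` contained in `U`. -/
structure IsInvariantNhd (n : ℕ) [NeZero n] {M : Type*} [TopologicalSpace M]
    [ChartedSpace (EuclideanHalfSpace n) M] (U : Opens M) [MulAction Circle U]
    (V : Set M) : Prop where
  isOpen : IsOpen V
  boundary_subset : (𝓡∂ n).boundary M ⊆ V
  subset : V ⊆ (U : Set M)
  invariant : ∀ (a : Circle) (x : U), (x : M) ∈ V → ((a • x : U) : M) ∈ V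

/-- Invariant boundary defining functions: smooth functions `f : M → [0, ∞)` with
`f ⁻¹(0) = ∂M`, with `df` nowhere zero along `∂M`, and which are circle-invariant on some
invariant neighbourhood of `∂M`. -/
structure IsInvariantBoundaryDefining (n : ℕ) [NeZero n] {M : Type*} [TopologicalSpace M]
    [ChartedSpace (EuclideanHalfSpace n) M] (U : Opens M) [MulAction Circle U]
    (f : M → ℝ) : Prop where
  smooth : ContMDiff (𝓡∂ n) 𝓘(ℝ, ℝ) ∞ f
  nonneg : ∀ x, 0 ≤ f x
  zero_iff : ∀ x, f x = 0 ↔ x ∈ (𝓡∂ n).boundary M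
  mfderiv_ne_zero : ∀ x ∈ (𝓡∂ n).boundary M, mfderiv (𝓡∂ n) 𝓘(ℝ, ℝ) f x ≠ 0
  invariant : ∃ V : Set M, IsInvariantNhd n U V ∧
    ∀ (a : Circle) (x : U), (x : M) ∈ V → f ((a • x : U) : M) = f (x : M)

/-- Distinct points are equivalent iff both lie in `∂M` and they are in the same circle orbit. -/
def cutSetoid (n : ℕ) [NeZero n] {M : Type*} [TopologicalSpace M]
    [ChartedSpace (EuclideanHalfSpace n) M] (U : Opens M) [MulAction Circle U] : Setoid M where
  r x y := x = y ∨ (x ∈ (𝓡∂ n).boundary M ∧ y ∈ (𝓡∂ n).boundary M ∧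
    ∃ (a : Circle) (u : U), (u : M) = x ∧ ((a • u : U) : M) = y)
  iseqv := by
    refine ⟨fun x => Or.inl rfl, ?_, ?_⟩
    · rintro x y (h | ⟨hx, hy, a, u, rfl, rfl⟩)
      · exact Or.inl h.symm
      · exact Or.inr ⟨hy, hx, a⁻¹, a • u, rfl, by rw [inv_smul_smul]⟩
    · rintro x y z (rfl | ⟨hx, hy, a, u, rfl, rfl⟩) h
      · exact h
      · rcases h with rfl | ⟨_, hz, b, v, hv, rfl⟩
        · exact Or.inr ⟨hx, hy, a, u, rfl, rfl⟩
        · obtain rfl : v = a • u := Subtype.ext hv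
          exact Or.inr ⟨hx, hz, b * a, u, rfl, by rw [mul_smul]⟩

/-- The cut space `M_cut = M / ∼`. -/
def CutSpace (n : ℕ) [NeZero n] {M : Type*} [TopologicalSpace M]
    [ChartedSpace (EuclideanHalfSpace n) M] (U : Opens M) [MulAction Circle U] : Type _ :=
  Quotient (cutSetoid n U)

/-- The cut space carries the quotient topology. -/
instance (n : ℕ) [NeZero n] {M : Type*} [TopologicalSpace M]
    [ChartedSpace (EuclideanHalfSpace n) M] (U : Opens M) [MulAction Circle U] :
    TopologicalSpace (CutSpace n U) :=
  inferInstanceAs (TopologicalSpace (Quotient (cutSetoid n U)))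

/-- The quotient map `c : M → M_cut`. -/
def cutMap (n : ℕ) [NeZero n] {M : Type*} [TopologicalSpace M]
    [ChartedSpace (EuclideanHalfSpace n) M] (U : Opens M) [MulAction Circle U] :
    M → CutSpace n U :=
  fun x => Quotient.mk (cutSetoid n U) x

/-- The set `ℱ_M` of functions `h : M_cut → ℝ` associated with the function `f`: the pullback
`h ∘ c` is smooth on the interior, and near the boundary it has the form `H (x, √(f x))` with
`H` smooth on `V × ℂ` and `H (a • x, z) = H (x, a z)`. (The function `H` is given by a function on
`M × ℂ` of which only the restriction to `V × ℂ` matters.) -/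
def cutFunctions (n : ℕ) [NeZero n] {M : Type*} [TopologicalSpace M]
    [ChartedSpace (EuclideanHalfSpace n) M] (U : Opens M) [MulAction Circle U] (f : M → ℝ) :
    Set (CutSpace n U → ℝ) :=
  {h | ContMDiffOn (𝓡∂ n) 𝓘(ℝ, ℝ) ∞ (h ∘ cutMap n U) ((𝓡∂ n).interior M) ∧
    ∃ (V : Set M) (H : M × ℂ → ℝ), IsInvariantNhd n U V ∧
      ContMDiffOn ((𝓡∂ n).prod 𝓘(ℝ, ℂ)) 𝓘(ℝ, ℝ) ∞ H (V ×ˢ univ) ∧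
      (∀ (a : Circle) (x : U) (z : ℂ), (x : M) ∈ V →
        H (((a • x : U) : M), z) = H ((x : M), (a : ℂ) * z)) ∧
      ∀ x ∈ V, h (cutMap n U x) = H (x, ((Real.sqrt (f x) : ℝ) : ℂ))}

/-- The orbit relation of the circle action on `∂M`. -/
def boundaryOrbitSetoid (n : ℕ) [NeZero n] {M : Type*} [TopologicalSpace M]
    [ChartedSpace (EuclideanHalfSpace n) M] (U : Opens M) [MulAction Circle U]
    (hU : (𝓡∂ n).boundary M ⊆ (U : Set M)) : Setoid ((𝓡∂ n).boundary M) where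
  r x y := ∃ a : Circle, ((a • (⟨x, hU x.2⟩ : U) : U) : M) = y
  iseqv := by
    refine ⟨fun x => ⟨1, by rw [one_smul]⟩, ?_, ?_⟩
    · rintro x y ⟨a, ha⟩
      refine ⟨a⁻¹, ?_⟩
      have : (⟨y, hU y.2⟩ : U) = a • (⟨x, hU x.2⟩ : U) := Subtype.ext ha.symm
      rw [this, inv_smul_smul]
    · rintro x y z ⟨a, ha⟩ ⟨b, hb⟩
      refine ⟨b * a, ?_⟩
      have : (⟨y, hU y.2⟩ : U) = a • (⟨x, hU x.2⟩ : U) := Subtype.ext ha.symm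
      rw [mul_smul, ← this, hb]

/-- The map `∂M / S¹ → M_cut` induced by `c`; here `∂M / S¹` has the quotient topology. -/
def boundaryOrbitMap (n : ℕ) [NeZero n] {M : Type*} [TopologicalSpace M]
    [ChartedSpace (EuclideanHalfSpace n) M] (U : Opens M) [MulAction Circle U]
    (hU : (𝓡∂ n).boundary M ⊆ (U : Set M)) :
    Quotient (boundaryOrbitSetoid n U hU) → CutSpace n U :=
  Quotient.lift (fun x => cutMap n U x) (by
    rintro x y ⟨a, ha⟩
    exact Quotient.sound (Or.inr ⟨x.2, y.2, a, ⟨x, hU x.2⟩, rfl, ha⟩))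

/-- `M_red = c(∂M)`, as a subset of the cut space. -/
def reducedSet (n : ℕ) [NeZero n] {M : Type*} [TopologicalSpace M]
    [ChartedSpace (EuclideanHalfSpace n) M] (U : Opens M) [MulAction Circle U] :
    Set (CutSpace n U) :=
  cutMap n U '' (𝓡∂ n).boundary M

/-- `S` is an embedded submanifold of codimension `k` of the `n`-dimensional smooth manifold `X`:
near each point of `S` there is a chart of the maximal smooth atlas in which `S` is a linear
subspace of codimension `k`. -/
def IsEmbeddedSubmanifold (n k : ℕ) {X : Type*} [TopologicalSpace X]
    [ChartedSpace (EuclideanSpace ℝ (Fin n)) X] (S : Set X) : Prop :=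
  ∀ y ∈ S, ∃ φ ∈ IsManifold.maximalAtlas (𝓡 n) ∞ X, y ∈ φ.source ∧
    ∃ L : Submodule ℝ (EuclideanSpace ℝ (Fin n)), Module.finrank ℝ L + k = n ∧
      ∀ z ∈ φ.source, z ∈ S ↔ φ z ∈ L

/-- The set of smooth real-valued functions on an `m`-dimensional smooth manifold. -/
def smoothFunctions (m : ℕ) (X : Type*) [TopologicalSpace X]
    [ChartedSpace (EuclideanSpace ℝ (Fin m)) X] : Set (X → ℝ) :=
  {h | ContMDiff (𝓡 m) 𝓘(ℝ, ℝ) ∞ h}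

/-- Two charted-space structures on the topological space `X` define the same smooth structure:
the identity map is smooth in both directions. -/
def SameSmoothStructure {m m' : ℕ} {X : Type*} [TopologicalSpace X]
    (A : ChartedSpace (EuclideanSpace ℝ (Fin m)) X)
    (B : ChartedSpace (EuclideanSpace ℝ (Fin m')) X) : Prop :=
  @ContMDiff ℝ _ _ _ _ _ _ (𝓡 m) X _ A _ _ _ _ _ (𝓡 m') X _ B ∞ id ∧
    @ContMDiff ℝ _ _ _ _ _ _ (𝓡 m') X _ B _ _ _ _ _ (𝓡 m) X _ A ∞ id

end SmoothCut

end

/-! The local model carries the whole argument. Near an orbit in the boundary, freeness gives an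
equivariant map `α` to the circle. Together with invariant coordinates `d` in `ℝ^(n-2)` and the
function `f`, it identifies an invariant open set `W` with the product of the circle and a
relatively open piece of the half-space `{(d, s) | 0 ≤ s}`; `σ` is the section over that piece on
which `α = 1` (`exists_cutSlice`). Collapsing the circles over `s = 0` turns annuli into discs: `κ =
(d, α √f)` descends to a chart of the cut space with values in `ℝ^(n-2) × ℂ`, and its inverse is
induced by `ι (d, z) = (z / |z|) · σ (d, |z|²)`.

The square root and the unit part are singular at `z = 0`, but equivariance makes the singularities
cancel. A transition between two slice charts sends `(d, z)` to `(d' (σ), α' (σ) z)` with `σ` taken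
at `(d, |z|²)`, because `|z|` times the unit part is `z` again (`CutSlice.κ_ι_of_mem`). In the same
way, if `h ∘ c = H (x, √f)` with `H` equivariant, then `h ∘ c ∘ ι = H (σ (d, |z|²), z)`, which is
smooth.

Conversely, a smooth `h` has local lifts `H` read off from the slice charts. The condition imposed
on the values of `H` is convex, so a partition of unity glues the lifts, and averaging over the
circle restores equivariance (`exists_contMDiff_lift`, `mem_cutFunctions_of_contMDiff`). Two
boundary defining functions differ by a positive smooth factor, by Hadamard's lemma; after
averaging, that factor is absorbed by rescaling `z` (`cutFunctions_subset`).

The remaining points are softer. The quotient map is closed because the circle is compact, which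
gives the Hausdorff property and the embedding of the orbit space. Smooth functions determine a
smooth structure through cut-off coordinates (`contMDiff_of_forall_comp`). In a slice chart the
reduced space is the subspace `z = 0`. -/

noncomputable section

set_option linter.unusedSectionVars false

namespace SmoothCut

section

/-! ### Smooth dependence of integrals over the unit interval on parameters. -/

section ParametricIntegral

open MeasureTheory

variable {E F : Type*} [NormedAddCommGroup E] [NormedSpace ℝ E] [NormedAddCommGroup F]
  [NormedSpace ℝ F]

/-- A function continuous on `S × [0,1]` is continuous in the first variable uniformly with respect
to the second one. -/
theorem eventually_forall_norm_sub_le {X F : Type*} [TopologicalSpace X] [NormedAddCommGroup F]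
    {S : Set X} {Φ : X × ℝ → F}
    (hΦ : ContinuousOn Φ (S ×ˢ Icc 0 1)) {x₀ : X} (hx₀ : x₀ ∈ S) {ε : ℝ} (hε : 0 < ε) :
    ∀ᶠ x in 𝓝 x₀, ∀ s ∈ Icc (0 : ℝ) 1, x ∈ S → ‖Φ (x, s) - Φ (x₀, s)‖ ≤ ε := by
  -- The memberships stay inside the predicate as implications: the compactness argument needs
  -- eventualities in full neighbourhoods of `(x₀, s)`, while `Φ` is controlled only on `S ×ˢ Icc 0
  -- 1`.
  have key : ∀ᶠ x in 𝓝 x₀, ∀ s ∈ Icc (0 : ℝ) 1,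
      (s ∈ Icc (0 : ℝ) 1 → x ∈ S → ‖Φ (x, s) - Φ (x₀, s)‖ ≤ ε) := by
    apply isCompact_Icc.eventually_forall_of_forall_eventually
    intro s hs
    have h1 := hΦ (x₀, s) ⟨hx₀, hs⟩
    have h2 : ∀ᶠ z in 𝓝[S ×ˢ Icc 0 1] (x₀, s), ‖Φ z - Φ (x₀, s)‖ < ε / 2 := by
      have := Metric.tendsto_nhds.1 h1 (ε / 2) (by positivity)
      simpa [dist_eq_norm] using this
    rw [eventually_nhdsWithin_iff] at h2
    have h3 : ∀ᶠ z : X × ℝ in 𝓝 (x₀, s), (x₀, z.2) ∈ S ×ˢ Icc (0 : ℝ) 1 →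
        ‖Φ (x₀, z.2) - Φ (x₀, s)‖ < ε / 2 := by
      have hc : Filter.Tendsto (fun z : X × ℝ => (x₀, z.2)) (𝓝 (x₀, s)) (𝓝 (x₀, s)) :=
        (Continuous.tendsto (by fun_prop) _)
      exact hc.eventually h2
    filter_upwards [h2, h3] with z hz1 hz2 hzs hzS
    have a1 := hz1 ⟨hzS, hzs⟩
    have a2 := hz2 ⟨hx₀, hzs⟩
    calc ‖Φ (z.1, z.2) - Φ (x₀, z.2)‖
        = ‖(Φ z - Φ (x₀, s)) - (Φ (x₀, z.2) - Φ (x₀, s))‖ := by congr 1; abel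
      _ ≤ ‖Φ z - Φ (x₀, s)‖ + ‖Φ (x₀, z.2) - Φ (x₀, s)‖ := norm_sub_le _ _
      _ ≤ ε := by linarith
  filter_upwards [key] with x hx s hs hxS using hx s hs hs hxS

theorem intervalIntegrable_of_continuousOn_prod {X F : Type*} [TopologicalSpace X]
    [NormedAddCommGroup F] {S : Set X} {Φ : X × ℝ → F}
    (hΦ : ContinuousOn Φ (S ×ˢ Icc 0 1)) {x : X} (hx : x ∈ S) :
    IntervalIntegrable (fun s => Φ (x, s)) volume 0 1 := by
  apply ContinuousOn.intervalIntegrable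
  rw [uIcc_of_le zero_le_one]
  exact hΦ.comp (by fun_prop) fun s hs => ⟨hx, hs⟩

theorem continuousOn_integral_unitInterval {X F : Type*} [TopologicalSpace X]
    [NormedAddCommGroup F] [NormedSpace ℝ F] {S : Set X} {Φ : X × ℝ → F}
    (hΦ : ContinuousOn Φ (S ×ˢ Icc 0 1)) :
    ContinuousOn (fun x => ∫ s in (0 : ℝ)..1, Φ (x, s)) S := by
  intro x₀ hx₀
  refine Metric.tendsto_nhds.2 fun ε hε => ?_
  have h := eventually_forall_norm_sub_le hΦ hx₀ (half_pos hε)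
  filter_upwards [h.filter_mono nhdsWithin_le_nhds, self_mem_nhdsWithin] with x hx hxS
  rw [dist_eq_norm, ← intervalIntegral.integral_sub
    (intervalIntegrable_of_continuousOn_prod hΦ hxS)
    (intervalIntegrable_of_continuousOn_prod hΦ hx₀)]
  have := intervalIntegral.norm_integral_le_of_norm_le_const (a := (0 : ℝ)) (b := 1)
    (C := ε / 2) (f := fun s => Φ (x, s) - Φ (x₀, s)) (by
      intro s hs
      rw [uIoc_of_le zero_le_one] at hs
      exact hx s ⟨hs.1.le, hs.2⟩ hxS)
  simp only [sub_zero, abs_one, mul_one] at this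
  linarith

/-- Differentiation under the integral sign, within a convex set. -/
theorem hasFDerivWithinAt_integral_unitInterval [CompleteSpace F] {S : Set E} (hS : Convex ℝ S)
    {Φ : E × ℝ → F} {Φ' : E × ℝ → E →L[ℝ] F} (hΦ : ContinuousOn Φ (S ×ˢ Icc 0 1))
    (hΦ' : ContinuousOn Φ' (S ×ˢ Icc 0 1))
    (hd : ∀ x ∈ S, ∀ s ∈ Icc (0 : ℝ) 1, HasFDerivWithinAt (fun y => Φ (y, s)) (Φ' (x, s)) S x)
    {x₀ : E} (hx₀ : x₀ ∈ S) :
    HasFDerivWithinAt (fun x => ∫ s in (0 : ℝ)..1, Φ (x, s))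
      (∫ s in (0 : ℝ)..1, Φ' (x₀, s)) S x₀ := by
  rw [hasFDerivWithinAt_iff_isLittleO, Asymptotics.isLittleO_iff]
  intro ε hε
  have h := eventually_forall_norm_sub_le hΦ' hx₀ hε
  obtain ⟨r, hr, hball⟩ := Metric.eventually_nhds_iff_ball.1 h
  filter_upwards [nhdsWithin_le_nhds (Metric.ball_mem_nhds x₀ hr), self_mem_nhdsWithin]
    with x hx hxS
  have hI1 := intervalIntegrable_of_continuousOn_prod hΦ hxS
  have hI2 := intervalIntegrable_of_continuousOn_prod hΦ hx₀
  have hI3 := intervalIntegrable_of_continuousOn_prod hΦ' hx₀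
  have hI4 : IntervalIntegrable (fun s => Φ' (x₀, s) (x - x₀)) volume 0 1 := by
    apply ContinuousOn.intervalIntegrable
    rw [uIcc_of_le zero_le_one]
    have : ContinuousOn (fun s => Φ' (x₀, s)) (Icc (0 : ℝ) 1) :=
      hΦ'.comp (by fun_prop) fun s hs => ⟨hx₀, hs⟩
    exact this.clm_apply continuousOn_const
  rw [ContinuousLinearMap.intervalIntegral_apply hI3, ← intervalIntegral.integral_sub hI1 hI2,
    ← intervalIntegral.integral_sub (hI1.sub hI2) hI4]
  have := intervalIntegral.norm_integral_le_of_norm_le_const (a := (0 : ℝ)) (b := 1)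
    (C := ε * ‖x - x₀‖)
    (f := fun s => Φ (x, s) - Φ (x₀, s) - Φ' (x₀, s) (x - x₀)) (by
      intro s hs
      rw [uIoc_of_le zero_le_one] at hs
      have hs' : s ∈ Icc (0 : ℝ) 1 := ⟨hs.1.le, hs.2⟩
      -- Mean value inequality for fixed `s`: on the convex set `S ∩ ball x₀ r` the derivative stays
      -- within `ε` of `Φ' (x₀, s)`, with the same `r` for all `s`.
      apply (hS.inter (convex_ball x₀ r)).norm_image_sub_le_of_norm_hasFDerivWithin_le'
        (f := fun y => Φ (y, s)) (f' := fun y => Φ' (y, s))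
      · exact fun y hy => (hd y hy.1 s hs').mono inter_subset_left
      · exact fun y hy => hball y hy.2 s hs' hy.1
      · exact ⟨hx₀, Metric.mem_ball_self hr⟩
      · exact ⟨hxS, hx⟩)
  simpa using this

/-- Induction on the order of differentiability. The target space is quantified after `m` because
the step replaces `F` by `E →L[ℝ] F`; taking both spaces in `Type` keeps this new target in the same
universe. -/
theorem contDiffOn_integral_unitInterval_nat {E : Type} [NormedAddCommGroup E] [NormedSpace ℝ E]
    {S : Set E} (hS : Convex ℝ S) (hu : UniqueDiffOn ℝ S)
    (m : ℕ) : ∀ {F : Type} [NormedAddCommGroup F] [NormedSpace ℝ F] [CompleteSpace F]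
      {Φ : E × ℝ → F}, ContDiffOn ℝ m Φ (S ×ˢ Icc 0 1) →
    ContDiffOn ℝ m (fun x => ∫ s in (0 : ℝ)..1, Φ (x, s)) S := by
  have hu2 : UniqueDiffOn ℝ (S ×ˢ Icc (0 : ℝ) 1) := hu.prod uniqueDiffOn_Icc_zero_one
  induction m with
  | zero =>
    intro F _ _ _ Φ h
    simp only [Nat.cast_zero, contDiffOn_zero] at h ⊢
    exact continuousOn_integral_unitInterval h
  | succ m ih =>
    intro F _ _ _ Φ h
    push_cast at h ⊢
    have h' := (contDiffOn_succ_iff_fderivWithin hu2).1 h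
    set Φ' : E × ℝ → E →L[ℝ] F := fun z =>
      (fderivWithin ℝ Φ (S ×ˢ Icc (0 : ℝ) 1) z).comp (ContinuousLinearMap.inl ℝ E ℝ) with hΦ'
    have hc : ContDiffOn ℝ m Φ' (S ×ˢ Icc 0 1) :=
      h'.2.2.clm_comp contDiffOn_const
    rw [contDiffOn_succ_iff_hasFDerivWithinAt_of_uniqueDiffOn hu]
    refine ⟨by simp, fun x => ∫ s in (0 : ℝ)..1, Φ' (x, s), ih hc, fun x hx => ?_⟩
    refine hasFDerivWithinAt_integral_unitInterval hS h.continuousOn hc.continuousOn ?_ hx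
    intro y hy s hs
    have h1 := (h'.1 (y, s) ⟨hy, hs⟩).hasFDerivWithinAt
    have h2 : HasFDerivWithinAt (fun y : E => (y, s)) (ContinuousLinearMap.inl ℝ E ℝ) S y :=
      (hasFDerivAt_prodMk_left y s).hasFDerivWithinAt
    have h3 : MapsTo (fun y : E => (y, s)) S (S ×ˢ Icc (0 : ℝ) 1) := fun z hz => ⟨hz, hs⟩
    exact h1.comp y h2 h3

theorem contDiffOn_integral_unitInterval {E F : Type} [NormedAddCommGroup E] [NormedSpace ℝ E]
    [NormedAddCommGroup F] [NormedSpace ℝ F] [CompleteSpace F]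
    {S : Set E} (hS : Convex ℝ S) (hu : UniqueDiffOn ℝ S) {Φ : E × ℝ → F}
    (hΦ : ContDiffOn ℝ ∞ Φ (S ×ˢ Icc 0 1)) :
    ContDiffOn ℝ ∞ (fun x => ∫ s in (0 : ℝ)..1, Φ (x, s)) S := by
  rw [contDiffOn_infty] at hΦ ⊢
  exact fun m => contDiffOn_integral_unitInterval_nat hS hu m (hΦ m)

/-- Smooth dependence on parameters of integrals over the unit interval, on manifolds. -/
theorem contMDiffOn_integral_unitInterval {E F : Type} [NormedAddCommGroup E] [NormedSpace ℝ E]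
    [NormedAddCommGroup F] [NormedSpace ℝ F] [CompleteSpace F]
    {H : Type*} [TopologicalSpace H] (I : ModelWithCorners ℝ E H) {M : Type*} [TopologicalSpace M]
    [ChartedSpace H M] [IsManifold I ∞ M] {V : Set M} (hV : IsOpen V) {Φ : M × ℝ → F}
    (hΦ : ContMDiffOn (I.prod 𝓘(ℝ, ℝ)) 𝓘(ℝ, F) ∞ Φ (V ×ˢ univ)) :
    ContMDiffOn I 𝓘(ℝ, F) ∞ (fun x => ∫ s in (0 : ℝ)..1, Φ (x, s)) V := by
  intro x₀ hx₀
  apply ContMDiffAt.contMDiffWithinAt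
  set φ := extChartAt I x₀ with hφ
  have hO : (extChartAt I x₀).target ∩ φ.symm ⁻¹' V ∈ 𝓝[range I] (φ x₀) := by
    refine Filter.inter_mem (extChartAt_target_mem_nhdsWithin x₀) ?_
    have := (continuousAt_extChartAt_symm (I := I) x₀).preimage_mem_nhds
      (t := V) (by rw [extChartAt_to_inv]; exact hV.mem_nhds hx₀)
    exact mem_nhdsWithin_of_mem_nhds this
  obtain ⟨r, hr, hball⟩ := Metric.mem_nhdsWithin_iff.1 hO
  -- A ball cut with the range of the model is convex, which the target of the chart need not be.
  set S := Metric.ball (φ x₀) r ∩ range I with hSdef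
  have hSc : Convex ℝ S := (convex_ball _ _).inter I.convex_range
  have hSu : UniqueDiffOn ℝ S := by
    rw [hSdef, inter_comm]; exact I.uniqueDiffOn.inter Metric.isOpen_ball
  have hsm : ContDiffOn ℝ ∞ (fun z : E × ℝ => Φ (φ.symm z.1, z.2)) (S ×ˢ Icc 0 1) := by
    rw [← contMDiffOn_iff_contDiffOn]
    have h1 : ContMDiffOn 𝓘(ℝ, E × ℝ) (I.prod 𝓘(ℝ, ℝ)) ∞
        (fun z : E × ℝ => (φ.symm z.1, z.2)) (S ×ˢ Icc 0 1) := by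
      apply ContMDiffOn.prodMk
      · exact (contMDiffOn_extChartAt_symm x₀).comp contDiff_fst.contMDiff.contMDiffOn
          fun z hz => (hball hz.1).1
      · exact contDiff_snd.contMDiff.contMDiffOn
    exact hΦ.comp h1 fun z hz => ⟨(hball hz.1).2, mem_univ _⟩
  have hint := contDiffOn_integral_unitInterval hSc hSu hsm
  rw [contMDiffAt_iff_source, contMDiffWithinAt_iff_contDiffWithinAt]
  have hS : S ∈ 𝓝[range I] (φ x₀) :=
    Filter.inter_mem (mem_nhdsWithin_of_mem_nhds (Metric.ball_mem_nhds _ hr)) self_mem_nhdsWithin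
  have hmem : φ x₀ ∈ S := ⟨Metric.mem_ball_self hr, mem_range_self _⟩
  exact (hint _ hmem).mono_of_mem_nhdsWithin hS

end ParametricIntegral

end

section

/-! ### Calculus on half-spaces: the inverse function theorem and Hadamard's lemma. -/

section HalfSpace

variable {E F : Type*} [NormedAddCommGroup E] [NormedSpace ℝ E] [NormedAddCommGroup F]
  [NormedSpace ℝ F]

/-- The Lipschitz retraction onto the half-space `0 ≤ ℓ` along the direction `e`. -/
def halfSpaceRetraction (ℓ : E →L[ℝ] ℝ) (e : E) (x : E) : E := x + max (-ℓ x) 0 • e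

theorem halfSpaceRetraction_of_nonneg {ℓ : E →L[ℝ] ℝ} {e x : E} (hx : 0 ≤ ℓ x) :
    halfSpaceRetraction ℓ e x = x := by
  simp [halfSpaceRetraction, hx]

theorem halfSpaceRetraction_of_neg {ℓ : E →L[ℝ] ℝ} {e x : E} (hx : ℓ x < 0) :
    halfSpaceRetraction ℓ e x = x - ℓ x • e := by
  rw [halfSpaceRetraction, max_eq_left (by linarith), neg_smul, sub_eq_add_neg]

theorem apply_halfSpaceRetraction_nonneg {ℓ : E →L[ℝ] ℝ} {e : E} (he : ℓ e = 1) (x : E) :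
    0 ≤ ℓ (halfSpaceRetraction ℓ e x) := by
  rcases le_or_gt 0 (ℓ x) with h | h
  · rwa [halfSpaceRetraction_of_nonneg h]
  · rw [halfSpaceRetraction_of_neg h]; simp [he]

theorem norm_halfSpaceRetraction_sub_le (ℓ : E →L[ℝ] ℝ) (e x y : E) :
    ‖halfSpaceRetraction ℓ e x - halfSpaceRetraction ℓ e y‖ ≤ (1 + ‖ℓ‖ * ‖e‖) * ‖x - y‖ := by
  have h1 : |max (-ℓ x) 0 - max (-ℓ y) 0| ≤ ‖ℓ‖ * ‖x - y‖ := by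
    refine (abs_max_sub_max_le_abs _ _ _).trans ?_
    have : -ℓ x - -ℓ y = -(ℓ (x - y)) := by rw [map_sub]; ring
    rw [this, abs_neg]
    exact ℓ.le_opNorm _
  have h2 : halfSpaceRetraction ℓ e x - halfSpaceRetraction ℓ e y
      = (x - y) + (max (-ℓ x) 0 - max (-ℓ y) 0) • e := by
    simp only [halfSpaceRetraction, sub_smul]; abel
  rw [h2]
  refine (norm_add_le _ _).trans ?_
  rw [norm_smul, Real.norm_eq_abs]
  nlinarith [mul_le_mul_of_nonneg_right h1 (norm_nonneg e)]

theorem continuous_halfSpaceRetraction (ℓ : E →L[ℝ] ℝ) (e : E) :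
    Continuous (halfSpaceRetraction ℓ e) := by
  unfold halfSpaceRetraction; fun_prop

theorem uniqueDiffOn_halfSpace {ℓ : E →L[ℝ] ℝ} {e : E} (he : 0 < ℓ e) :
    UniqueDiffOn ℝ {x | 0 ≤ ℓ x} := by
  apply uniqueDiffOn_convex
  · exact (convex_Ici (𝕜 := ℝ) (0 : ℝ)).linear_preimage ℓ.toLinearMap
  · refine ⟨e, interior_mono (s := {x | 0 < ℓ x}) (fun x (hx : 0 < ℓ x) => hx.le) ?_⟩
    rw [(isOpen_lt continuous_const ℓ.continuous).interior_eq]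
    exact he

theorem convex_halfSpace (ℓ : E →L[ℝ] ℝ) : Convex ℝ {x | 0 ≤ ℓ x} :=
  (convex_Ici (𝕜 := ℝ) (0 : ℝ)).linear_preimage ℓ.toLinearMap

/-- The affine extension across the boundary of a `C¹` map on a half-space is strictly
differentiable. -/
theorem hasStrictFDerivAt_halfSpace_extension {ℓ : E →L[ℝ] ℝ} {e : E} (he : ℓ e = 1) {O : Set E}
    (hO : IsOpen O) {G : E → F} (hG : ContDiffOn ℝ 1 G ({x | 0 ≤ ℓ x} ∩ O)) {p : E} (hp : p ∈ O)
    (hp0 : 0 ≤ ℓ p) {L : E →L[ℝ] F} (hL : HasFDerivWithinAt G L {x | 0 ≤ ℓ x} p) :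
    HasStrictFDerivAt (fun x => G (halfSpaceRetraction ℓ e x) + L (x - halfSpaceRetraction ℓ e x))
      L p := by
  set S := {x | 0 ≤ ℓ x} with hS
  have hu : UniqueDiffOn ℝ (S ∩ O) := (uniqueDiffOn_halfSpace (by rw [he]; norm_num)).inter hO
  have hD := hG.continuousOn_fderivWithin hu le_rfl
  have hpm : p ∈ S ∩ O := ⟨hp0, hp⟩
  have hDp : fderivWithin ℝ G (S ∩ O) p = L := (hL.mono inter_subset_left).fderivWithin (hu p hpm)
  set K := 1 + ‖ℓ‖ * ‖e‖ with hK
  have hK0 : 0 < K := by positivity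
  rw [hasStrictFDerivAt_iff_isLittleO, Asymptotics.isLittleO_iff]
  intro c hc
  have h1 : ∀ᶠ x in 𝓝[S ∩ O] p, ‖fderivWithin ℝ G (S ∩ O) x - L‖ < c / K := by
    have := Metric.tendsto_nhds.1 (hD p hpm) (c / K) (by positivity)
    simpa [dist_eq_norm, hDp] using this
  rw [nhdsWithin_inter_of_mem' (mem_nhdsWithin_of_mem_nhds (hO.mem_nhds hp)),
    eventually_nhdsWithin_iff] at h1
  obtain ⟨r, hr, hball⟩ := Metric.eventually_nhds_iff_ball.1 (h1.and (hO.eventually_mem hp))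
  have hret : Filter.Tendsto (halfSpaceRetraction ℓ e) (𝓝 p) (𝓝 p) := by
    have := (continuous_halfSpaceRetraction ℓ e).tendsto p
    rwa [halfSpaceRetraction_of_nonneg hp0] at this
  have hev : ∀ᶠ x in 𝓝 p, halfSpaceRetraction ℓ e x ∈ Metric.ball p r :=
    hret.eventually (Metric.ball_mem_nhds p hr)
  have hev2 := (hev.prod_nhds hev)
  filter_upwards [hev2] with z hz
  set x' := halfSpaceRetraction ℓ e z.1 with hx'
  set y' := halfSpaceRetraction ℓ e z.2 with hy'
  have hmv : ‖G x' - G y' - L (x' - y')‖ ≤ c / K * ‖x' - y'‖ := by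
    apply ((convex_halfSpace ℓ).inter (convex_ball p r)).norm_image_sub_le_of_norm_hasFDerivWithin_le'
      (f' := fun x => fderivWithin ℝ G (S ∩ O) x)
    · intro x hx
      exact ((hG.differentiableOn (by simp)) x ⟨hx.1, (hball x hx.2).2⟩).hasFDerivWithinAt.mono
        fun w hw => ⟨hw.1, (hball w hw.2).2⟩
    · exact fun x hx => ((hball x hx.2).1 hx.1).le
    · exact ⟨apply_halfSpaceRetraction_nonneg he _, hz.2⟩
    · exact ⟨apply_halfSpaceRetraction_nonneg he _, hz.1⟩
  -- The affine correction cancels exactly, so the remainder of the extension is that of `G` at the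
  -- retracted points, where the mean value inequality applies; `K` is a Lipschitz constant of the
  -- retraction.
  have heq : G x' + L (z.1 - x') - (G y' + L (z.2 - y')) - L (z.1 - z.2)
      = G x' - G y' - L (x' - y') := by
    simp only [map_sub]; abel
  rw [heq]
  refine hmv.trans ?_
  calc c / K * ‖x' - y'‖ ≤ c / K * (K * ‖z.1 - z.2‖) := by
        gcongr
        exact norm_halfSpaceRetraction_sub_le ℓ e z.1 z.2
    _ = c * ‖z.1 - z.2‖ := by field_simp

/-- Smoothness of an inverse, within a set of unique differentiability. -/
theorem contDiffOn_of_inverse [CompleteSpace E] {G : E → F} {k : F → E} {S : Set E}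
    {T : Set F} (hu : UniqueDiffOn ℝ S) (hT : UniqueDiffOn ℝ T) (hG : ContDiffOn ℝ ∞ G S)
    (hk : ContinuousOn k T) (hkm : MapsTo k T S) (hGk : ∀ y ∈ T, G (k y) = y)
    (hinv : ∀ y ∈ T, ∃ L : E ≃L[ℝ] F, (L : E →L[ℝ] F) = fderivWithin ℝ G S (k y)) :
    ContDiffOn ℝ ∞ k T := by
  have hder : ∀ y ∈ T, HasFDerivWithinAt k
      (ContinuousLinearMap.inverse (fderivWithin ℝ G S (k y))) T y := by
    intro y hy
    obtain ⟨L, hL⟩ := hinv y hy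
    have h1 := ((hG.differentiableOn (by simp)) (k y) (hkm hy)).hasFDerivWithinAt
    rw [← hL] at h1 ⊢
    rw [ContinuousLinearMap.inverse_equiv]
    refine HasFDerivWithinAt.of_local_left_inverse ?_ h1 hy ?_
    · exact tendsto_nhdsWithin_iff.2 ⟨hk y hy, eventually_mem_nhdsWithin.mono fun z hz => hkm hz⟩
    · exact eventually_mem_nhdsWithin.mono fun z hz => hGk z hz
  -- Bootstrapping: `hder` expresses the derivative of `k` through `k` itself, so each order of
  -- smoothness yields the next.
  rw [contDiffOn_infty]
  intro m
  induction m with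
  | zero => simpa using hk
  | succ m ih =>
    push_cast
    rw [contDiffOn_succ_iff_hasFDerivWithinAt_of_uniqueDiffOn hT]
    refine ⟨by simp, _, ?_, hder⟩
    intro y hy
    obtain ⟨L, hL⟩ := hinv y hy
    have h1 : ContDiffAt ℝ m (ContinuousLinearMap.inverse (M := E) (M₂ := F) (R := ℝ))
        (fderivWithin ℝ G S (k y)) := by
      rw [← hL]; exact contDiffAt_map_inverse L
    have h2 : ContDiffOn ℝ m (fun x => fderivWithin ℝ G S x) S :=
      hG.fderivWithin hu (by exact_mod_cast le_top)
    exact h1.comp_contDiffWithinAt y ((h2.comp ih hkm) y hy)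

/-- The inverse function theorem at a boundary point of a half-space, for maps preserving the
boundary and the interior. -/
theorem exists_openPartialHomeomorph_halfSpace [CompleteSpace E] [CompleteSpace F]
    {ℓ : E →L[ℝ] ℝ} {e : E} (he : ℓ e = 1) {μ : F →L[ℝ] ℝ} {O : Set E}
    (hO : IsOpen O) {G : E → F} (hG : ContDiffOn ℝ ∞ G ({x | 0 ≤ ℓ x} ∩ O)) {p : E} (hp : p ∈ O)
    (hp0 : ℓ p = 0) (h0 : ∀ x ∈ O, ℓ x = 0 → μ (G x) = 0)
    (hpos : ∀ x ∈ O, 0 < ℓ x → 0 < μ (G x)) {L : E ≃L[ℝ] F}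
    (hL : HasFDerivWithinAt G (L : E →L[ℝ] F) {x | 0 ≤ ℓ x} p) (hLe : 0 < μ (L e)) :
    ∃ g : OpenPartialHomeomorph E F, p ∈ g.source ∧ g.source ⊆ O ∧
      (∀ x ∈ g.source, 0 ≤ ℓ x → g x = G x) ∧ (∀ x ∈ g.source, 0 ≤ μ (g x) ↔ 0 ≤ ℓ x) ∧
      ContDiffOn ℝ ∞ g.symm (g.target ∩ {y | 0 ≤ μ y}) := by
  set S := {x | 0 ≤ ℓ x} with hS
  have hS1 : UniqueDiffOn ℝ S := uniqueDiffOn_halfSpace (by rw [he]; norm_num)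
  have hu : UniqueDiffOn ℝ (S ∩ O) := hS1.inter hO
  have hpm : p ∈ S ∩ O := ⟨hp0.ge, hp⟩
  set π := halfSpaceRetraction ℓ e with hπ
  -- `G'` continues `G` affinely across the boundary. It is strictly differentiable at `p`, enough
  -- for the ordinary inverse function theorem, but need not be smooth; smoothness of the inverse is
  -- therefore proved on the half-space only.
  set G' : E → F := fun x => G (π x) + (L : E →L[ℝ] F) (x - π x) with hG'
  have hstr : HasStrictFDerivAt G' (L : E →L[ℝ] F) p :=
    hasStrictFDerivAt_halfSpace_extension he hO (hG.of_le (by simp)) hp hp0.ge hL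
  set g₀ := hstr.toOpenPartialHomeomorph G' with hg₀
  have hD := hG.continuousOn_fderivWithin hu (by simp)
  have hDp : fderivWithin ℝ G (S ∩ O) p = L := (hL.mono inter_subset_left).fderivWithin (hu p hpm)
  have hev : ∀ᶠ x in 𝓝[S ∩ O] p, fderivWithin ℝ G (S ∩ O) x ∈
      range ((↑) : (E ≃L[ℝ] F) → E →L[ℝ] F) := by
    apply (hD p hpm)
    rw [hDp]
    exact ContinuousLinearEquiv.nhds L
  rw [nhdsWithin_inter_of_mem' (mem_nhdsWithin_of_mem_nhds (hO.mem_nhds hp)),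
    eventually_nhdsWithin_iff] at hev
  obtain ⟨W, hW, hWo, hpW⟩ := eventually_nhds_iff.1 hev
  have hπc : Continuous π := continuous_halfSpaceRetraction ℓ e
  have hsO : IsOpen (W ∩ (O ∩ π ⁻¹' O)) := hWo.inter (hO.inter (hO.preimage hπc))
  set g := g₀.restrOpen _ hsO with hg
  have hsrc : ∀ x ∈ g.source, x ∈ W ∧ x ∈ O ∧ π x ∈ O := by
    intro x hx
    rw [hg, OpenPartialHomeomorph.restrOpen_source] at hx
    exact hx.2
  have hgG : ∀ x, 0 ≤ ℓ x → g x = G x := by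
    intro x hx0
    change G' x = G x
    simp [hG', hπ, halfSpaceRetraction_of_nonneg hx0]
  have hsign : ∀ x ∈ g.source, 0 ≤ μ (g x) ↔ 0 ≤ ℓ x := by
    intro x hx
    rcases le_or_gt 0 (ℓ x) with h | h
    · rw [hgG x h]
      refine iff_of_true ?_ h
      rcases h.eq_or_lt with h' | h'
      · exact (h0 x (hsrc x hx).2.1 h'.symm).ge
      · exact (hpos x (hsrc x hx).2.1 h').le
    · refine iff_of_false ?_ (not_le.2 h)
      change ¬ 0 ≤ μ (G' x)
      have hx2 : π x = x - ℓ x • e := halfSpaceRetraction_of_neg h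
      -- Outside the half-space `π x` lies on the boundary, so only the affine term `ℓ x * μ (L e)`
      -- remains, and it is negative.
      have h3 : μ (G (π x)) = 0 := h0 _ (hsrc x hx).2.2 (by rw [hx2]; simp [he])
      simp only [hG', map_add, h3, zero_add, not_le]
      rw [hx2, sub_sub_cancel]
      simp only [map_smul, smul_eq_mul]
      exact mul_neg_of_neg_of_pos h hLe
  have hgs : ∀ y ∈ g.target ∩ {y | 0 ≤ μ y}, g.symm y ∈ g.source ∧ 0 ≤ ℓ (g.symm y) ∧
      G (g.symm y) = y := by
    intro y hy
    have h1 := g.map_target hy.1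
    have h2 : 0 ≤ ℓ (g.symm y) := by
      rw [← hsign _ h1, g.right_inv hy.1]; exact hy.2
    exact ⟨h1, h2, by rw [← hgG _ h2, g.right_inv hy.1]⟩
  refine ⟨g, ?_, fun x hx => (hsrc x hx).2.1, fun x _ => hgG x, hsign, ?_⟩
  · rw [hg, OpenPartialHomeomorph.restrOpen_source]
    refine ⟨hstr.mem_toOpenPartialHomeomorph_source, hpW, hp, ?_⟩
    simpa [hπ, halfSpaceRetraction_of_nonneg hp0.ge] using hp
  · refine contDiffOn_of_inverse hu ?_ hG (g.continuousOn_symm.mono inter_subset_left) ?_ ?_ ?_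
    · rw [inter_comm]; exact (uniqueDiffOn_halfSpace hLe).inter g.open_target
    · exact fun y hy => ⟨(hgs y hy).2.1, (hsrc _ (hgs y hy).1).2.1⟩
    · exact fun y hy => (hgs y hy).2.2
    · intro y hy
      obtain ⟨h1, h2, h3⟩ := hgs y hy
      exact hW _ (hsrc _ h1).1 h2

end HalfSpace

/-- Hadamard's lemma at the boundary of a half-space: a smooth function vanishing on the boundary
is divisible by the defining functional. -/
theorem exists_eq_mul_of_eq_zero_on_boundary {E : Type} [NormedAddCommGroup E] [NormedSpace ℝ E]
    {ℓ : E →L[ℝ] ℝ} {e : E} (he : ℓ e = 1) {O : Set E} (hO : IsOpen O) {f : E → ℝ}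
    (hf : ContDiffOn ℝ ∞ f ({x | 0 ≤ ℓ x} ∩ O)) {p : E} (hp : p ∈ O) (hp0 : ℓ p = 0)
    (h0 : ∀ x ∈ O, ℓ x = 0 → f x = 0) :
    ∃ (O' : Set E) (g : E → ℝ), IsOpen O' ∧ p ∈ O' ∧ O' ⊆ O ∧
      ContDiffOn ℝ ∞ g ({x | 0 ≤ ℓ x} ∩ O') ∧ (∀ x ∈ {x | 0 ≤ ℓ x} ∩ O', f x = ℓ x * g x) ∧
      ∀ L : E →L[ℝ] ℝ, HasFDerivWithinAt f L {x | 0 ≤ ℓ x} p → g p = L e := by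
  set S := {x | 0 ≤ ℓ x} with hS
  have hS1 : UniqueDiffOn ℝ S := uniqueDiffOn_halfSpace (by rw [he]; norm_num)
  obtain ⟨r, hr, hrO⟩ := Metric.isOpen_iff.1 hO p hp
  set B := Metric.ball p r with hB
  have hfB : ContDiffOn ℝ ∞ f (S ∩ B) := hf.mono (inter_subset_inter_right _ hrO)
  have hu : UniqueDiffOn ℝ (S ∩ B) := hS1.inter Metric.isOpen_ball
  set K := 1 + ‖ℓ‖ * ‖e‖ with hK
  have hK1 : 1 ≤ K := by rw [hK]; linarith [mul_nonneg (norm_nonneg ℓ) (norm_nonneg e)]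
  have hK0 : 0 < K := by linarith
  -- `γ (x, ·)` runs along `e` from the projection of `x` to the boundary, where `f` vanishes, to
  -- `x`. Distances to `p` grow by a factor at most `K`, whence the radius `r / K`. The quotient is
  -- the integral over `s` of the derivative of `f` in direction `e`.
  set γ : E × ℝ → E := fun z => z.1 - ((1 - z.2) * ℓ z.1) • e with hγ
  have hγs : ContDiff ℝ ∞ γ := by rw [hγ]; fun_prop
  have hγm : ∀ z ∈ (S ∩ Metric.ball p (r / K)) ×ˢ Icc (0 : ℝ) 1, γ z ∈ S ∩ B := by
    rintro ⟨x, s⟩ ⟨⟨hx, hxb⟩, hs0, hs1⟩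
    have hx' : 0 ≤ ℓ x := hx
    simp only at hs0 hs1 hxb
    constructor
    · change 0 ≤ ℓ (x - ((1 - s) * ℓ x) • e)
      rw [map_sub, map_smul, he, smul_eq_mul, mul_one]
      nlinarith
    · rw [hB, mem_ball_iff_norm]
      rw [mem_ball_iff_norm, lt_div_iff₀ hK0] at hxb
      have h1 : |ℓ x| ≤ ‖ℓ‖ * ‖x - p‖ := by
        have := ℓ.le_opNorm (x - p)
        rwa [map_sub, hp0, sub_zero, Real.norm_eq_abs] at this
      have h2 : |1 - s| ≤ 1 := by rw [abs_le]; constructor <;> linarith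
      calc ‖γ (x, s) - p‖ = ‖(x - p) - ((1 - s) * ℓ x) • e‖ := by
            congr 1; simp only [hγ]; abel
        _ ≤ ‖x - p‖ + ‖((1 - s) * ℓ x) • e‖ := norm_sub_le _ _
        _ = ‖x - p‖ + |1 - s| * |ℓ x| * ‖e‖ := by rw [norm_smul, Real.norm_eq_abs, abs_mul]
        _ ≤ ‖x - p‖ + 1 * (‖ℓ‖ * ‖x - p‖) * ‖e‖ := by gcongr
        _ = ‖x - p‖ * K := by rw [hK]; ring
        _ < r := hxb
  set D := fderivWithin ℝ f (S ∩ B) with hD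
  have hDs : ContDiffOn ℝ ∞ D (S ∩ B) := hfB.fderivWithin hu (by simp)
  refine ⟨Metric.ball p (r / K), fun x => ∫ s in (0 : ℝ)..1, D (γ (x, s)) e, Metric.isOpen_ball,
    Metric.mem_ball_self (by positivity), ?_, ?_, ?_, ?_⟩
  · exact (Metric.ball_subset_ball (div_le_self hr.le hK1)).trans hrO
  · apply contDiffOn_integral_unitInterval (Φ := fun z => D (γ z) e)
      ((convex_halfSpace ℓ).inter (convex_ball _ _)) (hS1.inter Metric.isOpen_ball)
    exact (hDs.comp hγs.contDiffOn hγm).clm_apply contDiffOn_const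
  · intro x hx
    have hm : MapsTo (fun s : ℝ => γ (x, s)) (Icc 0 1) (S ∩ B) := fun s hs => hγm (x, s) ⟨hx, hs⟩
    have hder : ∀ s ∈ Icc (0 : ℝ) 1, HasDerivWithinAt (fun s => f (γ (x, s)))
        (ℓ x * D (γ (x, s)) e) (Icc 0 1) s := by
      intro s hs
      have h1 := ((hfB.differentiableOn (by simp)) _ (hm hs)).hasFDerivWithinAt
      have h2 : HasDerivWithinAt (fun s : ℝ => γ (x, s)) (ℓ x • e) (Icc 0 1) s := by
        have h3 : HasDerivAt (fun s : ℝ => (1 - s) * ℓ x) (-ℓ x) s := by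
          simpa using ((hasDerivAt_id s).const_sub 1).mul_const (ℓ x)
        have := (h3.smul_const e).const_sub x
        simpa [hγ] using this.hasDerivWithinAt
      have h4 := h1.comp_hasDerivWithinAt s h2 hm
      rw [map_smul, smul_eq_mul] at h4
      exact h4
    have hint := intervalIntegral.integral_eq_sub_of_hasDerivAt_of_le zero_le_one
      (fun s hs => (hder s hs).continuousWithinAt)
      (fun s hs => (hder s ⟨hs.1.le, hs.2.le⟩).hasDerivAt (Icc_mem_nhds hs.1 hs.2)) (by
        apply ContinuousOn.intervalIntegrable
        rw [uIcc_of_le zero_le_one]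
        refine continuousOn_const.mul ?_
        exact (hDs.continuousOn.comp (by fun_prop) hm).clm_apply continuousOn_const)
    rw [intervalIntegral.integral_const_mul] at hint
    have h5 : γ (x, 1) = x := by simp [hγ]
    have h6 : f (γ (x, 0)) = 0 := by
      apply h0 _ (hrO (hm ⟨le_rfl, zero_le_one⟩).2)
      simp [hγ, he]
    rw [h5, h6, sub_zero] at hint
    exact hint.symm
  · intro L hL
    have hpm : p ∈ S ∩ B := ⟨hp0.ge, Metric.mem_ball_self hr⟩
    have h1 : D p = L := (hL.mono inter_subset_left).fderivWithin (hu p hpm)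
    have h2 : ∀ s, γ (p, s) = p := fun s => by simp [hγ, hp0]
    simp [h2, h1]

end

section

/-! ### The unit part of a complex number -/

/-- The unit part `z / |z|` of a complex number, as an element of the circle. -/
def unitPart (z : ℂ) : Circle := Circle.exp z.arg

theorem coe_unitPart (z : ℂ) : ((unitPart z : Circle) : ℂ) = Complex.exp (z.arg * Complex.I) := by
  simp [unitPart]

theorem norm_mul_unitPart (z : ℂ) : (‖z‖ : ℂ) * (unitPart z : ℂ) = z := by
  rw [coe_unitPart]; exact Complex.norm_mul_exp_arg_mul_I z

theorem eq_unitPart {z : ℂ} {r : ℝ} (hr : 0 < r) {a : Circle} (h : z = (a : ℂ) * r) :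
    unitPart z = a := by
  have hz : ‖z‖ = r := by rw [h, norm_mul, Circle.norm_coe]; simp [abs_of_pos hr]
  have h1 := norm_mul_unitPart z
  rw [hz] at h1
  have hr' : (r : ℂ) ≠ 0 := by exact_mod_cast hr.ne'
  apply Circle.coe_injective
  apply mul_left_cancel₀ hr'
  rw [h1, h, mul_comm]

theorem unitPart_mul (a : Circle) {z : ℂ} (hz : z ≠ 0) : unitPart (a * z) = a * unitPart z := by
  apply eq_unitPart (norm_pos_iff.2 hz)
  rw [Circle.coe_mul, mul_assoc, mul_comm _ (‖z‖ : ℂ), norm_mul_unitPart]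

theorem contDiffAt_arg {z : ℂ} (hz : z ∈ Complex.slitPlane) :
    ContDiffAt ℝ ∞ Complex.arg z := by
  have h1 : ContDiffAt ℝ ∞ Complex.log z := (Complex.contDiffAt_log hz).restrict_scalars ℝ
  have h2 : ContDiffAt ℝ ∞ (fun w : ℂ => Complex.imCLM (Complex.log w)) z :=
    Complex.imCLM.contDiff.contDiffAt.comp z h1
  exact h2.congr_of_eventuallyEq (Filter.Eventually.of_forall fun w => (Complex.log_im w).symm)

/-- The argument jumps on the negative real axis. Dividing by `z` first moves the question to a
neighbourhood of `1`, inside the slit plane. -/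
theorem contMDiffAt_unitPart {z : ℂ} (hz : z ≠ 0) :
    ContMDiffAt 𝓘(ℝ, ℂ) (𝓡 1) ∞ unitPart z := by
  have heq : unitPart =ᶠ[𝓝 z] fun w => unitPart z * Circle.exp (w / z).arg := by
    filter_upwards [isOpen_ne.mem_nhds hz] with w hw
    apply eq_unitPart (norm_pos_iff.2 hw)
    have hwz : w / z ≠ 0 := div_ne_zero hw hz
    have h1 := norm_mul_unitPart (w / z)
    have h2 := norm_mul_unitPart z
    rw [Circle.coe_mul]
    change w = (unitPart z : ℂ) * (unitPart (w / z) : ℂ) * ‖w‖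
    have h3 : (‖w‖ : ℂ) = ‖w / z‖ * ‖z‖ := by
      rw [norm_div]; push_cast
      rw [div_mul_cancel₀]
      exact_mod_cast (norm_pos_iff.2 hz).ne'
    rw [h3]
    calc w = (w / z) * z := by field_simp
      _ = (‖w / z‖ * (unitPart (w / z) : ℂ)) * (‖z‖ * (unitPart z : ℂ)) := by rw [h1, h2]
      _ = _ := by ring
  refine ContMDiffAt.congr_of_eventuallyEq ?_ heq
  have h1 : ContDiffAt ℝ ∞ (fun w : ℂ => (w / z).arg) z := by
    have : ContDiffAt ℝ ∞ (fun w : ℂ => w / z) z := contDiffAt_id.div_const z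
    exact ContDiffAt.comp z (g := Complex.arg)
      (contDiffAt_arg (by rw [div_self hz]; exact Complex.one_mem_slitPlane)) this
  have h2 : ContMDiffAt 𝓘(ℝ, ℂ) (𝓡 1) ∞ (fun w : ℂ => Circle.exp (w / z).arg) z :=
    ContMDiffAt.comp z (contMDiff_circleExp (m := ∞)).contMDiffAt h1.contMDiffAt
  exact ContMDiffAt.mul contMDiffAt_const h2

theorem contMDiff_circle_coe : ContMDiff (𝓡 1) 𝓘(ℝ, ℂ) ∞ (fun a : Circle => (a : ℂ)) := by
  have := finrank_real_complex_fact'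
  exact contMDiff_coe_sphere

/-! ### Averages over the circle -/

/-- The average of a function over the circle. -/
def circleAvg {F : Type*} [NormedAddCommGroup F] [NormedSpace ℝ F] (g : Circle → F) : F :=
  ∫ s in (0 : ℝ)..1, g (Circle.exp (2 * Real.pi * s))

section circleAvg

variable {F : Type*} [NormedAddCommGroup F] [NormedSpace ℝ F]

/-- Translation by `b` shifts the parameter of a function of period one, and integrals over a full
period do not change. -/
theorem circleAvg_mul_right (g : Circle → F) (b : Circle) :
    circleAvg (fun a => g (a * b)) = circleAvg g := by
  have hpi : (0 : ℝ) < 2 * Real.pi := by positivity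
  obtain ⟨t, rfl⟩ := Circle.exp_surjective b
  have hper : Function.Periodic (fun s : ℝ => g (Circle.exp (2 * Real.pi * s))) 1 := by
    intro s
    simp only [mul_add, mul_one]
    rw [Circle.exp_add, Circle.exp_two_pi, mul_one]
  unfold circleAvg
  have h1 : ∀ s : ℝ, g (Circle.exp (2 * Real.pi * s) * Circle.exp t)
      = (fun s : ℝ => g (Circle.exp (2 * Real.pi * s))) (s + t / (2 * Real.pi)) := by
    intro s
    simp only
    rw [← Circle.exp_add]
    congr 2
    field_simp
  simp_rw [h1]
  rw [intervalIntegral.integral_comp_add_right (fun s : ℝ => g (Circle.exp (2 * Real.pi * s)))]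
  have := hper.intervalIntegral_add_eq (t / (2 * Real.pi)) 0
  rw [zero_add] at this
  rw [zero_add, add_comm 1]
  exact this

theorem circleAvg_const [CompleteSpace F] (v : F) : circleAvg (fun _ => v) = v := by
  simp [circleAvg]

theorem circleAvg_nonneg {g : Circle → ℝ} (hg : ∀ a, 0 ≤ g a) : 0 ≤ circleAvg g :=
  intervalIntegral.integral_nonneg zero_le_one fun _ _ => hg _

theorem continuous_exp_two_pi : Continuous fun s : ℝ => Circle.exp (2 * Real.pi * s) :=
  Circle.exp.continuous.comp (by fun_prop)

theorem circleAvg_pos {g : Circle → ℝ} (hc : Continuous g) (hg : ∀ a, 0 ≤ g a) (h1 : 0 < g 1) :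
    0 < circleAvg g := by
  apply intervalIntegral.integral_pos zero_lt_one (hc.comp continuous_exp_two_pi).continuousOn
  · exact fun _ _ => hg _
  · exact ⟨0, ⟨le_rfl, zero_le_one⟩, by simpa using h1⟩

theorem contMDiffOn_circleAvg {E F : Type} [NormedAddCommGroup E] [NormedSpace ℝ E]
    [NormedAddCommGroup F] [NormedSpace ℝ F] [CompleteSpace F]
    {H : Type*} [TopologicalSpace H] {I : ModelWithCorners ℝ E H} {N : Type*} [TopologicalSpace N]
    [ChartedSpace H N] [IsManifold I ∞ N] {V : Set N} (hV : IsOpen V) {g : Circle → N → F}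
    (hg : ∀ a, ∀ x ∈ V, ContMDiffAt ((𝓡 1).prod I) 𝓘(ℝ, F) ∞
      (fun p : Circle × N => g p.1 p.2) (a, x)) :
    ContMDiffOn I 𝓘(ℝ, F) ∞ (fun x => circleAvg fun a => g a x) V := by
  refine contMDiffOn_integral_unitInterval I hV
    (Φ := fun p : N × ℝ => g (Circle.exp (2 * Real.pi * p.2)) p.1) ?_
  rintro ⟨x, s⟩ ⟨hx, -⟩
  apply ContMDiffAt.contMDiffWithinAt
  have h1 : ContMDiff 𝓘(ℝ, ℝ) (𝓡 1) ∞ (fun s : ℝ => Circle.exp (2 * Real.pi * s)) :=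
    contMDiff_circleExp.comp (contDiff_const.mul contDiff_id).contMDiff
  have h2 : ContMDiffAt (I.prod 𝓘(ℝ, ℝ)) ((𝓡 1).prod I) ∞
      (fun p : N × ℝ => (Circle.exp (2 * Real.pi * p.2), p.1)) (x, s) :=
    ((h1 s).comp (x, s) (contMDiffAt_snd (I := I) (J := 𝓘(ℝ, ℝ)))).prodMk contMDiffAt_fst
  exact (hg _ x hx).comp (x, s) h2

end circleAvg

/-! ### The partially defined circle action on `M` -/

section Action

variable {M : Type*} [TopologicalSpace M] (U : Opens M) [MulAction Circle U]

open Classical in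
/-- The action of the circle on `U`, extended by the identity outside of `U`. -/
def act (a : Circle) (x : M) : M :=
  if h : x ∈ U then ((a • (⟨x, h⟩ : U) : U) : M) else x

variable {U}

theorem act_of_mem {x : M} (h : x ∈ U) (a : Circle) :
    act U a x = ((a • (⟨x, h⟩ : U) : U) : M) := dif_pos h

theorem act_coe (a : Circle) (x : U) : act U a x = ((a • x : U) : M) := act_of_mem x.2 a

theorem act_mem {x : M} (h : x ∈ U) (a : Circle) : act U a x ∈ U := by
  rw [act_of_mem h]; exact Subtype.coe_prop _

theorem act_of_notMem {x : M} (h : x ∉ U) (a : Circle) : act U a x = x := dif_neg h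

theorem act_mul (a b : Circle) (x : M) : act U (a * b) x = act U a (act U b x) := by
  by_cases h : x ∈ U
  · lift x to U using h
    rw [act_coe, act_coe, act_coe, mul_smul]
  · rw [act_of_notMem h, act_of_notMem h, act_of_notMem h]

@[simp]
theorem act_one (x : M) : act U 1 x = x := by
  by_cases h : x ∈ U
  · lift x to U using h
    rw [act_coe, one_smul]
  · rw [act_of_notMem h]

@[simp]
theorem act_inv_act (a : Circle) (x : M) : act U a⁻¹ (act U a x) = x := by
  rw [← act_mul, inv_mul_cancel, act_one]

@[simp]
theorem act_act_inv (a : Circle) (x : M) : act U a (act U a⁻¹ x) = x := by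
  rw [← act_mul, mul_inv_cancel, act_one]

variable (U) in
/-- The largest invariant subset of `O ∩ U`. -/
def invariantCore (O : Set M) : Set M := {x | x ∈ U ∧ ∀ a, act U a x ∈ O}

theorem act_mem_invariantCore {O : Set M} {x : M} (hx : x ∈ invariantCore U O) (a : Circle) :
    act U a x ∈ invariantCore U O :=
  ⟨act_mem hx.1 a, fun b => by rw [← act_mul]; exact hx.2 _⟩

theorem invariantCore_subset (O : Set M) : invariantCore U O ⊆ O := fun x hx => by
  simpa using hx.2 1

variable {n : ℕ} [NeZero n] [ChartedSpace (EuclideanHalfSpace n) M]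

theorem IsFreeCircleActionNearBoundary.contMDiffOn_act
    (hU : IsFreeCircleActionNearBoundary n U) :
    ContMDiffOn ((𝓡 1).prod (𝓡∂ n)) (𝓡∂ n) ∞ (fun p : Circle × M => act U p.1 p.2)
      (univ ×ˢ (U : Set M)) := by
  classical
  rintro ⟨a, x⟩ ⟨-, hx⟩
  apply ContMDiffAt.contMDiffWithinAt
  -- A total left inverse of the inclusion of `U`; its value off `U` is irrelevant for smoothness at
  -- `x`.
  let k : M → U := fun y => if h : y ∈ U then ⟨y, h⟩ else ⟨x, hx⟩
  have hk : ContMDiffAt (𝓡∂ n) (𝓡∂ n) ∞ k x := by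
    have h1 : ContMDiffAt (𝓡∂ n) (𝓡∂ n) ∞ (fun y : U => k y) (⟨x, hx⟩ : U) := by
      have : (fun y : U => k y) = id := by
        ext y; simp [k, y.2]
      rw [this]; exact contMDiffAt_id
    exact contMDiffAt_subtype_iff.1 h1
  have h2 : ContMDiffAt ((𝓡 1).prod (𝓡∂ n)) ((𝓡 1).prod (𝓡∂ n)) ∞
      (fun p : Circle × M => (p.1, k p.2)) (a, x) :=
    contMDiffAt_fst.prodMk (ContMDiffAt.comp (a, x) (g := k) hk contMDiffAt_snd)
  have h3 : ContMDiffAt ((𝓡 1).prod (𝓡∂ n)) (𝓡∂ n) ∞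
      (fun p : Circle × M => ((p.1 • k p.2 : U) : M)) (a, x) :=
    ContMDiffAt.comp (a, x) (contMDiff_subtype_val (U := U)).contMDiffAt
      (ContMDiffAt.comp (a, x) (hU.smooth _) h2)
  refine h3.congr_of_eventuallyEq ?_
  have : ∀ᶠ p : Circle × M in 𝓝 (a, x), p.2 ∈ U :=
    continuous_snd.continuousAt.eventually_mem (U.isOpen.mem_nhds hx)
  filter_upwards [this] with p hp
  simp [act_of_mem hp, k, hp]

theorem IsFreeCircleActionNearBoundary.contMDiffWithinAt_act
    (hU : IsFreeCircleActionNearBoundary n U)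
    {E' H' N : Type*} [NormedAddCommGroup E'] [NormedSpace ℝ E'] [TopologicalSpace H']
    {J : ModelWithCorners ℝ E' H'} [TopologicalSpace N] [ChartedSpace H' N] {g : N → Circle}
    {h : N → M} {s : Set N} {y : N} (hg : ContMDiffWithinAt J (𝓡 1) ∞ g s y)
    (hh : ContMDiffWithinAt J (𝓡∂ n) ∞ h s y) (hy : h y ∈ U) :
    ContMDiffWithinAt J (𝓡∂ n) ∞ (fun y => act U (g y) (h y)) s y := by
  have h1 : ContMDiffAt ((𝓡 1).prod (𝓡∂ n)) (𝓡∂ n) ∞ (fun p : Circle × M => act U p.1 p.2)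
      (g y, h y) :=
    (hU.contMDiffOn_act _ ⟨mem_univ _, hy⟩).contMDiffAt
      ((isOpen_univ.prod U.isOpen).mem_nhds ⟨mem_univ _, hy⟩)
  exact ContMDiffAt.comp_contMDiffWithinAt y (f := fun y => (g y, h y)) h1 (hg.prodMk hh)

theorem IsFreeCircleActionNearBoundary.continuousAt_act
    (hU : IsFreeCircleActionNearBoundary n U) (a : Circle) {x : M} (hx : x ∈ U) :
    ContinuousAt (fun p : Circle × M => act U p.1 p.2) (a, x) :=
  hU.contMDiffOn_act.continuousOn.continuousAt
    ((isOpen_univ.prod U.isOpen).mem_nhds ⟨mem_univ _, hx⟩)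

theorem IsFreeCircleActionNearBoundary.continuous_act_left
    (hU : IsFreeCircleActionNearBoundary n U) {x : M} (hx : x ∈ U) :
    Continuous fun a => act U a x :=
  continuous_iff_continuousAt.2 fun a =>
    (hU.continuousAt_act a hx).comp (f := fun a => (a, x)) (by fun_prop)

/-- The tube lemma for the compact circle. This is the source of all invariant neighbourhoods below,
and of the closedness of the quotient map. -/
theorem IsFreeCircleActionNearBoundary.isOpen_invariantCore
    (hU : IsFreeCircleActionNearBoundary n U) {O : Set M} (hO : IsOpen O) :
    IsOpen (invariantCore U O) := by
  rw [isOpen_iff_mem_nhds]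
  rintro x ⟨hx, hxO⟩
  have h1 : ∀ᶠ y in 𝓝 x, ∀ a ∈ (univ : Set Circle), act U a y ∈ O := by
    apply isCompact_univ.eventually_forall_of_forall_eventually
    intro a _
    have h2 := (hU.continuousAt_act a hx).comp (f := fun p : M × Circle => (p.2, p.1))
      (x := (x, a)) (by fun_prop)
    exact h2.eventually_mem (hO.mem_nhds (hxO a))
  filter_upwards [h1, U.isOpen.mem_nhds hx] with y hy hyU
  exact ⟨hyU, fun a => hy a (mem_univ a)⟩

theorem IsFreeCircleActionNearBoundary.act_injective
    (hU : IsFreeCircleActionNearBoundary n U) {x : M} (hx : x ∈ U) :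
    Function.Injective fun a => act U a x := by
  intro a b hab
  lift x to U using hx
  have h1 : act U (b⁻¹ * a) x = x := by
    rw [act_mul]; simp only at hab; rw [hab, act_inv_act]
  rw [act_coe] at h1
  have := hU.free _ x (Subtype.ext h1)
  exact (inv_mul_eq_one.1 this).symm

theorem IsInvariantNhd.act_mem {V : Set M} (hV : IsInvariantNhd n U V) {x : M} (hx : x ∈ V)
    (a : Circle) : act U a x ∈ V := by
  have := hV.invariant a ⟨x, hV.subset hx⟩ hx
  rwa [act_of_mem (hV.subset hx)]

/-- Each element of the circle acts on `U` by a diffeomorphism, and diffeomorphisms preserve the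
boundary. -/
theorem IsFreeCircleActionNearBoundary.act_mem_boundary_iff
    (hU : IsFreeCircleActionNearBoundary n U) (a : Circle) (x : M) :
    act U a x ∈ (𝓡∂ n).boundary M ↔ x ∈ (𝓡∂ n).boundary M := by
  by_cases hx : x ∈ U
  · lift x to U using hx
    have : ContMDiffSMul (𝓡 1) (𝓡∂ n) ∞ Circle U := ⟨hU.smooth⟩
    have h1 := (Diffeomorph.smul (𝓡 1) (𝓡∂ n) ∞ (M := U) a).preimage_boundary (n := ∞) (by simp)
    rw [ModelWithCorners.boundary_open] at h1
    have h2 := Set.ext_iff.1 h1 x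
    rw [act_coe]
    exact h2
  · rw [act_of_notMem hx]

theorem IsFreeCircleActionNearBoundary.act_mem_interior_iff
    (hU : IsFreeCircleActionNearBoundary n U) (a : Circle) (x : M) :
    act U a x ∈ (𝓡∂ n).interior M ↔ x ∈ (𝓡∂ n).interior M := by
  rw [← ModelWithCorners.compl_boundary, mem_compl_iff, mem_compl_iff, hU.act_mem_boundary_iff]

theorem IsFreeCircleActionNearBoundary.boundary_subset_invariantCore
    (hU : IsFreeCircleActionNearBoundary n U) {O : Set M} (hO : (𝓡∂ n).boundary M ⊆ O) :
    (𝓡∂ n).boundary M ⊆ invariantCore U O := fun x hx =>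
  ⟨hU.boundary_subset hx, fun a => hO ((hU.act_mem_boundary_iff a x).2 hx)⟩

theorem IsFreeCircleActionNearBoundary.isInvariantNhd_invariantCore
    (hU : IsFreeCircleActionNearBoundary n U) {O : Set M} (hO : IsOpen O)
    (hb : (𝓡∂ n).boundary M ⊆ O) : IsInvariantNhd n U (invariantCore U O) where
  isOpen := hU.isOpen_invariantCore hO
  boundary_subset := hU.boundary_subset_invariantCore hb
  subset := fun _ hx => hx.1
  invariant := fun a x hx => by rw [← act_coe]; exact act_mem_invariantCore hx a

end Action

end

section

/-! ### Boundary charts, inward curves and Hadamard's lemma in a chart. -/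

section Charts

variable {n : ℕ} [NeZero n]

variable (n) in
/-- The zeroth coordinate functional. -/
def coordZero : EuclideanSpace ℝ (Fin n) →L[ℝ] ℝ := EuclideanSpace.proj 0

variable (n) in
/-- The inward pointing vector of the half-space. -/
def inwardVector : EuclideanSpace ℝ (Fin n) := EuclideanSpace.single 0 1

@[simp]
theorem coordZero_apply (x : EuclideanSpace ℝ (Fin n)) : coordZero n x = x 0 := rfl

theorem coordZero_inwardVector : coordZero n (inwardVector n) = 1 := by
  simp [inwardVector]

theorem range_model_eq : range (𝓡∂ n) = {x | 0 ≤ coordZero n x} :=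
  range_modelWithCornersEuclideanHalfSpace n

variable {M : Type*} [TopologicalSpace M] [ChartedSpace (EuclideanHalfSpace n) M]

/-- The boundary coordinate in the preferred chart at `q`. -/
def boundaryCoord (q x : M) : ℝ := coordZero n (extChartAt (𝓡∂ n) q x)

theorem boundaryCoord_nonneg (q x : M) : 0 ≤ boundaryCoord (n := n) q x :=
  ((chartAt (EuclideanHalfSpace n) q) x).2

variable [IsManifold (𝓡∂ n) ∞ M]

theorem mem_boundary_iff_boundaryCoord {q x : M}
    (hx : x ∈ (chartAt (EuclideanHalfSpace n) q).source) :
    x ∈ (𝓡∂ n).boundary M ↔ boundaryCoord (n := n) q x = 0 := by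
  have h := (𝓡∂ n).isInteriorPoint_iff_of_mem_atlas (n := ∞) (by simp)
    (chart_mem_atlas (EuclideanHalfSpace n) q) hx
  have hmem : extChartAt (𝓡∂ n) q x ∈ (extChartAt (𝓡∂ n) q).target :=
    (extChartAt (𝓡∂ n) q).map_source (by rwa [extChartAt_source])
  have h2 : (extChartAt (𝓡∂ n) q x ∈ interior (extChartAt (𝓡∂ n) q).target) ↔
      0 < boundaryCoord (n := n) q x := by
    rw [extChartAt_target] at hmem ⊢
    rw [interior_inter, interior_range_modelWithCornersEuclideanHalfSpace,
      IsOpen.interior_eq ((chartAt (EuclideanHalfSpace n) q).open_target.preimage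
        (𝓡∂ n).continuous_symm)]
    exact ⟨fun h => h.2, fun h => ⟨hmem.1, h⟩⟩
  change (𝓡∂ n).IsBoundaryPoint x ↔ _
  rw [ModelWithCorners.isBoundaryPoint_iff_not_isInteriorPoint, h]
  change ¬ (extChartAt (𝓡∂ n) q x ∈ interior (extChartAt (𝓡∂ n) q).target) ↔ _
  rw [h2, not_lt]
  exact ⟨fun h => le_antisymm h (boundaryCoord_nonneg q x), fun h => h.le⟩

theorem contMDiffOn_boundaryCoord (q : M) :
    ContMDiffOn (𝓡∂ n) 𝓘(ℝ, ℝ) ∞ (boundaryCoord (n := n) q)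
      (chartAt (EuclideanHalfSpace n) q).source :=
  (coordZero n).contDiff.contMDiff.comp_contMDiffOn contMDiffOn_extChartAt

/-- The curve starting at `p` and pointing inwards in the preferred chart at `q`. -/
def inwardCurve (q p : M) (t : ℝ) : M :=
  (extChartAt (𝓡∂ n) q).symm (extChartAt (𝓡∂ n) q p + t • inwardVector n)

theorem inwardCurve_zero {q p : M} (hp : p ∈ (chartAt (EuclideanHalfSpace n) q).source) :
    inwardCurve (n := n) q p 0 = p := by
  simp only [inwardCurve, zero_smul, add_zero]
  exact (extChartAt (𝓡∂ n) q).left_inv (by rwa [extChartAt_source])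

theorem exists_inwardCurve_mem_target {q p : M}
    (hp : p ∈ (chartAt (EuclideanHalfSpace n) q).source) :
    ∃ ε > (0 : ℝ), ∀ t ∈ Icc 0 ε, extChartAt (𝓡∂ n) q p + t • inwardVector n ∈
      (extChartAt (𝓡∂ n) q).target := by
  have h1 : (extChartAt (𝓡∂ n) q).target ∈ 𝓝[range (𝓡∂ n)] (extChartAt (𝓡∂ n) q p) :=
    extChartAt_target_mem_nhdsWithin' (by rwa [extChartAt_source])
  have h2 : Filter.Tendsto (fun t : ℝ => extChartAt (𝓡∂ n) q p + t • inwardVector n)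
      (𝓝[≥] 0) (𝓝[range (𝓡∂ n)] (extChartAt (𝓡∂ n) q p)) := by
    apply tendsto_nhdsWithin_iff.2 ⟨?_, ?_⟩
    · have : Continuous (fun t : ℝ => extChartAt (𝓡∂ n) q p + t • inwardVector n) := by fun_prop
      have h3 := this.tendsto 0
      rw [zero_smul, add_zero] at h3
      exact h3.mono_left nhdsWithin_le_nhds
    · filter_upwards [self_mem_nhdsWithin] with t ht
      rw [range_model_eq]
      change 0 ≤ coordZero n _
      rw [map_add, map_smul, coordZero_inwardVector, smul_eq_mul, mul_one]
      exact add_nonneg (boundaryCoord_nonneg q p) ht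
  have h3 := h2.eventually h1
  obtain ⟨ε, hε, h⟩ := (mem_nhdsGE_iff_exists_Icc_subset).1 h3
  exact ⟨ε, hε, h⟩

theorem contMDiffOn_inwardCurve {q p : M} {ε : ℝ} (hε : ∀ t ∈ Icc 0 ε,
      extChartAt (𝓡∂ n) q p + t • inwardVector n ∈ (extChartAt (𝓡∂ n) q).target) :
    ContMDiffOn 𝓘(ℝ, ℝ) (𝓡∂ n) ∞ (inwardCurve (n := n) q p) (Icc 0 ε) := by
  have h1 : ContDiff ℝ ∞ (fun t : ℝ => extChartAt (𝓡∂ n) q p + t • inwardVector n) := by fun_prop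
  exact (contMDiffOn_extChartAt_symm q).comp h1.contMDiff.contMDiffOn hε

/-- By the chain rule, one curve with nonzero one-sided derivative is enough. This spares computing
the full differential of functions built from sums or averages. -/
theorem mfderiv_ne_zero_of_curve {f : M → ℝ} {p : M} (hf : MDifferentiableAt (𝓡∂ n) 𝓘(ℝ, ℝ) f p)
    {ε : ℝ} (hε : 0 < ε) {γ : ℝ → M} (hγ0 : γ 0 = p)
    (hγ : ContMDiffOn 𝓘(ℝ, ℝ) (𝓡∂ n) ∞ γ (Icc 0 ε))
    (h : ¬ HasDerivWithinAt (f ∘ γ) 0 (Icc 0 ε) 0) :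
    mfderiv (𝓡∂ n) 𝓘(ℝ, ℝ) f p ≠ 0 := by
  intro h0
  apply h
  have h1 := hf.hasMFDerivAt
  rw [h0] at h1
  subst hγ0
  have h2 := ((hγ 0 ⟨le_rfl, hε.le⟩).mdifferentiableWithinAt (by simp)).hasMFDerivWithinAt
  have h3 := h1.comp_hasMFDerivWithinAt (0 : ℝ) h2
  rw [ContinuousLinearMap.zero_comp] at h3
  have h4 : HasFDerivWithinAt (f ∘ γ) (0 : ℝ →L[ℝ] ℝ) (Icc 0 ε) 0 := h3.hasFDerivWithinAt
  simpa using h4.hasDerivWithinAt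

/-- Hadamard's lemma in the preferred chart at a boundary point. -/
theorem exists_hadamard_chart {f : M → ℝ} (hf : ContMDiff (𝓡∂ n) 𝓘(ℝ, ℝ) ∞ f)
    (h0 : ∀ x ∈ (𝓡∂ n).boundary M, f x = 0) (hnn : ∀ x, 0 ≤ f x) {p : M}
    (hp : p ∈ (𝓡∂ n).boundary M) (hd : mfderiv (𝓡∂ n) 𝓘(ℝ, ℝ) f p ≠ 0) :
    ∃ (O : Set (EuclideanSpace ℝ (Fin n))) (g : EuclideanSpace ℝ (Fin n) → ℝ), IsOpen O ∧
      extChartAt (𝓡∂ n) p p ∈ O ∧ range (𝓡∂ n) ∩ O ⊆ (extChartAt (𝓡∂ n) p).target ∧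
      ContDiffOn ℝ ∞ g (range (𝓡∂ n) ∩ O) ∧
      (∀ y ∈ range (𝓡∂ n) ∩ O, f ((extChartAt (𝓡∂ n) p).symm y) = coordZero n y * g y) ∧
      0 < g (extChartAt (𝓡∂ n) p p) ∧
      HasFDerivWithinAt (f ∘ (extChartAt (𝓡∂ n) p).symm)
        (g (extChartAt (𝓡∂ n) p p) • coordZero n) (range (𝓡∂ n)) (extChartAt (𝓡∂ n) p p) := by
  set φ := extChartAt (𝓡∂ n) p with hφ
  set y₀ := φ p with hy₀
  have hy₀0 : coordZero n y₀ = 0 :=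
    (mem_boundary_iff_boundaryCoord (mem_chart_source (EuclideanHalfSpace n) p)).1 hp
  obtain ⟨O, hO, hyO, hOt⟩ := mem_nhdsWithin.1 (extChartAt_target_mem_nhdsWithin (I := 𝓡∂ n) p)
  have hOt' : range (𝓡∂ n) ∩ O ⊆ φ.target := by rwa [inter_comm]
  have hF : ContDiffOn ℝ ∞ (f ∘ φ.symm) (range (𝓡∂ n) ∩ O) := by
    rw [← contMDiffOn_iff_contDiffOn]
    exact hf.comp_contMDiffOn ((contMDiffOn_extChartAt_symm p).mono hOt')
  have hF' := hF
  rw [range_model_eq] at hF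
  have hzero : ∀ y ∈ O, coordZero n y = 0 → (f ∘ φ.symm) y = 0 := by
    intro y hy hy0
    have hyt : y ∈ φ.target := hOt' ⟨by rw [range_model_eq]; exact hy0.ge, hy⟩
    apply h0
    have hs : φ.symm y ∈ (chartAt (EuclideanHalfSpace n) p).source := by
      rw [← extChartAt_source (𝓡∂ n)]; exact φ.map_target hyt
    rw [mem_boundary_iff_boundaryCoord hs, boundaryCoord]
    rw [φ.right_inv hyt, hy0]
  obtain ⟨O', g, hO', hpO', hO'O, hg, hfg, -⟩ :=
    exists_eq_mul_of_eq_zero_on_boundary coordZero_inwardVector hO hF hyO hy₀0 hzero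
  rw [← range_model_eq] at hg hfg
  have hym : y₀ ∈ range (𝓡∂ n) ∩ O' := ⟨mem_range_self _, hpO'⟩
  -- Product rule for `coordZero * g` at a zero of `coordZero`: the term containing the derivative
  -- of `g` drops out.
  have hder : HasFDerivWithinAt (f ∘ φ.symm) (g y₀ • coordZero n) (range (𝓡∂ n)) y₀ := by
    have h1 := ((hg.differentiableOn (by simp)) y₀ hym).hasFDerivWithinAt
    have h2 := ((coordZero n).hasFDerivAt (x := y₀)).hasFDerivWithinAt (s := range (𝓡∂ n) ∩ O')
    have h3 := h2.mul h1
    rw [hy₀0, zero_smul, zero_add] at h3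
    have h4 := h3.congr (f₁ := f ∘ φ.symm) (fun y hy => hfg y hy) (hfg y₀ hym)
    exact (hasFDerivWithinAt_inter (hO'.mem_nhds hpO')).1 h4
  have hmf : mfderiv (𝓡∂ n) 𝓘(ℝ, ℝ) f p = g y₀ • coordZero n := by
    rw [((hf p).mdifferentiableAt (by simp)).mfderiv]
    have : writtenInExtChartAt (𝓡∂ n) 𝓘(ℝ, ℝ) p f = f ∘ φ.symm := rfl
    rw [this]
    exact hder.fderivWithin ((𝓡∂ n).uniqueDiffOn _ (mem_range_self _))
  have hgne : g y₀ ≠ 0 := by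
    intro h; apply hd; rw [hmf, h]; exact zero_smul ℝ (coordZero n)
  -- Along the inward ray `f` equals `t * g`, so `g ≥ 0` for `t > 0`, and the sign passes to the
  -- limit.
  have hgnn : 0 ≤ g y₀ := by
    have ht : Filter.Tendsto (fun t : ℝ => y₀ + t • inwardVector n) (𝓝[>] 0)
        (𝓝[range (𝓡∂ n) ∩ O'] y₀) := by
      have hc : Continuous (fun t : ℝ => y₀ + t • inwardVector n) := by fun_prop
      have h3 := hc.tendsto 0
      rw [zero_smul, add_zero] at h3
      have h3' := h3.mono_left (nhdsWithin_le_nhds (s := Ioi 0))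
      refine tendsto_nhdsWithin_iff.2 ⟨h3', ?_⟩
      filter_upwards [self_mem_nhdsWithin, h3'.eventually (hO'.mem_nhds hpO')] with t ht ht2
      refine ⟨?_, ht2⟩
      rw [range_model_eq]
      change 0 ≤ coordZero n _
      rw [map_add, map_smul, coordZero_inwardVector, smul_eq_mul, mul_one, hy₀0, zero_add]
      exact le_of_lt ht
    have hlim := (hg.continuousOn y₀ hym).tendsto.comp ht
    refine ge_of_tendsto hlim ?_
    filter_upwards [self_mem_nhdsWithin, (tendsto_nhdsWithin_iff.1 ht).2] with t ht0 htm
    have h5 := hfg _ htm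
    have h6 : 0 ≤ (f ∘ φ.symm) (y₀ + t • inwardVector n) := hnn _
    rw [h5, map_add, map_smul, coordZero_inwardVector, smul_eq_mul, mul_one, hy₀0, zero_add] at h6
    exact nonneg_of_mul_nonneg_right h6 ht0
  exact ⟨O', g, hO', hpO', (inter_subset_inter_right _ hO'O).trans hOt', hg, hfg,
    lt_of_le_of_ne hgnn hgne.symm, hder⟩

end Charts

end

section

theorem locallyCompactSpace_of_halfSpace (n : ℕ) [NeZero n] (M : Type*)
    [TopologicalSpace M] [ChartedSpace (EuclideanHalfSpace n) M] :
    LocallyCompactSpace M :=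
  Manifold.locallyCompact_of_finiteDimensional (𝓡∂ n)

theorem sigmaCompactSpace_of_halfSpace (n : ℕ) [NeZero n] (M : Type*)
    [TopologicalSpace M] [ChartedSpace (EuclideanHalfSpace n) M]
    [SecondCountableTopology M] : SigmaCompactSpace M :=
  have := locallyCompactSpace_of_halfSpace n M
  inferInstance

theorem normalSpace_of_halfSpace (n : ℕ) [NeZero n] (M : Type*)
    [TopologicalSpace M] [ChartedSpace (EuclideanHalfSpace n) M]
    [T2Space M] [SecondCountableTopology M] : NormalSpace M :=
  have := locallyCompactSpace_of_halfSpace n M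
  have := sigmaCompactSpace_of_halfSpace n M
  inferInstance

/-! ### Existence of boundary defining functions, without invariance. -/

section BoundaryDefining

variable {n : ℕ} [NeZero n] {M : Type*} [TopologicalSpace M]
  [ChartedSpace (EuclideanHalfSpace n) M]

theorem not_hasDerivWithinAt_zero_of_le {k : ℝ → ℝ} {ε c : ℝ} (hε : 0 < ε) (hc : 0 < c)
    (hk0 : k 0 = 0) (hk : ∀ᶠ t in 𝓝[>] 0, c * t ≤ k t) :
    ¬ HasDerivWithinAt k 0 (Icc 0 ε) 0 := by
  intro h
  rw [hasDerivWithinAt_iff_isLittleO, Asymptotics.isLittleO_iff] at h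
  have h1 := h (half_pos hc)
  have hle : 𝓝[>] (0 : ℝ) ≤ 𝓝[Icc 0 ε] 0 := by
    rw [← nhdsWithin_Ioo_eq_nhdsGT hε]
    exact nhdsWithin_mono _ Ioo_subset_Icc_self
  obtain ⟨t, ⟨ht1, ht2⟩, ht3⟩ := (((h1.filter_mono hle).and hk).and self_mem_nhdsWithin).exists
  have ht3 : 0 < t := ht3
  simp only [hk0, sub_zero, smul_zero, Real.norm_eq_abs, abs_of_pos ht3] at ht1
  have := le_abs_self (k t)
  nlinarith

theorem continuousAt_inwardCurve {q p : M} (hp : p ∈ (chartAt (EuclideanHalfSpace n) q).source) :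
    ContinuousAt (inwardCurve (n := n) q p) 0 := by
  have hp' : p ∈ (extChartAt (𝓡∂ n) q).source := by rwa [extChartAt_source]
  have h1 := continuousAt_extChartAt_symm' (I := 𝓡∂ n) hp'
  refine ContinuousAt.comp (f := fun t : ℝ => extChartAt (𝓡∂ n) q p + t • inwardVector n)
    (g := (extChartAt (𝓡∂ n) q).symm) ?_ ?_
  · simpa using h1
  · exact Continuous.continuousAt (by fun_prop)

variable [IsManifold (𝓡∂ n) ∞ M]

theorem boundaryCoord_inwardCurve {q p : M}
    (hp : p ∈ (chartAt (EuclideanHalfSpace n) q).source) (hb : p ∈ (𝓡∂ n).boundary M) {t : ℝ}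
    (ht : extChartAt (𝓡∂ n) q p + t • inwardVector n ∈ (extChartAt (𝓡∂ n) q).target) :
    boundaryCoord (n := n) q (inwardCurve (n := n) q p t) = t := by
  rw [boundaryCoord, inwardCurve, (extChartAt (𝓡∂ n) q).right_inv ht, map_add, map_smul,
    coordZero_inwardVector, smul_eq_mul, mul_one]
  have := (mem_boundary_iff_boundaryCoord hp).1 hb
  rw [boundaryCoord] at this
  rw [this, zero_add]

variable (n M) in
/-- A smooth boundary defining function exists. -/
theorem exists_boundaryDefining [T2Space M] [SecondCountableTopology M] :
    ∃ f : M → ℝ, ContMDiff (𝓡∂ n) 𝓘(ℝ, ℝ) ∞ f ∧ (∀ x, 0 ≤ f x) ∧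
      (∀ x, f x = 0 ↔ x ∈ (𝓡∂ n).boundary M) ∧
      ∀ x ∈ (𝓡∂ n).boundary M, mfderiv (𝓡∂ n) 𝓘(ℝ, ℝ) f x ≠ 0 := by
  have := sigmaCompactSpace_of_halfSpace n M
  obtain ⟨ρ, hρ⟩ := SmoothPartitionOfUnity.exists_isSubordinate_chartAt_source (𝓡∂ n) M
  set f : M → ℝ := fun x => ∑ᶠ i, ρ i x • boundaryCoord (n := n) i x with hf
  have hsm : ContMDiff (𝓡∂ n) 𝓘(ℝ, ℝ) ∞ f :=
    hρ.contMDiff_finsum_smul (fun i => (chartAt _ i).open_source) contMDiffOn_boundaryCoord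
  have hterm : ∀ x i, 0 ≤ ρ i x • boundaryCoord (n := n) i x := fun x i =>
    mul_nonneg (ρ.nonneg i x) (boundaryCoord_nonneg i x)
  have hle : ∀ x i, ρ i x * boundaryCoord (n := n) i x ≤ f x := fun x i =>
    single_le_finsum i ((ρ.locallyFinite.point_finite x).subset fun j hj => by
      intro h0; apply hj; simp [h0]) (hterm x)
  have hnn : ∀ x, 0 ≤ f x := fun x => finsum_nonneg (hterm x)
  have hsrc : ∀ i x, ρ i x ≠ 0 → x ∈ (chartAt (EuclideanHalfSpace n) i).source := fun i x hx =>
    hρ i (subset_closure hx)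
  have hpos : ∀ x, ∃ i, 0 < ρ i x := fun x => ρ.exists_pos_of_mem (mem_univ x)
  have hzero : ∀ x, f x = 0 ↔ x ∈ (𝓡∂ n).boundary M := by
    intro x
    constructor
    · intro hx
      obtain ⟨i, hi⟩ := hpos x
      rw [mem_boundary_iff_boundaryCoord (hsrc i x hi.ne')]
      have h1 := hle x i
      rw [hx] at h1
      have h2 := boundaryCoord_nonneg (n := n) i x
      nlinarith
    · intro hx
      apply finsum_eq_zero_of_forall_eq_zero
      intro i
      by_cases hi : ρ i x = 0
      · simp [hi]
      · rw [(mem_boundary_iff_boundaryCoord (hsrc i x hi)).1 hx, smul_zero]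
  refine ⟨f, hsm, hnn, hzero, ?_⟩
  intro p hp
  obtain ⟨i, hi⟩ := hpos p
  have hpi := hsrc i p hi.ne'
  obtain ⟨ε, hε, hεt⟩ := exists_inwardCurve_mem_target hpi
  have hγ0 := inwardCurve_zero (n := n) hpi
  refine mfderiv_ne_zero_of_curve ((hsm p).mdifferentiableAt (by simp)) hε
    hγ0 (contMDiffOn_inwardCurve hεt) ?_
  -- The boundary coordinate of chart `i` equals `t` on the inward curve, so the single summand `i`
  -- already gives `f ≥ (ρ i p / 2) * t` for small `t`.
  refine not_hasDerivWithinAt_zero_of_le hε (half_pos hi) ?_ ?_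
  · simp only [Function.comp, hγ0]; exact (hzero p).2 hp
  · have h1 : ContinuousAt (fun t => ρ i (inwardCurve (n := n) i p t)) 0 := by
      apply ContinuousAt.comp (f := inwardCurve (n := n) i p)
      · exact (ρ i).contMDiff.continuous.continuousAt
      · exact continuousAt_inwardCurve hpi
    have h2 : ∀ᶠ t in 𝓝 (0 : ℝ), ρ i p / 2 < ρ i (inwardCurve (n := n) i p t) := by
      apply h1.eventually (lt_mem_nhds _)
      simp only [hγ0]; linarith
    filter_upwards [h2.filter_mono nhdsWithin_le_nhds, Ioc_mem_nhdsGT hε] with t ht1 ht2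
    have h3 := hle (inwardCurve (n := n) i p t) i
    rw [boundaryCoord_inwardCurve hpi hp (hεt t ⟨ht2.1.le, ht2.2⟩)] at h3
    have := ht2.1
    simp only [Function.comp]
    nlinarith

end BoundaryDefining

/-! ### Averaging over orbits: existence of invariant boundary defining functions. -/

section Averaging

variable {n : ℕ} [NeZero n] {M : Type*} [TopologicalSpace M]
  [ChartedSpace (EuclideanHalfSpace n) M] [IsManifold (𝓡∂ n) ∞ M] {U : Opens M}
  [MulAction Circle U]

theorem IsFreeCircleActionNearBoundary.contMDiffAt_act
    (hU : IsFreeCircleActionNearBoundary n U) (a : Circle) {x : M} (hx : x ∈ U) :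
    ContMDiffAt ((𝓡 1).prod (𝓡∂ n)) (𝓡∂ n) ∞ (fun p : Circle × M => act U p.1 p.2) (a, x) :=
  (hU.contMDiffOn_act _ ⟨mem_univ _, hx⟩).contMDiffAt
    ((isOpen_univ.prod U.isOpen).mem_nhds ⟨mem_univ _, hx⟩)

theorem IsFreeCircleActionNearBoundary.contMDiffOn_average
    (hU : IsFreeCircleActionNearBoundary n U) {F : Type} [NormedAddCommGroup F] [NormedSpace ℝ F]
    [CompleteSpace F] {f : M → F} (hf : ContMDiff (𝓡∂ n) 𝓘(ℝ, F) ∞ f) :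
    ContMDiffOn (𝓡∂ n) 𝓘(ℝ, F) ∞ (fun x => circleAvg fun a => f (act U a x)) U :=
  contMDiffOn_circleAvg U.isOpen fun a _ hx => (hf _).comp (a, _) (hU.contMDiffAt_act a hx)

/-- Differentiate the average under the integral along an inward curve. Every rotate of `f` vanishes
at `p` and is nonnegative, so its one-sided derivative is nonnegative; for the identity rotation it
is positive by Hadamard's lemma. By continuity in the angle no cancellation can occur. -/
theorem IsFreeCircleActionNearBoundary.mfderiv_average_ne_zero
    (hU : IsFreeCircleActionNearBoundary n U) {f : M → ℝ}
    (hf : ContMDiff (𝓡∂ n) 𝓘(ℝ, ℝ) ∞ f) (hnn : ∀ x, 0 ≤ f x)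
    (h0 : ∀ x ∈ (𝓡∂ n).boundary M, f x = 0) {p : M} (hp : p ∈ (𝓡∂ n).boundary M)
    (hd : mfderiv (𝓡∂ n) 𝓘(ℝ, ℝ) f p ≠ 0) :
    mfderiv (𝓡∂ n) 𝓘(ℝ, ℝ) (fun x => circleAvg fun a => f (act U a x)) p ≠ 0 := by
  have hpU := hU.boundary_subset hp
  have hps := mem_chart_source (EuclideanHalfSpace n) p
  set γ := inwardCurve (n := n) p p with hγ
  have hγ0 : γ 0 = p := inwardCurve_zero (n := n) hps
  obtain ⟨ε₀, hε₀, hε₀t⟩ := exists_inwardCurve_mem_target hps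
  obtain ⟨ε, hε, hεε, hεU⟩ : ∃ ε > 0, ε ≤ ε₀ ∧ ∀ t ∈ Icc 0 ε, γ t ∈ U := by
    have h1 := (continuousAt_inwardCurve (n := n) hps).eventually_mem
      (U.isOpen.mem_nhds (by rw [← hγ, hγ0]; exact hpU))
    obtain ⟨δ, hδ, hδU⟩ := Metric.eventually_nhds_iff_ball.1 h1
    refine ⟨min ε₀ (δ / 2), by positivity, min_le_left _ _, fun t ht => hδU t ?_⟩
    rw [mem_ball_zero_iff, Real.norm_eq_abs, abs_of_nonneg ht.1]
    linarith [ht.2, min_le_right ε₀ (δ / 2)]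
  have hεt : ∀ t ∈ Icc 0 ε, extChartAt (𝓡∂ n) p p + t • inwardVector n ∈
      (extChartAt (𝓡∂ n) p).target := fun t ht => hε₀t t ⟨ht.1, ht.2.trans hεε⟩
  have hγs := contMDiffOn_inwardCurve hεt
  set S := Icc (0 : ℝ) ε with hS
  have h0S : (0 : ℝ) ∈ S := ⟨le_rfl, hε.le⟩
  have hSu : UniqueDiffOn ℝ S := uniqueDiffOn_Icc hε
  set Φ : ℝ × ℝ → ℝ := fun z => f (act U (Circle.exp (2 * Real.pi * z.2)) (γ z.1)) with hΦ
  have hΦs : ContDiffOn ℝ ∞ Φ (S ×ˢ Icc 0 1) := by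
    rw [← contMDiffOn_iff_contDiffOn]
    rintro ⟨t, s⟩ ⟨ht, hs⟩
    apply ContMDiffAt.comp_contMDiffWithinAt _ (hf _)
    refine hU.contMDiffWithinAt_act (g := fun z : ℝ × ℝ => Circle.exp (2 * Real.pi * z.2))
      (h := fun z : ℝ × ℝ => γ z.1) ?_ ?_ (hεU t ht)
    · have h1 : ContDiff ℝ ∞ fun z : ℝ × ℝ => 2 * Real.pi * z.2 := by fun_prop
      exact ((contMDiff_circleExp (m := ∞)).comp h1.contMDiff).contMDiffAt.contMDiffWithinAt
    · exact ContMDiffWithinAt.comp (g := γ) (f := Prod.fst) (t := S) (t, s) (hγs t ht)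
        contDiff_fst.contMDiff.contMDiffAt.contMDiffWithinAt fun z hz => hz.1
  set Φ' : ℝ × ℝ → ℝ →L[ℝ] ℝ := fun z =>
    (fderivWithin ℝ Φ (S ×ˢ Icc (0 : ℝ) 1) z).comp (ContinuousLinearMap.inl ℝ ℝ ℝ) with hΦ'
  have hΦ'c : ContinuousOn Φ' (S ×ˢ Icc 0 1) :=
    (hΦs.continuousOn_fderivWithin (hSu.prod uniqueDiffOn_Icc_zero_one) (by simp)).clm_comp
      continuousOn_const
  have hder : ∀ t ∈ S, ∀ s ∈ Icc (0 : ℝ) 1,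
      HasFDerivWithinAt (fun t => Φ (t, s)) (Φ' (t, s)) S t := by
    intro t ht s hs
    have h1 := ((hΦs.differentiableOn (by simp)) (t, s) ⟨ht, hs⟩).hasFDerivWithinAt
    have h2 : HasFDerivWithinAt (fun y : ℝ => (y, s)) (ContinuousLinearMap.inl ℝ ℝ ℝ) S t :=
      (hasFDerivAt_prodMk_left t s).hasFDerivWithinAt
    have h3 : MapsTo (fun y : ℝ => (y, s)) S (S ×ˢ Icc (0 : ℝ) 1) := fun z hz => ⟨hz, hs⟩
    exact h1.comp t h2 h3
  have hint := hasFDerivWithinAt_integral_unitInterval (convex_Icc 0 ε) hΦs.continuousOn hΦ'c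
    hder h0S
  have hΦ0 : ∀ s, Φ (0, s) = 0 := by
    intro s
    simp only [hΦ, hγ0]
    exact h0 _ ((hU.act_mem_boundary_iff _ _).2 hp)
  have hnonneg : ∀ s ∈ Icc (0 : ℝ) 1, 0 ≤ Φ' (0, s) 1 := by
    intro s hs
    have h1 := (hder 0 h0S s hs).hasDerivWithinAt
    rw [hasDerivWithinAt_iff_tendsto_slope] at h1
    have hne : (𝓝[S \ {0}] (0 : ℝ)).NeBot := by
      have : S \ {0} = Ioc 0 ε := Icc_sdiff_left
      rw [this, nhdsWithin_Ioc_eq_nhdsGT hε]; infer_instance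
    refine ge_of_tendsto h1 ?_
    filter_upwards [self_mem_nhdsWithin] with t ht
    rw [slope_def_field, hΦ0, sub_zero, sub_zero]
    exact div_nonneg (hnn _) ht.1.1
  have hpos : 0 < Φ' (0, 0) 1 := by
    obtain ⟨O, g, hO, hpO, -, -, -, hgpos, hgder⟩ := exists_hadamard_chart hf h0 hnn hp hd
    have h1 : HasDerivWithinAt (fun t => Φ (t, 0)) (g (extChartAt (𝓡∂ n) p p)) S 0 := by
      have h2 : HasDerivWithinAt (fun t : ℝ => extChartAt (𝓡∂ n) p p + t • inwardVector n)
          (inwardVector n) S 0 := by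
        have := ((hasDerivAt_id (0 : ℝ)).smul_const (inwardVector n)).const_add
          (extChartAt (𝓡∂ n) p p)
        simpa using this.hasDerivWithinAt
      have hmaps : MapsTo (fun t : ℝ => extChartAt (𝓡∂ n) p p + t • inwardVector n) S
          (range (𝓡∂ n)) := fun t ht => extChartAt_target_subset_range p (hεt t ht)
      have h3 := HasFDerivWithinAt.comp_hasDerivWithinAt_of_eq (0 : ℝ) hgder h2 hmaps (by simp)
      simp only [smul_apply, coordZero_inwardVector, smul_eq_mul,
        mul_one] at h3
      refine h3.congr (fun t _ => ?_) ?_ <;> simp [hΦ, hγ, inwardCurve]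
    have h4 := (hder 0 h0S 0 ⟨le_rfl, zero_le_one⟩).hasDerivWithinAt
    rw [(hSu 0 h0S).eq_deriv _ h4 h1]
    exact hgpos
  have hfin : 0 < (∫ s in (0 : ℝ)..1, Φ' (0, s)) 1 := by
    rw [ContinuousLinearMap.intervalIntegral_apply
      (intervalIntegrable_of_continuousOn_prod hΦ'c h0S)]
    apply intervalIntegral.integral_pos zero_lt_one
    · exact (hΦ'c.comp (by fun_prop) fun s hs => ⟨h0S, hs⟩).clm_apply continuousOn_const
    · exact fun s hs => hnonneg s ⟨hs.1.le, hs.2⟩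
    · exact ⟨0, ⟨le_rfl, zero_le_one⟩, hpos⟩
  refine mfderiv_ne_zero_of_curve
    (((hU.contMDiffOn_average hf).contMDiffAt (U.isOpen.mem_nhds hpU)).mdifferentiableAt (by simp))
    hε hγ0 hγs ?_
  intro hzero
  exact hfin.ne' ((hSu 0 h0S).eq_deriv _ hint.hasDerivWithinAt hzero)

theorem circleAvg_act (f : M → ℝ) (a : Circle) (x : M) :
    (circleAvg fun b => f (act U b (act U a x))) = circleAvg fun b => f (act U b x) := by
  simp_rw [← act_mul]
  exact circleAvg_mul_right (fun b => f (act U b x)) a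

/-- Invariant boundary defining functions exist. -/
theorem IsFreeCircleActionNearBoundary.exists_isInvariantBoundaryDefining [T2Space M]
    [SecondCountableTopology M] (hU : IsFreeCircleActionNearBoundary n U) :
    ∃ f : M → ℝ, IsInvariantBoundaryDefining n U f := by
  have := sigmaCompactSpace_of_halfSpace n M
  have := normalSpace_of_halfSpace n M
  obtain ⟨f₀, hs₀, hnn₀, hz₀, hd₀⟩ := exists_boundaryDefining n M
  set f₁ : M → ℝ := fun x => circleAvg fun a => f₀ (act U a x) with hf₁
  have hs₁ := hU.contMDiffOn_average hs₀
  have hnn₁ : ∀ x, 0 ≤ f₁ x := fun x => circleAvg_nonneg fun a => hnn₀ _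
  have hz₁ : ∀ x ∈ U, (f₁ x = 0 ↔ x ∈ (𝓡∂ n).boundary M) := by
    intro x hx
    constructor
    · intro h
      by_contra hxb
      have h1 : 0 < f₀ (act U 1 x) := by
        rw [act_one]; exact lt_of_le_of_ne (hnn₀ x) fun h => hxb ((hz₀ x).1 h.symm)
      have := circleAvg_pos (hs₀.continuous.comp (hU.continuous_act_left hx))
        (fun a => hnn₀ _) h1
      exact this.ne' h
    · intro h
      have : ∀ a, f₀ (act U a x) = 0 := fun a => (hz₀ _).2 ((hU.act_mem_boundary_iff a x).2 h)
      simp only [hf₁, this]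
      exact circleAvg_const 0
  obtain ⟨u, hu, hbu, huU⟩ := normal_exists_closure_subset
    ((𝓡∂ n).isClosed_boundary (M := M) (n := ∞) (by simp)) U.isOpen hU.boundary_subset
  obtain ⟨χ, hχ1, hχ0, hχ⟩ := exists_contMDiffMap_one_nhds_of_subset_interior (𝓡∂ n) (n := ⊤)
    (s := (𝓡∂ n).boundary M) (t := u) ((𝓡∂ n).isClosed_boundary (n := ∞) (by simp))
    (by rwa [hu.interior_eq])
  obtain ⟨O, hOo, hbO, hO1⟩ := eventually_nhdsSet_iff_exists.1 hχ1
  -- The average `f₁` is known to be smooth only on `U`, so it is used near `∂M` and blended into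
  -- `f₀` further out. Convex combinations keep the sign and the zero set.
  set f : M → ℝ := fun x => χ x * f₁ x + (1 - χ x) * f₀ x with hf
  have hfO : ∀ x ∈ O, f x = f₁ x := fun x hx => by simp [hf, hO1 x hx]
  have hχU : ∀ x ∉ U, χ x = 0 := fun x hx => hχ0 x fun h => hx (huU (subset_closure h))
  refine ⟨f, ?_, ?_, ?_, ?_, invariantCore U O, hU.isInvariantNhd_invariantCore hOo hbO, ?_⟩
  · intro x
    by_cases hx : x ∈ U
    · have h1 : ContMDiffAt (𝓡∂ n) 𝓘(ℝ, ℝ) ∞ χ x := χ.contMDiff x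
      exact (h1.mul (hs₁.contMDiffAt (U.isOpen.mem_nhds hx))).add
        ((contMDiffAt_const.sub h1).mul (hs₀ x))
    · refine (hs₀ x).congr_of_eventuallyEq ?_
      have : (closure u)ᶜ ∈ 𝓝 x := isClosed_closure.isOpen_compl.mem_nhds fun h => hx (huU h)
      filter_upwards [this] with y hy
      simp [hf, hχ0 y fun h => hy (subset_closure h)]
  · exact fun x => add_nonneg (mul_nonneg (hχ x).1 (hnn₁ x))
      (mul_nonneg (sub_nonneg.2 (hχ x).2) (hnn₀ x))
  · intro x
    by_cases hx : x ∈ U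
    · constructor
      · intro h
        by_contra hxb
        have p₀ : 0 < f₀ x := lt_of_le_of_ne (hnn₀ x) fun h => hxb ((hz₀ x).1 h.symm)
        have p₁ : 0 < f₁ x := lt_of_le_of_ne (hnn₁ x) fun h => hxb ((hz₁ x hx).1 h.symm)
        have c := hχ x
        simp only [hf] at h
        rcases c.1.eq_or_lt with hc | hc
        · rw [← hc] at h; linarith
        · have := mul_pos hc p₁
          have := mul_nonneg (sub_nonneg.2 c.2) p₀.le
          linarith
      · intro h
        simp [hf, (hz₀ x).2 h, (hz₁ x hx).2 h]
    · simp only [hf, hχU x hx, zero_mul, zero_add, sub_zero, one_mul]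
      exact hz₀ x
  · intro x hx
    have : f =ᶠ[𝓝 x] f₁ := by
      filter_upwards [hOo.mem_nhds (hbO hx)] with y hy using hfO y hy
    rw [this.mfderiv_eq]
    exact hU.mfderiv_average_ne_zero hs₀ hnn₀ (fun x hx => (hz₀ x).2 hx) hx (hd₀ x hx)
  · intro a x hx
    rw [← act_coe, hfO _ (hx.2 a), hfO _ (invariantCore_subset O hx)]
    exact circleAvg_act f₀ a x

end Averaging

end

/-! ### Slices for the circle action at boundary points. -/

section

/-- Two functionals that are independent, with explicit witnesses, can be completed to an injective
linear map by a map to a space of dimension two less. -/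
theorem exists_injective_completion {n : ℕ} {A B : EuclideanSpace ℝ (Fin n) →L[ℝ] ℝ}
    {v e : EuclideanSpace ℝ (Fin n)} (hAv : A v = 1) (hBv : B v = 0) (hBe : B e = 1) :
    2 ≤ n ∧ ∃ P : EuclideanSpace ℝ (Fin n) →L[ℝ] EuclideanSpace ℝ (Fin (n - 2)),
      ∀ x, A x = 0 → P x = 0 → B x = 0 → x = 0 := by
  set T : EuclideanSpace ℝ (Fin n) →ₗ[ℝ] ℝ × ℝ := (A : _ →ₗ[ℝ] ℝ).prod (B : _ →ₗ[ℝ] ℝ) with hT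
  have hTs : LinearMap.range T = ⊤ := by
    rw [LinearMap.range_eq_top]
    rintro ⟨s, t⟩
    refine ⟨(s - t * A e) • v + t • e, ?_⟩
    simp [hT, hAv, hBv, hBe]
  have hrank := LinearMap.finrank_range_add_finrank_ker T
  rw [hTs, finrank_top, Module.finrank_prod, Module.finrank_self, finrank_euclideanSpace_fin]
    at hrank
  refine ⟨by omega, ?_⟩
  -- `P` is a projection onto the joint kernel of `A` and `B`, identified with `ℝ^(n-2)`; hence it
  -- is injective on that kernel.
  obtain ⟨Q, hQ⟩ := LinearMap.exists_leftInverse_of_injective (LinearMap.ker T).subtype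
    (Submodule.ker_subtype _)
  have hfin : Module.finrank ℝ (LinearMap.ker T)
      = Module.finrank ℝ (EuclideanSpace ℝ (Fin (n - 2))) := by
    rw [finrank_euclideanSpace_fin]; omega
  set ψ := LinearEquiv.ofFinrankEq (LinearMap.ker T) (EuclideanSpace ℝ (Fin (n - 2))) hfin
  refine ⟨LinearMap.toContinuousLinearMap (ψ.toLinearMap.comp Q), fun x hA hP hB => ?_⟩
  have hx : x ∈ LinearMap.ker T := by
    rw [LinearMap.mem_ker]; simp [hT, hA, hB]
  have h1 : Q x = ⟨x, hx⟩ := LinearMap.congr_fun hQ ⟨x, hx⟩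
  have h2 : ψ (Q x) = 0 := hP
  rw [h1, LinearEquiv.map_eq_zero_iff] at h2
  simpa using h2

variable {n : ℕ} [NeZero n] {M : Type*} [TopologicalSpace M]
  [ChartedSpace (EuclideanHalfSpace n) M] {U : Opens M} [MulAction Circle U]

variable (n U) in
/-- Local slices for the circle action near the boundary: `W` is an invariant open set with
an equivariant map `α` to the circle, invariant functions `d`, and a section `σ` of `(d, f)` over
its image with `α ∘ σ = 1`. -/
structure CutSlice (f : M → ℝ) where
  /-- The domain of the slice. -/
  W : Set M
  /-- The equivariant map to the circle. -/
  α : M → Circle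
  /-- The coordinates on the orbit space. -/
  d : M → EuclideanSpace ℝ (Fin (n - 2))
  /-- The image of `(d, f)` is the part of `O` in the half-space. -/
  O : Set (EuclideanSpace ℝ (Fin (n - 2)) × ℝ)
  /-- The section. -/
  σ : EuclideanSpace ℝ (Fin (n - 2)) × ℝ → M
  isOpen_W : IsOpen W
  W_subset : W ⊆ U
  act_mem_W : ∀ x ∈ W, ∀ a, act U a x ∈ W
  f_act : ∀ x ∈ W, ∀ a, f (act U a x) = f x
  smooth_α : ContMDiffOn (𝓡∂ n) (𝓡 1) ∞ α W
  α_act : ∀ x ∈ W, ∀ a, α (act U a x) = a * α x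
  smooth_d : ContMDiffOn (𝓡∂ n) 𝓘(ℝ, EuclideanSpace ℝ (Fin (n - 2))) ∞ d W
  d_act : ∀ x ∈ W, ∀ a, d (act U a x) = d x
  isOpen_O : IsOpen O
  smooth_σ : ContMDiffOn 𝓘(ℝ, EuclideanSpace ℝ (Fin (n - 2)) × ℝ) (𝓡∂ n) ∞ σ
    (O ∩ {w | 0 ≤ w.2})
  σ_mem : ∀ w ∈ O, 0 ≤ w.2 → σ w ∈ W
  α_σ : ∀ w ∈ O, 0 ≤ w.2 → α (σ w) = 1
  d_σ : ∀ w ∈ O, 0 ≤ w.2 → d (σ w) = w.1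
  f_σ : ∀ w ∈ O, 0 ≤ w.2 → f (σ w) = w.2
  mem_O : ∀ x ∈ W, (d x, f x) ∈ O
  σ_apply : ∀ x ∈ W, σ (d x, f x) = act U (α x)⁻¹ x

variable [IsManifold (𝓡∂ n) ∞ M]

/-- Near every point there is an equivariant smooth map to the circle. -/
theorem IsFreeCircleActionNearBoundary.exists_equivariant [T2Space M] [SecondCountableTopology M]
    (hU : IsFreeCircleActionNearBoundary n U) {p : M} (hp : p ∈ U) :
    ∃ (W : Set M) (α : M → Circle), IsOpen W ∧ W ⊆ U ∧ p ∈ W ∧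
      (∀ x ∈ W, ∀ a, act U a x ∈ W) ∧ ContMDiffOn (𝓡∂ n) (𝓡 1) ∞ α W ∧
      (∀ x ∈ W, ∀ a, α (act U a x) = a * α x) ∧ α p = 1 := by
  have := sigmaCompactSpace_of_halfSpace n M
  -- The far half of the orbit of `p`; freeness keeps `p` out of it. With `β` zero on `K` and one at
  -- `p`, the average `A` of `β (a · x) a⁻¹` is equivariant, and the real part of its integrand at
  -- `p` is nonnegative and positive at `a = 1`. So `A p ≠ 0`, and `α` is the unit part of `A`,
  -- normalised at `p`.
  set K : Set M := (fun a => act U a p) '' {a : Circle | (a : ℂ).re ≤ 0} with hK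
  have hKc : IsClosed K := by
    apply IsCompact.isClosed
    refine IsCompact.image (IsClosed.isCompact ?_) (hU.continuous_act_left hp)
    exact isClosed_le (Complex.continuous_re.comp contMDiff_circle_coe.continuous) continuous_const
  have hpK : p ∉ K := by
    rintro ⟨a, ha, hap⟩
    have : a = 1 := hU.act_injective hp (by simpa using hap)
    subst this
    simp at ha
    linarith
  obtain ⟨β, hβ0, hβ1, hβ⟩ := exists_contMDiffMap_zero_one_of_isClosed (𝓡∂ n) (n := ⊤) hKc
    isClosed_singleton (t := {p}) (disjoint_singleton_right.2 hpK)
  set g : Circle → M → ℂ := fun a x => β (act U a x) • ((a⁻¹ : Circle) : ℂ) with hg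
  set A : M → ℂ := fun x => circleAvg fun a => g a x with hA
  have hAs : ContMDiffOn (𝓡∂ n) 𝓘(ℝ, ℂ) ∞ A U := by
    refine contMDiffOn_circleAvg U.isOpen fun a x hx => ?_
    have h1 : ContMDiffAt ((𝓡 1).prod (𝓡∂ n)) 𝓘(ℝ, ℝ) ∞
        (fun p : Circle × M => β (act U p.1 p.2)) (a, x) :=
      (β.contMDiff _).comp (a, x) (hU.contMDiffAt_act a hx)
    have h2 : ContMDiff ((𝓡 1).prod (𝓡∂ n)) 𝓘(ℝ, ℂ) ∞
        (fun p : Circle × M => ((p.1⁻¹ : Circle) : ℂ)) :=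
      contMDiff_circle_coe.comp contMDiff_fst.inv
    exact h1.smul (h2 _)
  have hAact : ∀ x b, A (act U b x) = b * A x := by
    intro x b
    have h1 : ∀ a, g a (act U b x) = (b : ℂ) * g (a * b) x := by
      intro a
      simp only [hg, ← act_mul]
      rw [mul_smul_comm]
      rw [← Circle.coe_mul, mul_inv, mul_comm a⁻¹, mul_inv_cancel_left]
    simp only [hA, h1]
    rw [circleAvg_mul_right (fun a => (b : ℂ) * g a x) b]
    exact intervalIntegral.integral_const_mul _ _
  have hAp : A p ≠ 0 := by
    have hcont : Continuous fun a => g a p :=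
      (β.contMDiff.continuous.comp (hU.continuous_act_left hp)).smul
        (contMDiff_circle_coe.continuous.comp continuous_inv)
    have hre : (A p).re = circleAvg fun a => (g a p).re :=
      (Complex.reCLM.intervalIntegral_comp_comm
        ((hcont.comp continuous_exp_two_pi).intervalIntegrable 0 1)).symm
    have hg' : ∀ a : Circle, (g a p).re = β (act U a p) * (a : ℂ).re := by
      intro a
      simp [hg]
    have hpos : 0 < (A p).re := by
      rw [hre]
      apply circleAvg_pos (Complex.continuous_re.comp hcont)
      · intro a
        change 0 ≤ (g a p).re
        rw [hg']
        rcases le_or_gt (a : ℂ).re 0 with h | h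
        · have : β (act U a p) = 0 := hβ0 ⟨a, h, rfl⟩
          rw [this, zero_mul]
        · exact mul_nonneg (hβ _).1 h.le
      · change 0 < (g 1 p).re
        rw [hg', act_one]
        have : β p = 1 := hβ1 rfl
        rw [this]; simp
    intro h; rw [h] at hpos; simp at hpos
  set W : Set M := {x | x ∈ U ∧ A x ≠ 0} with hW
  have hWo : IsOpen W := hAs.continuousOn.isOpen_inter_preimage U.isOpen isOpen_ne
  refine ⟨W, fun x => (unitPart (A p))⁻¹ * unitPart (A x), hWo, fun x hx => hx.1, ⟨hp, hAp⟩,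
    ?_, ?_, ?_, inv_mul_cancel _⟩
  · rintro x ⟨hx, hx0⟩ a
    refine ⟨act_mem hx a, ?_⟩
    rw [hAact]
    exact mul_ne_zero (Circle.coe_ne_zero a) hx0
  · intro x hx
    apply ContMDiffAt.contMDiffWithinAt
    exact contMDiffAt_const.mul
      ((contMDiffAt_unitPart hx.2).comp x (hAs.contMDiffAt (U.isOpen.mem_nhds hx.1)))
  · rintro x ⟨hx, hx0⟩ a
    simp only
    rw [hAact, unitPart_mul a hx0, mul_left_comm]

theorem arg_circleExp_eventually : ∀ᶠ s : ℝ in 𝓝 0, (Circle.exp s : ℂ).arg = s := by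
  have : Ioo (-Real.pi) Real.pi ∈ 𝓝 (0 : ℝ) := Ioo_mem_nhds (by simp [Real.pi_pos]) Real.pi_pos
  filter_upwards [this] with s hs
  exact Circle.arg_exp hs.1 hs.2.le

/-- The velocity of the orbit through a boundary point, in the chart: an equivariant angle has
derivative one along it, and it is tangent to the boundary. -/
theorem IsFreeCircleActionNearBoundary.exists_velocity
    (hU : IsFreeCircleActionNearBoundary n U) {p : M} (hp : p ∈ (𝓡∂ n).boundary M)
    {W : Set M} {α : M → Circle} (hpW : p ∈ W)
    (hαa : ∀ x ∈ W, ∀ a, α (act U a x) = a * α x) (hα1 : α p = 1)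
    {A : EuclideanSpace ℝ (Fin n) →L[ℝ] ℝ}
    (hA : HasFDerivWithinAt (fun y => ((α ((extChartAt (𝓡∂ n) p).symm y) : Circle) : ℂ).arg) A
      (range (𝓡∂ n)) (extChartAt (𝓡∂ n) p p)) :
    ∃ v, A v = 1 ∧ coordZero n v = 0 := by
  have hpU := hU.boundary_subset hp
  set φ := extChartAt (𝓡∂ n) p with hφ
  set o : ℝ → M := fun s => act U (Circle.exp s) p with ho
  have hos : ContMDiff 𝓘(ℝ, ℝ) (𝓡∂ n) ∞ o := fun s =>
    hU.contMDiffWithinAt_act (s := univ) (contMDiff_circleExp (m := ∞)).contMDiffAt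
      contMDiffAt_const hpU
  have ho0 : o 0 = p := by simp [ho]
  have hsrc : ∀ᶠ s in 𝓝 (0 : ℝ), o s ∈ (chartAt (EuclideanHalfSpace n) p).source :=
    hos.continuous.continuousAt.eventually_mem
      ((chartAt (EuclideanHalfSpace n) p).open_source.mem_nhds (by
        rw [ho0]; exact mem_chart_source (EuclideanHalfSpace n) p))
  have hγ : DifferentiableAt ℝ (fun s => φ (o s)) 0 := by
    have h1 : ContMDiffAt (𝓡∂ n) 𝓘(ℝ, EuclideanSpace ℝ (Fin n)) ∞ φ (o 0) := by
      rw [ho0]; exact contMDiffAt_extChartAt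
    have h2 : ContDiffAt ℝ ∞ (fun s => φ (o s)) 0 := (h1.comp (0 : ℝ) (hos 0)).contDiffAt
    exact h2.differentiableAt (by simp)
  set v := deriv (fun s => φ (o s)) 0 with hv
  have hγ' : HasDerivAt (fun s => φ (o s)) v 0 := hγ.hasDerivAt
  refine ⟨v, ?_, ?_⟩
  · have h1 : HasDerivWithinAt (fun s => φ (o s)) v univ 0 := hγ'.hasDerivWithinAt
    have h2 := HasFDerivWithinAt.comp_hasDerivWithinAt_of_eq (0 : ℝ) hA h1
      (fun s _ => mem_range_self _) (by rw [ho0])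
    rw [hasDerivWithinAt_univ] at h2
    have h3 : (fun s => ((α (φ.symm (φ (o s))) : Circle) : ℂ).arg) =ᶠ[𝓝 0] id := by
      filter_upwards [hsrc, arg_circleExp_eventually] with s hs hs2
      rw [φ.left_inv (by rwa [hφ, extChartAt_source])]
      simp only [ho, id]
      rw [hαa p hpW, hα1, mul_one, hs2]
    have h4 := h3.hasDerivAt_iff.1 h2
    exact h4.unique (hasDerivAt_id 0)
  · have h1 : HasDerivAt (fun s => coordZero n (φ (o s))) (coordZero n v) 0 :=
      (coordZero n).hasFDerivAt.comp_hasDerivAt (0 : ℝ) hγ'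
    have h2 : (fun s => coordZero n (φ (o s))) =ᶠ[𝓝 0] fun _ => 0 := by
      filter_upwards [hsrc] with s hs
      exact (mem_boundary_iff_boundaryCoord hs).1 ((hU.act_mem_boundary_iff _ _).2 hp)
    exact (h2.hasDerivAt_iff.1 h1).unique (hasDerivAt_const 0 0)

/-- Slices exist at every boundary point. -/
theorem IsFreeCircleActionNearBoundary.exists_cutSlice [T2Space M] [SecondCountableTopology M]
    (hU : IsFreeCircleActionNearBoundary n U) {f : M → ℝ}
    (hf : IsInvariantBoundaryDefining n U f) {p : M} (hp : p ∈ (𝓡∂ n).boundary M) :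
    2 ≤ n ∧ ∃ S : CutSlice n U f, p ∈ S.W := by
  have hpU := hU.boundary_subset hp
  obtain ⟨W₁, α, hW₁o, hW₁U, hpW₁, hW₁a, hαs, hαa, hα1⟩ := hU.exists_equivariant hpU
  obtain ⟨V, hV, hVf⟩ := hf.invariant
  have hVf' : ∀ x ∈ V, ∀ a, f (act U a x) = f x := fun x hx a => by
    have := hVf a ⟨x, hV.subset hx⟩ hx
    rwa [act_of_mem (hV.subset hx)]
  set W₀ := W₁ ∩ V with hW₀
  have hW₀o : IsOpen W₀ := hW₁o.inter hV.isOpen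
  have hpW₀ : p ∈ W₀ := ⟨hpW₁, hV.boundary_subset hp⟩
  have hW₀a : ∀ x ∈ W₀, ∀ a, act U a x ∈ W₀ := fun x hx a =>
    ⟨hW₁a x hx.1 a, hV.act_mem hx.2 a⟩
  have hαs₀ : ContMDiffOn (𝓡∂ n) (𝓡 1) ∞ α W₀ := hαs.mono inter_subset_left
  set φ := extChartAt (𝓡∂ n) p with hφ
  set y₀ := φ p with hy₀
  -- the local angle
  set N : Set M := W₀ ∩ α ⁻¹' {a : Circle | (a : ℂ) ∈ Complex.slitPlane} with hN
  have hNo : IsOpen N := hαs₀.continuousOn.isOpen_inter_preimage hW₀o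
    (Complex.isOpen_slitPlane.preimage contMDiff_circle_coe.continuous)
  have hpN : p ∈ N := ⟨hpW₀, by simp [hα1]⟩
  set θ : M → ℝ := fun x => ((α x : Circle) : ℂ).arg with hθ
  have hθs : ContMDiffOn (𝓡∂ n) 𝓘(ℝ, ℝ) ∞ θ N := by
    intro x hx
    have h1 : ContMDiffWithinAt (𝓡∂ n) 𝓘(ℝ, ℂ) ∞ (fun x => ((α x : Circle) : ℂ)) N x :=
      (contMDiff_circle_coe _).comp_contMDiffWithinAt x ((hαs₀ x hx.1).mono inter_subset_left)
    exact (contDiffAt_arg hx.2).contMDiffAt.comp_contMDiffWithinAt x h1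
  -- the chart domain
  obtain ⟨O₁, g₁, hO₁o, hyO₁, hO₁t, -, -, hg₁pos, hfder⟩ := exists_hadamard_chart hf.smooth
    (fun x hx => (hf.zero_iff x).2 hx) hf.nonneg hp (hf.mfderiv_ne_zero p hp)
  have hO₂ : φ.symm ⁻¹' N ∈ 𝓝 y₀ := (continuousAt_extChartAt_symm p).preimage_mem_nhds (by
    rw [extChartAt_to_inv]; exact hNo.mem_nhds hpN)
  obtain ⟨O₂, hO₂N, hO₂o, hyO₂⟩ := mem_nhds_iff.1 hO₂
  set O := O₁ ∩ O₂ with hO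
  have hOo : IsOpen O := hO₁o.inter hO₂o
  have hyO : y₀ ∈ O := ⟨hyO₁, hyO₂⟩
  have hOt : range (𝓡∂ n) ∩ O ⊆ φ.target := fun y hy => hO₁t ⟨hy.1, hy.2.1⟩
  have hON : ∀ y ∈ O, φ.symm y ∈ N := fun y hy => hO₂N hy.2
  have hy₀0 : coordZero n y₀ = 0 :=
    (mem_boundary_iff_boundaryCoord (mem_chart_source (EuclideanHalfSpace n) p)).1 hp
  have hφs : ContMDiffOn 𝓘(ℝ, EuclideanSpace ℝ (Fin n)) (𝓡∂ n) ∞ φ.symm (range (𝓡∂ n) ∩ O) :=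
    (contMDiffOn_extChartAt_symm p).mono hOt
  have hθφ : ContDiffOn ℝ ∞ (fun y => θ (φ.symm y)) (range (𝓡∂ n) ∩ O) := by
    rw [← contMDiffOn_iff_contDiffOn]
    exact hθs.comp hφs fun y hy => hON y hy.2
  have hfφ : ContDiffOn ℝ ∞ (fun y => f (φ.symm y)) (range (𝓡∂ n) ∩ O) := by
    rw [← contMDiffOn_iff_contDiffOn]
    exact hf.smooth.comp_contMDiffOn hφs
  have hym : y₀ ∈ range (𝓡∂ n) ∩ O := ⟨mem_range_self _, hyO⟩
  obtain ⟨A, hA⟩ : ∃ A, HasFDerivWithinAt (fun y => θ (φ.symm y)) A (range (𝓡∂ n)) y₀ :=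
    ⟨_, (hasFDerivWithinAt_inter (hOo.mem_nhds hyO)).1
      ((hθφ.differentiableOn (by simp)) y₀ hym).hasFDerivWithinAt⟩
  obtain ⟨v, hAv, hv0⟩ := hU.exists_velocity hp hpW₁ hαa hα1 hA
  -- The orbit velocity `v` is tangent to the boundary, so the differential `A` of the angle is
  -- independent of the boundary coordinate. This already forces `2 ≤ n` as soon as a boundary point
  -- exists.
  obtain ⟨hn2, P, hP⟩ := exists_injective_completion hAv hv0 coordZero_inwardVector
  refine ⟨hn2, ?_⟩
  -- the inverse function theorem
  set c := g₁ y₀ with hc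
  -- New coordinates: the angle, `n - 2` linear functions of the old chart, and `f`. Their
  -- differential `(A, P, c • coordZero)` is injective by the choice of `P`, hence invertible by
  -- dimension.
  set G : EuclideanSpace ℝ (Fin n) → ℝ × (EuclideanSpace ℝ (Fin (n - 2)) × ℝ) :=
    fun y => (θ (φ.symm y), (P y, f (φ.symm y))) with hG
  set L₀ : EuclideanSpace ℝ (Fin n) →L[ℝ] ℝ × (EuclideanSpace ℝ (Fin (n - 2)) × ℝ) :=
    A.prod (P.prod (c • coordZero n)) with hL₀
  have hL₀inj : Function.Injective L₀.toLinearMap := by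
    rw [← LinearMap.ker_eq_bot, LinearMap.ker_eq_bot']
    intro x hx
    have hx' : (A x, (P x, c * coordZero n x)) = (0, (0, 0)) := hx
    simp only [Prod.mk.injEq] at hx'
    exact hP x hx'.1 hx'.2.1 ((mul_eq_zero.1 hx'.2.2).resolve_left hg₁pos.ne')
  have hdim : Module.finrank ℝ (EuclideanSpace ℝ (Fin n))
      = Module.finrank ℝ (ℝ × (EuclideanSpace ℝ (Fin (n - 2)) × ℝ)) := by
    simp only [Module.finrank_prod, Module.finrank_self, finrank_euclideanSpace_fin]
    omega
  set L := (LinearMap.linearEquivOfInjective L₀.toLinearMap hL₀inj hdim).toContinuousLinearEquiv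
    with hL
  have hLL₀ : (L : _ →L[ℝ] _) = L₀ := by ext x <;> rfl
  set μ : ℝ × (EuclideanSpace ℝ (Fin (n - 2)) × ℝ) →L[ℝ] ℝ :=
    (ContinuousLinearMap.snd ℝ _ ℝ).comp (ContinuousLinearMap.snd ℝ ℝ _) with hμ
  have hGs : ContDiffOn ℝ ∞ G (range (𝓡∂ n) ∩ O) :=
    hθφ.prodMk (P.contDiff.contDiffOn.prodMk hfφ)
  have hGder : HasFDerivWithinAt G (L : _ →L[ℝ] _) (range (𝓡∂ n)) y₀ := by
    rw [hLL₀]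
    exact hA.prodMk (P.hasFDerivAt.hasFDerivWithinAt.prodMk hfder)
  have hbd : ∀ y ∈ O, 0 ≤ coordZero n y → (f (φ.symm y) = 0 ↔ coordZero n y = 0) := by
    intro y hy hy0
    have hyt : y ∈ φ.target := hOt ⟨by rw [range_model_eq]; exact hy0, hy⟩
    have hs : φ.symm y ∈ (chartAt (EuclideanHalfSpace n) p).source := by
      rw [← extChartAt_source (𝓡∂ n)]; exact φ.map_target hyt
    rw [hf.zero_iff, mem_boundary_iff_boundaryCoord hs, boundaryCoord, φ.right_inv hyt]
  rw [range_model_eq] at hGs hGder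
  obtain ⟨g, hpg, hgO, hgG, hgsign, hgs⟩ :=
    exists_openPartialHomeomorph_halfSpace coordZero_inwardVector (μ := μ) hOo hGs hyO hy₀0
      (fun y hy hy0 => (hbd y hy hy0.ge).2 hy0)
      (fun y hy hy0 => lt_of_le_of_ne (hf.nonneg _) fun h =>
        hy0.ne' ((hbd y hy hy0.le).1 h.symm)) hGder (by
          have h1 : L (inwardVector n) = L₀ (inwardVector n) := rfl
          have h2 : μ (L₀ (inwardVector n)) = c * coordZero n (inwardVector n) := rfl
          rw [h1, h2, coordZero_inwardVector, mul_one]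
          exact hg₁pos)
  -- the slice
  set N' : Set M := N ∩ (φ.source ∩ φ ⁻¹' g.source) with hN'
  have hN'o : IsOpen N' := hNo.inter (isOpen_extChartAt_preimage' p g.open_source)
  -- `r` moves a point along its orbit to the slice `α = 1`. Composition with `r` makes functions
  -- invariant, and pulling back `N'` makes the domain invariant.
  set r : M → M := fun x => act U (α x)⁻¹ x with hr
  have hrs : ContMDiffOn (𝓡∂ n) (𝓡∂ n) ∞ r W₀ := fun x hx =>
    hU.contMDiffWithinAt_act ((hαs₀ x hx).inv) contMDiffWithinAt_id (hW₁U hx.1)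
  have hra : ∀ x ∈ W₀, ∀ a, r (act U a x) = r x := by
    intro x hx a
    simp only [hr]
    rw [hαa x hx.1, ← act_mul, mul_inv, mul_comm a⁻¹, inv_mul_cancel_right]
  have hαr : ∀ x ∈ W₀, α (r x) = 1 := fun x hx => by
    simp only [hr]; rw [hαa x hx.1, inv_mul_cancel]
  have hr1 : ∀ x, α x = 1 → r x = x := fun x hx => by simp [hr, hx]
  set W : Set M := W₀ ∩ r ⁻¹' N' with hW
  have hWo : IsOpen W := hrs.continuousOn.isOpen_inter_preimage hW₀o hN'o
  have hpW : p ∈ W := by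
    refine ⟨hpW₀, ?_⟩
    change r p ∈ N'
    rw [hr1 p hα1]
    exact ⟨hpN, mem_extChartAt_source p, hpg⟩
  -- The section is the inverse of `G` at angle zero, that is, on the slice `α = 1`.
  have hkey : ∀ w ∈ {w | (0, w) ∈ g.target}, 0 ≤ w.2 →
      g.symm (0, w) ∈ g.source ∧ 0 ≤ coordZero n (g.symm (0, w)) ∧ G (g.symm (0, w)) = (0, w) := by
    intro w hw hw0
    have h1 := g.map_target hw
    have h2 : 0 ≤ coordZero n (g.symm (0, w)) := by
      rw [← hgsign _ h1, g.right_inv hw]; exact hw0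
    exact ⟨h1, h2, by rw [← hgG _ h1 h2, g.right_inv hw]⟩
  have hkey2 : ∀ w ∈ {w | (0, w) ∈ g.target}, 0 ≤ w.2 →
      g.symm (0, w) ∈ φ.target ∧ φ.symm (g.symm (0, w)) ∈ W ∧ α (φ.symm (g.symm (0, w))) = 1 ∧
        P (g.symm (0, w)) = w.1 ∧ f (φ.symm (g.symm (0, w))) = w.2 := by
    intro w hw hw0
    obtain ⟨h1, h2, h3⟩ := hkey w hw hw0
    simp only [hG, Prod.ext_iff] at h3
    obtain ⟨h4, h5, h6⟩ := h3
    have hO' := hgO h1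
    have ht : g.symm (0, w) ∈ φ.target := hOt ⟨by rw [range_model_eq]; exact h2, hO'⟩
    have hα : α (φ.symm (g.symm (0, w))) = 1 := by
      rw [← Circle.exp_arg (α (φ.symm (g.symm (0, w))))]
      simp only [hθ] at h4
      rw [h4, Circle.exp_zero]
    have hNm := hON _ hO'
    refine ⟨ht, ⟨hNm.1, ?_⟩, hα, h5, h6⟩
    change r _ ∈ N'
    rw [hr1 _ hα]
    refine ⟨hNm, φ.map_target ht, ?_⟩
    rw [mem_preimage, φ.right_inv ht]
    exact h1
  have hkey3 : ∀ x ∈ W, (0, (P (φ (r x)), f x)) ∈ g.target ∧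
      φ.symm (g.symm (0, (P (φ (r x)), f x))) = r x := by
    intro x hx
    have h1 : φ (r x) ∈ g.source := hx.2.2.2
    have h2 : 0 ≤ coordZero n (φ (r x)) := boundaryCoord_nonneg p (r x)
    have h3 : φ.symm (φ (r x)) = r x := φ.left_inv hx.2.2.1
    have h4 : g (φ (r x)) = (0, (P (φ (r x)), f x)) := by
      rw [hgG _ h1 h2]
      simp only [hG, h3, hθ]
      rw [hαr x hx.1, hVf' x hx.1.2]
      simp
    rw [← h4]
    exact ⟨g.map_source h1, by rw [g.left_inv h1, h3]⟩
  refine ⟨{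
    W := W
    α := α
    d := fun x => P (φ (r x))
    O := {w | (0, w) ∈ g.target}
    σ := fun w => φ.symm (g.symm (0, w))
    isOpen_W := hWo
    W_subset := fun x hx => hW₁U hx.1.1
    act_mem_W := fun x hx a => ⟨hW₀a x hx.1 a, by
      change r _ ∈ N'; rw [hra x hx.1]; exact hx.2⟩
    f_act := fun x hx a => hVf' x hx.1.2 a
    smooth_α := hαs₀.mono inter_subset_left
    α_act := fun x hx a => hαa x hx.1.1 a
    smooth_d := ?_
    d_act := fun x hx a => by rw [hra x hx.1]
    isOpen_O := g.open_target.preimage (by fun_prop)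
    smooth_σ := ?_
    σ_mem := fun w hw hw0 => (hkey2 w hw hw0).2.1
    α_σ := fun w hw hw0 => (hkey2 w hw hw0).2.2.1
    d_σ := fun w hw hw0 => by
      obtain ⟨h1, h2, h3, h4, h5⟩ := hkey2 w hw hw0
      rw [hr1 _ h3, φ.right_inv h1, h4]
    f_σ := fun w hw hw0 => (hkey2 w hw hw0).2.2.2.2
    mem_O := fun x hx => (hkey3 x hx).1
    σ_apply := fun x hx => (hkey3 x hx).2 }, hpW⟩
  · have h1 : ContMDiffOn (𝓡∂ n) 𝓘(ℝ, EuclideanSpace ℝ (Fin n)) ∞ (fun x => φ (r x)) W :=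
      (contMDiffOn_extChartAt (x := p)).comp (hrs.mono inter_subset_left) fun x hx => by
        have := hx.2.2.1
        rwa [hφ, extChartAt_source] at this
    exact P.contDiff.contMDiff.comp_contMDiffOn h1
  · have h1 : ContDiffOn ℝ ∞ (fun w : EuclideanSpace ℝ (Fin (n - 2)) × ℝ => g.symm (0, w))
        ({w | (0, w) ∈ g.target} ∩ {w | 0 ≤ w.2}) :=
      hgs.comp (contDiff_prodMk_right _).contDiffOn fun w hw => hw
    exact (contMDiffOn_extChartAt_symm p).comp h1.contMDiffOn
      fun w hw => (hkey2 w hw.1 hw.2).1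

end

section

variable {n : ℕ} [NeZero n] {M : Type*} [TopologicalSpace M]
  [ChartedSpace (EuclideanHalfSpace n) M] {U : Opens M} [MulAction Circle U]

/-! ### The quotient map -/

theorem isQuotientMap_cutMap : Topology.IsQuotientMap (cutMap n U) := isQuotientMap_quotient_mk'

theorem continuous_cutMap : Continuous (cutMap n U) := isQuotientMap_cutMap.continuous

theorem surjective_cutMap : Function.Surjective (cutMap n U) := isQuotientMap_cutMap.surjective

theorem cutMap_eq_iff (hU : IsFreeCircleActionNearBoundary n U) {x y : M} :
    cutMap n U x = cutMap n U y ↔ x = y ∨ (x ∈ (𝓡∂ n).boundary M ∧ ∃ a, act U a x = y) := by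
  refine Quotient.eq.trans ⟨?_, ?_⟩
  · rintro (h | ⟨hx, -, a, u, rfl, rfl⟩)
    · exact Or.inl h
    · exact Or.inr ⟨hx, a, act_coe a u⟩
  · rintro (h | ⟨hx, a, rfl⟩)
    · exact Or.inl h
    · refine Or.inr ⟨hx, (hU.act_mem_boundary_iff a x).2 hx, a, ⟨x, hU.boundary_subset hx⟩, rfl, ?_⟩
      rw [act_of_mem (hU.boundary_subset hx)]

theorem cutMap_act (hU : IsFreeCircleActionNearBoundary n U) {x : M}
    (hx : x ∈ (𝓡∂ n).boundary M) (a : Circle) : cutMap n U (act U a x) = cutMap n U x :=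
  ((cutMap_eq_iff hU).2 (Or.inr ⟨hx, a, rfl⟩)).symm

theorem preimage_image_cutMap (hU : IsFreeCircleActionNearBoundary n U) {W : Set M}
    (hW : ∀ x ∈ W, x ∈ (𝓡∂ n).boundary M → ∀ a, act U a x ∈ W) :
    cutMap n U ⁻¹' (cutMap n U '' W) = W := by
  refine Subset.antisymm ?_ (subset_preimage_image _ _)
  rintro y ⟨x, hx, hxy⟩
  rcases (cutMap_eq_iff hU).1 hxy with rfl | ⟨hxb, a, rfl⟩
  · exact hx
  · exact hW x hx hxb a

theorem isOpen_image_cutMap (hU : IsFreeCircleActionNearBoundary n U) {W : Set M}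
    (hWo : IsOpen W) (hW : ∀ x ∈ W, x ∈ (𝓡∂ n).boundary M → ∀ a, act U a x ∈ W) :
    IsOpen (cutMap n U '' W) := by
  rw [← isQuotientMap_cutMap.isOpen_preimage, preimage_image_cutMap hU hW]
  exact hWo

/-- A set-theoretic section of the quotient map. -/
def cutOut (y : CutSpace n U) : M := Quotient.out y

theorem cutMap_cutOut (y : CutSpace n U) : cutMap n U (cutOut y) = y := Quotient.out_eq y

/-! ### Charts of the cut space -/

variable (n U) in
/-- Data for a chart of the cut space: a map `k` on a saturated open subset `W` of `M`, compatible
with the equivalence relation, and a map `j` back, inverse to `k` up to the equivalence relation. -/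
structure CutChart where
  /-- The preimage of the chart domain. -/
  W : Set M
  /-- The lift of the chart. -/
  k : M → EuclideanSpace ℝ (Fin n)
  /-- The lift of the inverse. -/
  j : EuclideanSpace ℝ (Fin n) → M
  /-- The image of the chart. -/
  T : Set (EuclideanSpace ℝ (Fin n))
  isOpen_W : IsOpen W
  act_mem_W : ∀ x ∈ W, x ∈ (𝓡∂ n).boundary M → ∀ a, act U a x ∈ W
  isOpen_T : IsOpen T
  k_act : ∀ x ∈ W, x ∈ (𝓡∂ n).boundary M → ∀ a, k (act U a x) = k x
  k_mem : ∀ x ∈ W, k x ∈ T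
  j_mem : ∀ u ∈ T, j u ∈ W
  k_j : ∀ u ∈ T, k (j u) = u
  cutMap_j_k : ∀ x ∈ W, cutMap n U (j (k x)) = cutMap n U x
  continuousOn_k : ContinuousOn k W
  continuousOn_j : ContinuousOn (fun u => cutMap n U (j u)) T

namespace CutChart

variable (hU : IsFreeCircleActionNearBoundary n U) (D : CutChart n U)
include hU

theorem mem_W_of_cutMap_mem {x : M} (hx : cutMap n U x ∈ cutMap n U '' D.W) : x ∈ D.W := by
  have : x ∈ cutMap n U ⁻¹' (cutMap n U '' D.W) := hx
  rwa [preimage_image_cutMap hU D.act_mem_W] at this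

theorem k_cutOut {x : M} (hx : x ∈ D.W) : D.k (cutOut (cutMap n U x)) = D.k x := by
  have h := cutMap_cutOut (cutMap n U x)
  rcases (cutMap_eq_iff hU).1 h.symm with h | ⟨hxb, a, h⟩
  · rw [← h]
  · rw [← h, D.k_act x hx hxb]

/-- The chart associated with the data. -/
def toHomeo : OpenPartialHomeomorph (CutSpace n U) (EuclideanSpace ℝ (Fin n)) where
  toFun := fun y => D.k (cutOut y)
  invFun := fun u => cutMap n U (D.j u)
  source := cutMap n U '' D.W
  target := D.T
  map_source' := by
    rintro _ ⟨x, hx, rfl⟩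
    rw [D.k_cutOut hU hx]; exact D.k_mem x hx
  map_target' := fun u hu => mem_image_of_mem _ (D.j_mem u hu)
  left_inv' := by
    rintro _ ⟨x, hx, rfl⟩
    rw [D.k_cutOut hU hx, D.cutMap_j_k x hx]
  right_inv' := fun u hu => by rw [D.k_cutOut hU (D.j_mem u hu), D.k_j u hu]
  open_source := isOpen_image_cutMap hU D.isOpen_W D.act_mem_W
  open_target := D.isOpen_T
  continuousOn_toFun := by
    have ho := isOpen_image_cutMap hU D.isOpen_W D.act_mem_W
    rw [isQuotientMap_cutMap.continuousOn_isOpen_iff ho, preimage_image_cutMap hU D.act_mem_W]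
    exact D.continuousOn_k.congr fun x hx => D.k_cutOut hU hx
  continuousOn_invFun := D.continuousOn_j

theorem toHomeo_apply {x : M} (hx : x ∈ D.W) : D.toHomeo hU (cutMap n U x) = D.k x :=
  D.k_cutOut hU hx

theorem toHomeo_symm_apply (u : EuclideanSpace ℝ (Fin n)) :
    (D.toHomeo hU).symm u = cutMap n U (D.j u) := rfl

theorem mem_toHomeo_source {x : M} : cutMap n U x ∈ (D.toHomeo hU).source ↔ x ∈ D.W :=
  ⟨D.mem_W_of_cutMap_mem hU, mem_image_of_mem _⟩

end CutChart

variable [IsManifold (𝓡∂ n) ∞ M]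

theorem isOpen_chart_interior (q : M) :
    IsOpen ((extChartAt (𝓡∂ n) q).target ∩ {u | 0 < coordZero n u}) := by
  have h : (extChartAt (𝓡∂ n) q).target ∩ {u | 0 < coordZero n u}
      = (𝓡∂ n).symm ⁻¹' (chartAt (EuclideanHalfSpace n) q).target ∩ {u | 0 < coordZero n u} := by
    rw [extChartAt_target, range_model_eq]
    ext u
    constructor
    · rintro ⟨⟨h1, h2⟩, h3⟩; exact ⟨h1, h3⟩
    · rintro ⟨h1, h3⟩; exact ⟨⟨h1, (show (0 : ℝ) ≤ coordZero n u from le_of_lt h3)⟩, h3⟩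
  rw [h]
  exact ((chartAt (EuclideanHalfSpace n) q).open_target.preimage (𝓡∂ n).continuous_symm).inter
    (isOpen_lt continuous_const (coordZero n).continuous)

theorem mem_interior_iff_coordZero_pos {q x : M}
    (hx : x ∈ (chartAt (EuclideanHalfSpace n) q).source) :
    x ∈ (𝓡∂ n).interior M ↔ 0 < coordZero n (extChartAt (𝓡∂ n) q x) := by
  rw [← ModelWithCorners.compl_boundary, mem_compl_iff, mem_boundary_iff_boundaryCoord hx]
  exact ⟨fun h => lt_of_le_of_ne (boundaryCoord_nonneg q x) (Ne.symm h), fun h => h.ne'⟩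

theorem notMem_interior_of_mem_boundary {x : M} (hx : x ∈ (𝓡∂ n).boundary M) :
    x ∉ (𝓡∂ n).interior M := by
  rw [← ModelWithCorners.compl_boundary]; exact fun h => h hx

theorem isOpen_manifold_interior : IsOpen ((𝓡∂ n).interior M) :=
  (𝓡∂ n).isOpen_interior (n := ∞) (by simp)

variable (U) in
/-- The chart of the cut space given by a chart of `M` restricted to the interior. -/
def interiorChart (q : M) : CutChart n U where
  W := (chartAt (EuclideanHalfSpace n) q).source ∩ (𝓡∂ n).interior M
  k := extChartAt (𝓡∂ n) q
  j := (extChartAt (𝓡∂ n) q).symm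
  T := (extChartAt (𝓡∂ n) q).target ∩ {u | 0 < coordZero n u}
  isOpen_W := (chartAt (EuclideanHalfSpace n) q).open_source.inter isOpen_manifold_interior
  act_mem_W := fun x hx hb => absurd hx.2 (notMem_interior_of_mem_boundary hb)
  isOpen_T := isOpen_chart_interior q
  k_act := fun x hx hb => absurd hx.2 (notMem_interior_of_mem_boundary hb)
  k_mem := fun x hx => ⟨(extChartAt (𝓡∂ n) q).map_source (by rw [extChartAt_source]; exact hx.1),
    (mem_interior_iff_coordZero_pos hx.1).1 hx.2⟩
  j_mem := fun u hu => by
    have h1 : (extChartAt (𝓡∂ n) q).symm u ∈ (chartAt (EuclideanHalfSpace n) q).source := by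
      rw [← extChartAt_source (𝓡∂ n)]; exact (extChartAt (𝓡∂ n) q).map_target hu.1
    refine ⟨h1, (mem_interior_iff_coordZero_pos h1).2 ?_⟩
    rw [(extChartAt (𝓡∂ n) q).right_inv hu.1]; exact hu.2
  k_j := fun u hu => (extChartAt (𝓡∂ n) q).right_inv hu.1
  cutMap_j_k := fun x hx => by
    rw [(extChartAt (𝓡∂ n) q).left_inv (by rw [extChartAt_source]; exact hx.1)]
  continuousOn_k := (continuousOn_extChartAt q).mono fun x hx => by
    rw [extChartAt_source]; exact hx.1
  continuousOn_j := continuous_cutMap.comp_continuousOn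
    ((continuousOn_extChartAt_symm q).mono inter_subset_left)

variable (n) in
/-- The model of the slice charts is isomorphic to the standard model. -/
def sliceModelEquiv (hn : 2 ≤ n) :
    (EuclideanSpace ℝ (Fin (n - 2)) × ℂ) ≃L[ℝ] EuclideanSpace ℝ (Fin n) :=
  ContinuousLinearEquiv.ofFinrankEq (by
    simp only [Module.finrank_prod, finrank_euclideanSpace_fin, Complex.finrank_real_complex]
    omega)

namespace CutSlice

variable {f : M → ℝ} (S : CutSlice n U f)

/-- The chart of the cut space near a reduced orbit, on the level of `M`. -/
def κ (x : M) : EuclideanSpace ℝ (Fin (n - 2)) × ℂ := (S.d x, (S.α x : ℂ) * (Real.sqrt (f x) : ℝ))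

/-- The quotient map of the model: `(d, z) ↦ (d, |z|²)`. -/
def sq (m : ℕ) (u : EuclideanSpace ℝ (Fin m) × ℂ) : EuclideanSpace ℝ (Fin m) × ℝ :=
  (u.1, ‖u.2‖ ^ 2)

theorem contDiff_sq (m : ℕ) : ContDiff ℝ ∞ (sq m) :=
  contDiff_fst.prodMk ((contDiff_norm_sq ℝ).comp contDiff_snd)

theorem sq_nonneg (m : ℕ) (u : EuclideanSpace ℝ (Fin m) × ℂ) : 0 ≤ (sq m u).2 := by
  simp only [sq]; positivity

/-- The inverse of the chart near a reduced orbit, on the level of `M`. -/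
def ι (u : EuclideanSpace ℝ (Fin (n - 2)) × ℂ) : M := act U (unitPart u.2) (S.σ (sq _ u))

/-- The image of the chart near a reduced orbit. -/
def target : Set (EuclideanSpace ℝ (Fin (n - 2)) × ℂ) := sq _ ⁻¹' S.O

theorem isOpen_target : IsOpen S.target := S.isOpen_O.preimage (contDiff_sq _).continuous

theorem σ_sq_mem {u : EuclideanSpace ℝ (Fin (n - 2)) × ℂ} (hu : u ∈ S.target) :
    S.σ (sq _ u) ∈ S.W := S.σ_mem _ hu (sq_nonneg _ u)

theorem contMDiffOn_σ_sq : ContMDiffOn 𝓘(ℝ, EuclideanSpace ℝ (Fin (n - 2)) × ℂ) (𝓡∂ n) ∞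
    (fun u => S.σ (sq _ u)) S.target :=
  S.smooth_σ.comp (contDiff_sq _).contMDiff.contMDiffOn fun u hu => ⟨hu, sq_nonneg _ u⟩

theorem ι_mem {u : EuclideanSpace ℝ (Fin (n - 2)) × ℂ} (hu : u ∈ S.target) : S.ι u ∈ S.W :=
  S.act_mem_W _ (S.σ_sq_mem hu) _

theorem f_ι {u : EuclideanSpace ℝ (Fin (n - 2)) × ℂ} (hu : u ∈ S.target) :
    f (S.ι u) = ‖u.2‖ ^ 2 := by
  rw [ι, S.f_act _ (S.σ_sq_mem hu), S.f_σ _ hu (sq_nonneg _ u)]; rfl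

theorem κ_ι {u : EuclideanSpace ℝ (Fin (n - 2)) × ℂ} (hu : u ∈ S.target) : S.κ (S.ι u) = u := by
  have h := S.σ_sq_mem hu
  rw [κ, S.f_ι hu, Real.sqrt_sq (norm_nonneg _), ι, S.d_act _ h, S.d_σ _ hu (sq_nonneg _ u),
    S.α_act _ h, S.α_σ _ hu (sq_nonneg _ u), mul_one, mul_comm, norm_mul_unitPart]
  rfl

theorem sq_κ (hf : ∀ x, 0 ≤ f x) (x : M) : sq _ (S.κ x) = (S.d x, f x) := by
  simp only [κ, sq, norm_mul, Circle.norm_coe, one_mul, Complex.norm_real, Real.norm_eq_abs,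
    sq_abs, Real.sq_sqrt (hf x)]

theorem κ_mem (hf : ∀ x, 0 ≤ f x) {x : M} (hx : x ∈ S.W) : S.κ x ∈ S.target := by
  rw [target, mem_preimage, sq_κ S hf]; exact S.mem_O x hx

theorem σ_sq_κ (hf : ∀ x, 0 ≤ f x) {x : M} (hx : x ∈ S.W) :
    S.σ (sq _ (S.κ x)) = act U (S.α x)⁻¹ x := by
  rw [sq_κ S hf, S.σ_apply x hx]

/-- Off the boundary the unit part of `α √f` is `α`, which undoes the rotation by `α⁻¹`. On the
boundary the default unit part of `0` enters, harmlessly: any rotation gives the same point of the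
cut space. -/
theorem cutMap_ι_κ (hU : IsFreeCircleActionNearBoundary n U)
    (hf : IsInvariantBoundaryDefining n U f) {x : M} (hx : x ∈ S.W) :
    cutMap n U (S.ι (S.κ x)) = cutMap n U x := by
  rw [ι, S.σ_sq_κ hf.nonneg hx, ← act_mul]
  rcases (hf.nonneg x).eq_or_lt with h | h
  · exact cutMap_act hU ((hf.zero_iff x).1 h.symm) _
  · have : unitPart (S.κ x).2 = S.α x := eq_unitPart (Real.sqrt_pos.2 h) rfl
    rw [this, mul_inv_cancel, act_one]

theorem contMDiffAt_ι (hU : IsFreeCircleActionNearBoundary n U)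
    {u : EuclideanSpace ℝ (Fin (n - 2)) × ℂ} (hu : u ∈ S.target) (hu0 : u.2 ≠ 0) :
    ContMDiffAt 𝓘(ℝ, EuclideanSpace ℝ (Fin (n - 2)) × ℂ) (𝓡∂ n) ∞ S.ι u :=
  hU.contMDiffWithinAt_act (s := univ)
    ((contMDiffAt_unitPart hu0).comp u contDiff_snd.contMDiff.contMDiffAt)
    (S.contMDiffOn_σ_sq.contMDiffAt (S.isOpen_target.mem_nhds hu)) (S.W_subset (S.σ_sq_mem hu))

/-- Restricted to the interior, where `f > 0` and the square root is smooth. -/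
theorem contMDiffOn_κ (hf : IsInvariantBoundaryDefining n U f) :
    ContMDiffOn (𝓡∂ n) 𝓘(ℝ, EuclideanSpace ℝ (Fin (n - 2)) × ℂ) ∞ S.κ
      (S.W ∩ (𝓡∂ n).interior M) := by
  intro x hx
  apply ContMDiffAt.contMDiffWithinAt
  have hW := S.isOpen_W.mem_nhds hx.1
  have hfx : f x ≠ 0 := fun h => notMem_interior_of_mem_boundary ((hf.zero_iff x).1 h) hx.2
  have h1 : ContMDiffAt (𝓡∂ n) 𝓘(ℝ, ℝ) ∞ (fun x => Real.sqrt (f x)) x :=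
    (Real.contDiffAt_sqrt hfx).contMDiffAt.comp x (hf.smooth x)
  have h3 : ContMDiffAt (𝓡∂ n) 𝓘(ℝ, ℂ) ∞ (fun x => (S.α x : ℂ)) x :=
    (contMDiff_circle_coe _).comp x (S.smooth_α.contMDiffAt hW)
  have h4 : ContMDiffAt (𝓡∂ n) 𝓘(ℝ, ℂ) ∞ (fun x => (S.α x : ℂ) * (Real.sqrt (f x) : ℝ)) x := by
    refine (h1.smul h3).congr_of_eventuallyEq (Filter.Eventually.of_forall fun y => ?_)
    exact (mul_comm _ _).trans Complex.real_smul.symm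
  exact (S.smooth_d.contMDiffAt hW).prodMk_space h4

theorem continuousOn_κ (hf : IsInvariantBoundaryDefining n U f) : ContinuousOn S.κ S.W :=
  S.smooth_d.continuousOn.prodMk
    ((contMDiff_circle_coe.continuous.comp_continuousOn S.smooth_α.continuousOn).mul
      (Complex.continuous_ofReal.comp (hf.smooth.continuous.sqrt)).continuousOn)

/-- At `z = 0` the unit part jumps. But `σ` of the base point is on the boundary, so its whole orbit
maps into the given open set; by openness of the invariant core the same holds for nearby values of
`σ`, whatever rotation is applied. -/
theorem continuousOn_cutMap_ι (hU : IsFreeCircleActionNearBoundary n U)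
    (hf : IsInvariantBoundaryDefining n U f) :
    ContinuousOn (fun u => cutMap n U (S.ι u)) S.target := by
  intro u hu
  apply ContinuousAt.continuousWithinAt
  by_cases hu0 : u.2 = 0
  · intro N hN
    obtain ⟨O, hON, hO, huO⟩ := mem_nhds_iff.1 hN
    have hσb : S.σ (sq _ u) ∈ (𝓡∂ n).boundary M := by
      rw [← hf.zero_iff, S.f_σ _ hu (sq_nonneg _ u)]
      simp [sq, hu0]
    have h1 : S.σ (sq _ u) ∈ invariantCore U (cutMap n U ⁻¹' O) := by
      refine ⟨S.W_subset (S.σ_sq_mem hu), fun a => ?_⟩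
      rw [mem_preimage, cutMap_act hU hσb]
      have h3 : cutMap n U (S.ι u) ∈ O := huO
      rwa [ι, cutMap_act hU hσb] at h3
    have h2 := (S.contMDiffOn_σ_sq.continuousOn.continuousAt
      (S.isOpen_target.mem_nhds hu)).eventually_mem
        ((hU.isOpen_invariantCore (hO.preimage continuous_cutMap)).mem_nhds h1)
    rw [Filter.mem_map]
    filter_upwards [h2] with w hw
    exact hON (hw.2 _)
  · exact continuous_cutMap.continuousAt.comp (S.contMDiffAt_ι hU hu hu0).continuousAt

end CutSlice

/-- The chart of the cut space given by a slice. -/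
def sliceChart (hU : IsFreeCircleActionNearBoundary n U) {f : M → ℝ}
    (hf : IsInvariantBoundaryDefining n U f) (hn : 2 ≤ n) (S : CutSlice n U f) :
    CutChart n U where
  W := S.W
  k := fun x => sliceModelEquiv n hn (S.κ x)
  j := fun u => S.ι ((sliceModelEquiv n hn).symm u)
  T := (sliceModelEquiv n hn).symm ⁻¹' S.target
  isOpen_W := S.isOpen_W
  act_mem_W := fun x hx _ a => S.act_mem_W x hx a
  isOpen_T := S.isOpen_target.preimage (sliceModelEquiv n hn).symm.continuous
  k_act := fun x hx hb a => by
    have h1 : f x = 0 := (hf.zero_iff x).2 hb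
    simp only [CutSlice.κ]
    rw [S.d_act x hx, S.f_act x hx, h1]
    simp
  k_mem := fun x hx => by
    rw [mem_preimage, ContinuousLinearEquiv.symm_apply_apply]; exact S.κ_mem hf.nonneg hx
  j_mem := fun u hu => S.ι_mem hu
  k_j := fun u hu => by
    rw [S.κ_ι hu, ContinuousLinearEquiv.apply_symm_apply]
  cutMap_j_k := fun x hx => by
    rw [ContinuousLinearEquiv.symm_apply_apply]; exact S.cutMap_ι_κ hU hf hx
  continuousOn_k := (sliceModelEquiv n hn).continuous.comp_continuousOn (S.continuousOn_κ hf)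
  continuousOn_j := (S.continuousOn_cutMap_ι hU hf).comp
    (sliceModelEquiv n hn).symm.continuous.continuousOn fun _ hu => hu

end

section

variable {n : ℕ} [NeZero n] {M : Type*} [TopologicalSpace M]
  [ChartedSpace (EuclideanHalfSpace n) M] {U : Opens M} [MulAction Circle U]

/-! ### Transition maps -/

/-- The lifts of the chart and of its inverse are smooth over the interior. -/
structure CutChart.IsSmooth (D : CutChart n U) : Prop where
  k : ContMDiffOn (𝓡∂ n) 𝓘(ℝ, EuclideanSpace ℝ (Fin n)) ∞ D.k (D.W ∩ (𝓡∂ n).interior M)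
  j : ∀ u ∈ D.T, D.j u ∈ (𝓡∂ n).interior M →
    ContMDiffAt 𝓘(ℝ, EuclideanSpace ℝ (Fin n)) (𝓡∂ n) ∞ D.j u

variable [IsManifold (𝓡∂ n) ∞ M]

theorem isSmooth_interiorChart (q : M) : (interiorChart (n := n) U q).IsSmooth where
  k := contMDiffOn_extChartAt.mono fun _ hx => hx.1.1
  j := fun _ hu _ => (contMDiffOn_extChartAt_symm q).contMDiffAt
    (Filter.mem_of_superset ((isOpen_chart_interior q).mem_nhds hu) inter_subset_left)

theorem isSmooth_sliceChart (hU : IsFreeCircleActionNearBoundary n U) {f : M → ℝ}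
    (hf : IsInvariantBoundaryDefining n U f) (hn : 2 ≤ n) (S : CutSlice n U f) :
    (sliceChart hU hf hn S).IsSmooth where
  k := (sliceModelEquiv n hn).contDiff.contMDiff.comp_contMDiffOn (S.contMDiffOn_κ hf)
  j := fun u hu hint => by
    have h0 : ((sliceModelEquiv n hn).symm u).2 ≠ 0 := by
      intro h0
      apply notMem_interior_of_mem_boundary _ hint
      rw [← hf.zero_iff]
      have h1 : f (S.ι ((sliceModelEquiv n hn).symm u)) = 0 := by rw [S.f_ι hu, h0]; simp
      exact h1
    exact (S.contMDiffAt_ι hU hu h0).comp u (sliceModelEquiv n hn).symm.contDiff.contMDiff.contMDiffAt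

/-- Handles every transition that involves an interior chart, since such charts never meet the image
of the boundary. -/
theorem CutChart.contDiffAt_transition (hU : IsFreeCircleActionNearBoundary n U)
    {D D' : CutChart n U} (hD : D.IsSmooth) (hD' : D'.IsSmooth)
    {u : EuclideanSpace ℝ (Fin n)} (hu : u ∈ D.T) (hint : D.j u ∈ (𝓡∂ n).interior M)
    (hu' : D.j u ∈ D'.W) :
    ContDiffAt ℝ ∞ (fun u => D'.toHomeo hU (cutMap n U (D.j u))) u := by
  rw [← contMDiffAt_iff_contDiffAt]
  have hopen := D'.isOpen_W.inter (isOpen_manifold_interior (n := n) (M := M))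
  have h1 := (hD'.k.contMDiffAt (hopen.mem_nhds ⟨hu', hint⟩)).comp u (hD.j u hu hint)
  refine h1.congr_of_eventuallyEq ?_
  filter_upwards [(hD.j u hu hint).continuousAt.eventually_mem (D'.isOpen_W.mem_nhds hu')] with w hw
  exact D'.toHomeo_apply hU hw

/-- The unit part from `ι` meets the modulus from `√f`, and their product is `z`. The resulting
formula has no singularity at `z = 0`, so transitions between slice charts are smooth there. -/
theorem CutSlice.κ_ι_of_mem {f : M → ℝ} (S S' : CutSlice n U f)
    {v : EuclideanSpace ℝ (Fin (n - 2)) × ℂ}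
    (hv : v ∈ S.target) (hv' : S.σ (sq _ v) ∈ S'.W) :
    S'.κ (S.ι v) = (S'.d (S.σ (sq _ v)), (S'.α (S.σ (sq _ v)) : ℂ) * v.2) := by
  rw [κ, S.f_ι hv, Real.sqrt_sq (norm_nonneg _), ι, S'.d_act _ hv', S'.α_act _ hv', Circle.coe_mul]
  rw [mul_right_comm, mul_comm (unitPart v.2 : ℂ), norm_mul_unitPart, mul_comm v.2]

theorem CutSlice.contDiffAt_transition (hU : IsFreeCircleActionNearBoundary n U) {f : M → ℝ}
    (hf : IsInvariantBoundaryDefining n U f) (hn : 2 ≤ n) (S S' : CutSlice n U f)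
    {u : EuclideanSpace ℝ (Fin n)} (hu : u ∈ (sliceChart hU hf hn S).T)
    (hu' : (sliceChart hU hf hn S).j u ∈ S'.W) :
    ContDiffAt ℝ ∞ (fun u => (sliceChart hU hf hn S').toHomeo hU
      (cutMap n U ((sliceChart hU hf hn S).j u))) u := by
  set Ψ := sliceModelEquiv n hn with hΨ
  set v := Ψ.symm u with hv
  have hvt : v ∈ S.target := hu
  have hv' : S.σ (sq _ v) ∈ S'.W := by
    have h : S.ι v ∈ S'.W := hu'
    -- `S'.W` is invariant, so membership of `ι v` gives membership of the unrotated point.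
    have h' := S'.act_mem_W _ h (unitPart v.2)⁻¹
    rwa [CutSlice.ι, act_inv_act] at h'
  have hσ : ContMDiffAt 𝓘(ℝ, EuclideanSpace ℝ (Fin (n - 2)) × ℂ) (𝓡∂ n) ∞
      (fun u => S.σ (sq _ u)) v := S.contMDiffOn_σ_sq.contMDiffAt (S.isOpen_target.mem_nhds hvt)
  have hW := S'.isOpen_W.mem_nhds hv'
  have h1 : ContDiffAt ℝ ∞ (fun v => S'.d (S.σ (sq _ v))) v :=
    ((S'.smooth_d.contMDiffAt hW).comp v hσ).contDiffAt
  have h2 : ContDiffAt ℝ ∞ (fun v => (S'.α (S.σ (sq _ v)) : ℂ)) v :=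
    ((contMDiff_circle_coe _).comp v ((S'.smooth_α.contMDiffAt hW).comp v hσ)).contDiffAt
  have h3 : ContDiffAt ℝ ∞ (fun v : EuclideanSpace ℝ (Fin (n - 2)) × ℂ =>
      Ψ (S'.d (S.σ (sq _ v)), (S'.α (S.σ (sq _ v)) : ℂ) * v.2)) v :=
    Ψ.contDiff.contDiffAt.comp v (h1.prodMk (h2.mul contDiffAt_snd))
  have h4 := h3.comp u Ψ.symm.contDiff.contDiffAt
  refine h4.congr_of_eventuallyEq ?_
  have hΨc : ContinuousAt Ψ.symm u := Ψ.symm.continuous.continuousAt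
  filter_upwards [hΨc.eventually_mem (S.isOpen_target.mem_nhds hvt),
    (hσ.continuousAt.comp hΨc).eventually_mem hW] with w hw hw'
  have hmem : (sliceChart hU hf hn S).j w ∈ S'.W := S'.act_mem_W _ hw' _
  rw [CutChart.toHomeo_apply hU (sliceChart hU hf hn S') hmem]
  exact congrArg Ψ (S.κ_ι_of_mem S' hw hw')

/-! ### The smooth structure -/

section Structure

variable (hU : IsFreeCircleActionNearBoundary n U) {f : M → ℝ}
  (hf : IsInvariantBoundaryDefining n U f)

/-- The atlas of the cut space. -/
def cutAtlas : Set (OpenPartialHomeomorph (CutSpace n U) (EuclideanSpace ℝ (Fin n))) :=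
  {e | (∃ q, e = (interiorChart U q).toHomeo hU) ∨
    ∃ hn S, e = (sliceChart hU hf hn S).toHomeo hU}

theorem contDiffOn_cutAtlas {e e' : OpenPartialHomeomorph (CutSpace n U) (EuclideanSpace ℝ (Fin n))}
    (he : e ∈ cutAtlas hU hf) (he' : e' ∈ cutAtlas hU hf) :
    ContDiffOn ℝ ∞ (e' ∘ e.symm) (e.symm.trans e').source := by
  intro u hu
  apply ContDiffAt.contDiffWithinAt
  rw [OpenPartialHomeomorph.trans_source] at hu
  obtain ⟨hu1, hu2⟩ := hu
  rcases he with ⟨q, rfl⟩ | ⟨hn, S, rfl⟩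
  · have hint := ((interiorChart (n := n) U q).j_mem u hu1).2
    rcases he' with ⟨q', rfl⟩ | ⟨hn, S', rfl⟩
    · exact CutChart.contDiffAt_transition hU (isSmooth_interiorChart q)
        (isSmooth_interiorChart q') hu1 hint ((CutChart.mem_toHomeo_source hU _).1 hu2)
    · exact CutChart.contDiffAt_transition hU (isSmooth_interiorChart q)
        (isSmooth_sliceChart hU hf hn S') hu1 hint ((CutChart.mem_toHomeo_source hU _).1 hu2)
  · rcases he' with ⟨q', rfl⟩ | ⟨hn, S', rfl⟩
    · have hmem := (CutChart.mem_toHomeo_source hU _).1 hu2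
      exact CutChart.contDiffAt_transition hU (isSmooth_sliceChart hU hf hn S)
        (isSmooth_interiorChart q') hu1 hmem.2 hmem
    · exact CutSlice.contDiffAt_transition hU hf hn S S' hu1
        ((CutChart.mem_toHomeo_source hU _).1 hu2)

variable [T2Space M] [SecondCountableTopology M]

theorem exists_mem_cutAtlas (y : CutSpace n U) : ∃ e ∈ cutAtlas hU hf, y ∈ e.source := by
  obtain ⟨x, rfl⟩ := surjective_cutMap y
  by_cases hx : x ∈ (𝓡∂ n).interior M
  · exact ⟨_, Or.inl ⟨x, rfl⟩, mem_image_of_mem _ ⟨mem_chart_source _ x, hx⟩⟩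
  · rw [← mem_compl_iff, ModelWithCorners.compl_interior] at hx
    obtain ⟨hn, S, hS⟩ := hU.exists_cutSlice hf hx
    exact ⟨_, Or.inr ⟨hn, S, rfl⟩, mem_image_of_mem _ hS⟩

/-- The charted space structure of the cut space determined by an invariant boundary defining
function. -/
abbrev cutChartedSpace : ChartedSpace (EuclideanSpace ℝ (Fin n)) (CutSpace n U) where
  atlas := cutAtlas hU hf
  chartAt := fun y => (exists_mem_cutAtlas hU hf y).choose
  mem_chart_source := fun y => (exists_mem_cutAtlas hU hf y).choose_spec.2
  chart_mem_atlas := fun y => (exists_mem_cutAtlas hU hf y).choose_spec.1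

theorem isManifold_cutChartedSpace :
    letI := cutChartedSpace hU hf
    IsManifold (𝓡 n) ∞ (CutSpace n U) := by
  let _ := cutChartedSpace hU hf
  refine isManifold_of_contDiffOn (𝓡 n) ∞ _ fun e e' he he' => ?_
  have := contDiffOn_cutAtlas hU hf he he'
  simpa using this

theorem contMDiffAt_iff_of_mem_cutAtlas {h : CutSpace n U → ℝ}
    {e : OpenPartialHomeomorph (CutSpace n U) (EuclideanSpace ℝ (Fin n))}
    (he : e ∈ cutAtlas hU hf) {y : CutSpace n U} (hy : y ∈ e.source) :
    letI := cutChartedSpace hU hf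
    ContMDiffAt (𝓡 n) 𝓘(ℝ, ℝ) ∞ h y ↔ ContDiffAt ℝ ∞ (h ∘ e.symm) (e y) := by
  let _ := cutChartedSpace hU hf
  have := isManifold_cutChartedSpace hU hf
  have hmax : e ∈ IsManifold.maximalAtlas (𝓡 n) ∞ (CutSpace n U) :=
    IsManifold.subset_maximalAtlas he
  rw [← contMDiffWithinAt_univ, contMDiffWithinAt_iff_source_of_mem_maximalAtlas hmax hy,
    contMDiffWithinAt_iff_contDiffWithinAt]
  simp [contDiffWithinAt_univ]

theorem contMDiffAt_cutMap_interior_iff {h : CutSpace n U → ℝ} {x : M}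
    (hx : x ∈ (𝓡∂ n).interior M) :
    letI := cutChartedSpace hU hf
    ContMDiffAt (𝓡 n) 𝓘(ℝ, ℝ) ∞ h (cutMap n U x) ↔
      ContMDiffAt (𝓡∂ n) 𝓘(ℝ, ℝ) ∞ (h ∘ cutMap n U) x := by
  set D := interiorChart (n := n) U x with hD
  have hxW : x ∈ D.W := ⟨mem_chart_source _ x, hx⟩
  refine (contMDiffAt_iff_of_mem_cutAtlas hU hf (e := D.toHomeo hU) (Or.inl ⟨x, rfl⟩)
    (mem_image_of_mem _ hxW)).trans ?_
  rw [D.toHomeo_apply hU hxW]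
  have hjk : ∀ y ∈ D.W, D.j (D.k y) = y := fun y hy =>
    (extChartAt (𝓡∂ n) x).left_inv (by rw [extChartAt_source]; exact hy.1)
  have hT := D.k_mem x hxW
  have hjs := (isSmooth_interiorChart (n := n) (U := U) x).j (D.k x) hT (D.j_mem _ hT).2
  constructor
  · intro h1
    have h2 : ContMDiffAt (𝓡∂ n) 𝓘(ℝ, EuclideanSpace ℝ (Fin n)) ∞ D.k x := contMDiffAt_extChartAt
    refine (h1.contMDiffAt.comp x h2).congr_of_eventuallyEq ?_
    filter_upwards [D.isOpen_W.mem_nhds hxW] with y hy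
    simp only [Function.comp]
    rw [D.toHomeo_symm_apply, hjk y hy]
  · intro h1
    rw [← hjk x hxW] at h1
    exact (h1.comp _ hjs).contDiffAt

theorem contMDiffAt_cutMap_slice_iff {h : CutSpace n U → ℝ} (hn : 2 ≤ n) (S : CutSlice n U f)
    {x : M} (hx : x ∈ S.W) :
    letI := cutChartedSpace hU hf
    ContMDiffAt (𝓡 n) 𝓘(ℝ, ℝ) ∞ h (cutMap n U x) ↔
      ContDiffAt ℝ ∞ (fun v => h (cutMap n U (S.ι v))) (S.κ x) := by
  set D := sliceChart hU hf hn S with hD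
  have hxW : x ∈ D.W := hx
  refine (contMDiffAt_iff_of_mem_cutAtlas hU hf (e := D.toHomeo hU) (Or.inr ⟨hn, S, rfl⟩)
    (mem_image_of_mem _ hxW)).trans ?_
  rw [D.toHomeo_apply hU hxW]
  set Ψ := sliceModelEquiv n hn with hΨ
  have hk : D.k x = Ψ (S.κ x) := rfl
  rw [hk]
  have heq : h ∘ (D.toHomeo hU).symm = (fun v => h (cutMap n U (S.ι v))) ∘ Ψ.symm := rfl
  rw [heq]
  constructor
  · intro h1
    have h2 := h1.comp (S.κ x) Ψ.contDiff.contDiffAt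
    refine h2.congr_of_eventuallyEq (Filter.Eventually.of_forall fun v => ?_)
    simp
  · intro h1
    have h2 : S.κ x = Ψ.symm (Ψ (S.κ x)) := by simp
    rw [h2] at h1
    exact h1.comp _ Ψ.symm.contDiff.contDiffAt

end Structure

end

section

variable {n : ℕ} [NeZero n] {M : Type*} [TopologicalSpace M]
  [ChartedSpace (EuclideanHalfSpace n) M] {U : Opens M} [MulAction Circle U]
  [IsManifold (𝓡∂ n) ∞ M]

theorem IsInvariantBoundaryDefining.exists_isInvariantNhd {f : M → ℝ}
    (hf : IsInvariantBoundaryDefining n U f) :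
    ∃ V, IsInvariantNhd n U V ∧ ∀ x ∈ V, ∀ a, f (act U a x) = f x := by
  obtain ⟨V, hV, hVf⟩ := hf.invariant
  refine ⟨V, hV, fun x hx a => ?_⟩
  have := hVf a ⟨x, hV.subset hx⟩ hx
  rwa [act_of_mem (hV.subset hx)]

theorem IsInvariantBoundaryDefining.pos_iff {f : M → ℝ}
    (hf : IsInvariantBoundaryDefining n U f) {x : M} :
    0 < f x ↔ x ∈ (𝓡∂ n).interior M := by
  rw [← ModelWithCorners.compl_boundary, mem_compl_iff, ← hf.zero_iff]
  exact ⟨fun h => h.ne', fun h => lt_of_le_of_ne (hf.nonneg x) (Ne.symm h)⟩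

theorem contMDiffAt_complex_mul {E H N : Type*} [NormedAddCommGroup E] [NormedSpace ℝ E]
    [TopologicalSpace H] {I : ModelWithCorners ℝ E H} [TopologicalSpace N] [ChartedSpace H N]
    {f g : N → ℂ} {x : N} (hf : ContMDiffAt I 𝓘(ℝ, ℂ) ∞ f x) (hg : ContMDiffAt I 𝓘(ℝ, ℂ) ∞ g x) :
    ContMDiffAt I 𝓘(ℝ, ℂ) ∞ (fun x => f x * g x) x :=
  (contDiff_mul (𝕜 := ℝ) (𝔸 := ℂ)).contMDiff.contMDiffAt.comp x (hf.prodMk_space hg)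

/-! ### Smooth functions on the cut space -/

section SmoothFunctions

variable (hU : IsFreeCircleActionNearBoundary n U) {f : M → ℝ}
  (hf : IsInvariantBoundaryDefining n U f) [T2Space M] [SecondCountableTopology M]

/-- In a slice chart, with `a` the unit part of `z`, equivariance gives `H (a · σ, |z|) = H (σ, a
|z|) = H (σ, z)`, which is smooth because `σ` is evaluated at `(d, |z|²)`. -/
theorem contMDiff_of_mem_cutFunctions {h : CutSpace n U → ℝ} (hh : h ∈ cutFunctions n U f) :
    letI := cutChartedSpace hU hf
    ContMDiff (𝓡 n) 𝓘(ℝ, ℝ) ∞ h := by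
  let _ := cutChartedSpace hU hf
  obtain ⟨hint, V, H, hV, hH, hHa, hhH⟩ := hh
  intro y
  obtain ⟨x, rfl⟩ := surjective_cutMap y
  by_cases hx : x ∈ (𝓡∂ n).interior M
  · exact (contMDiffAt_cutMap_interior_iff hU hf hx).2
      (hint.contMDiffAt (isOpen_manifold_interior.mem_nhds hx))
  rw [← mem_compl_iff, ModelWithCorners.compl_interior] at hx
  obtain ⟨hn, S, hS⟩ := hU.exists_cutSlice hf hx
  refine (contMDiffAt_cutMap_slice_iff hU hf hn S hS).2 ?_
  have hut := S.κ_mem hf.nonneg hS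
  have hσV : S.σ (CutSlice.sq _ (S.κ x)) ∈ V := by
    rw [S.σ_sq_κ hf.nonneg hS]; exact hV.act_mem (hV.boundary_subset hx) _
  have hσ : ContMDiffAt 𝓘(ℝ, EuclideanSpace ℝ (Fin (n - 2)) × ℂ) (𝓡∂ n) ∞
      (fun v => S.σ (CutSlice.sq _ v)) (S.κ x) :=
    S.contMDiffOn_σ_sq.contMDiffAt (S.isOpen_target.mem_nhds hut)
  have h1 : ContMDiffAt 𝓘(ℝ, EuclideanSpace ℝ (Fin (n - 2)) × ℂ) 𝓘(ℝ, ℝ) ∞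
      (fun v => H (S.σ (CutSlice.sq _ v), v.2)) (S.κ x) :=
    (hH.contMDiffAt ((hV.isOpen.prod isOpen_univ).mem_nhds ⟨hσV, mem_univ _⟩)).comp (S.κ x)
      (f := fun v => (S.σ (CutSlice.sq _ v), v.2))
      (hσ.prodMk contDiff_snd.contMDiff.contMDiffAt)
  refine h1.contDiffAt.congr_of_eventuallyEq ?_
  filter_upwards [S.isOpen_target.mem_nhds hut,
    hσ.continuousAt.eventually_mem (hV.isOpen.mem_nhds hσV)] with v hv hvV
  have h2 : S.ι v ∈ V := hV.act_mem hvV _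
  rw [hhH _ h2, S.f_ι hv, Real.sqrt_sq (norm_nonneg _), CutSlice.ι, act_of_mem (hV.subset hvV),
    hHa _ _ _ hvV, mul_comm, norm_mul_unitPart]

/-- A smooth function on the cut space is of the form `H₀ (x, √f)`, equivariantly. -/
theorem exists_contMDiff_lift {h : CutSpace n U → ℝ}
    (hh : letI := cutChartedSpace hU hf; ContMDiff (𝓡 n) 𝓘(ℝ, ℝ) ∞ h) {V C : Set M}
    (hV : IsInvariantNhd n U V)
    (hC : IsClosed C) (hCV : C ⊆ V) :
    ∃ H : M × ℂ → ℝ, ContMDiff ((𝓡∂ n).prod 𝓘(ℝ, ℂ)) 𝓘(ℝ, ℝ) ∞ H ∧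
      ∀ x ∈ C, ∀ b : Circle, H (x, b * (Real.sqrt (f x) : ℝ)) = h (cutMap n U (act U b x)) := by
  have := sigmaCompactSpace_of_halfSpace n M
  -- The prescribed values, as a convex constraint that is empty of content unless `x ∈ C` and `|z|²
  -- = f x`. Convexity reduces the construction to local solutions, found in four cases below.
  let t : M × ℂ → Set ℝ := fun p => {v | p.1 ∈ C → ∀ b : Circle,
    p.2 = b * (Real.sqrt (f p.1) : ℝ) → v = h (cutMap n U (act U b p.1))}
  have ht : ∀ p, Convex ℝ (t p) := by
    intro p v hv w hw a b _ _ hab hp c hc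
    rw [hv hp c hc, hw hp c hc, ← add_smul, hab, one_smul]
  have hnorm : ∀ x (b : Circle), ‖(b * (Real.sqrt (f x) : ℝ) : ℂ)‖ ^ 2 = f x := fun x b => by
    rw [norm_mul, Circle.norm_coe, one_mul, Complex.norm_real, Real.norm_eq_abs, sq_abs,
      Real.sq_sqrt (hf.nonneg x)]
  have hfc := hf.smooth.continuous
  have hloc : ∀ p : M × ℂ, ∃ N ∈ 𝓝 p, ∃ g : M × ℂ → ℝ,
      ContMDiffOn ((𝓡∂ n).prod 𝓘(ℝ, ℂ)) 𝓘(ℝ, ℝ) ∞ g N ∧ ∀ q ∈ N, g q ∈ t q := by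
    rintro ⟨x, z⟩
    by_cases hxC : x ∈ C
    swap
    · exact ⟨_, (hC.isOpen_compl.preimage continuous_fst).mem_nhds hxC, fun _ => 0,
        contMDiffOn_const, fun q hq hq' => absurd hq' hq⟩
    by_cases hz : ‖z‖ ^ 2 = f x
    swap
    · refine ⟨{p | ‖p.2‖ ^ 2 ≠ f p.1}, (isOpen_ne_fun (by fun_prop) (by fun_prop)).mem_nhds hz,
        fun _ => 0, contMDiffOn_const, fun q hq _ b hb => absurd ?_ hq⟩
      rw [hb, hnorm]
    by_cases hz0 : z = 0
    · have hxb : x ∈ (𝓡∂ n).boundary M := by rw [← hf.zero_iff, ← hz, hz0]; simp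
      obtain ⟨hn, S, hS⟩ := hU.exists_cutSlice hf hxb
      -- Obtained from `κ` by replacing `√f` with the free variable `z`, hence smooth across the
      -- boundary; at `z = b √f` it equals `κ (b · x)`.
      let G : M × ℂ → EuclideanSpace ℝ (Fin (n - 2)) × ℂ := fun p => (S.d p.1, S.α p.1 * p.2)
      have hG : ∀ p : M × ℂ, p.1 ∈ S.W → ContMDiffAt ((𝓡∂ n).prod 𝓘(ℝ, ℂ))
          𝓘(ℝ, EuclideanSpace ℝ (Fin (n - 2)) × ℂ) ∞ G p := by
        intro p hp
        have hW := S.isOpen_W.mem_nhds hp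
        have h1 : ContMDiffAt ((𝓡∂ n).prod 𝓘(ℝ, ℂ)) 𝓘(ℝ, EuclideanSpace ℝ (Fin (n - 2))) ∞
            (fun p : M × ℂ => S.d p.1) p := (S.smooth_d.contMDiffAt hW).comp p contMDiffAt_fst
        have h2 : ContMDiffAt ((𝓡∂ n).prod 𝓘(ℝ, ℂ)) 𝓘(ℝ, ℂ) ∞
            (fun p : M × ℂ => (S.α p.1 : ℂ)) p :=
          ((contMDiff_circle_coe _).comp _ (S.smooth_α.contMDiffAt hW)).comp p contMDiffAt_fst
        exact h1.prodMk_space (contMDiffAt_complex_mul h2 contMDiffAt_snd)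
      have hN : IsOpen ((Prod.fst ⁻¹' S.W : Set (M × ℂ)) ∩ G ⁻¹' S.target) :=
        ContinuousOn.isOpen_inter_preimage
          (fun p hp => (hG p hp).continuousAt.continuousWithinAt)
          (S.isOpen_W.preimage continuous_fst) S.isOpen_target
      refine ⟨_, hN.mem_nhds ⟨hS, ?_⟩, fun p => h (cutMap n U (S.ι (G p))), ?_, ?_⟩
      · have h1 : G (x, z) = S.κ x := by
          simp only [G, CutSlice.κ]
          rw [← hz, hz0]; simp
        rw [mem_preimage, h1]
        exact S.κ_mem hf.nonneg hS
      · intro p hp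
        have h1 := (contMDiffAt_cutMap_slice_iff hU hf hn S (S.ι_mem hp.2)).1 (hh _)
        rw [S.κ_ι hp.2] at h1
        exact (h1.contMDiffAt.comp p (hG p hp.1)).contMDiffWithinAt
      · intro p hp _ b hb
        have h1 : G p = S.κ (act U b p.1) := by
          simp only [G, CutSlice.κ]
          rw [S.d_act _ hp.1, S.α_act _ hp.1, S.f_act _ hp.1, hb, Circle.coe_mul]
          congr 1; ring
        simp only
        rw [h1, S.cutMap_ι_κ hU hf (S.act_mem_W _ hp.1 b)]
    -- For `z ≠ 0` the rotation `b` can be recovered smoothly as the unit part of `z`.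
    · refine ⟨(V ∩ {x | 0 < f x}) ×ˢ {0}ᶜ, ?_, fun p => h (cutMap n U (act U (unitPart p.2) p.1)),
        ?_, ?_⟩
      · refine ((hV.isOpen.inter (isOpen_lt continuous_const hfc)).prod
          isOpen_compl_singleton).mem_nhds ⟨⟨hCV hxC, ?_⟩, hz0⟩
        rw [mem_ofPred_eq, ← hz]
        have := norm_pos_iff.2 hz0
        positivity
      · rintro ⟨y, w⟩ ⟨⟨hyV, hy⟩, hw⟩
        have h1 : act U (unitPart w) y ∈ (𝓡∂ n).interior M :=
          (hU.act_mem_interior_iff _ _).2 (hf.pos_iff.1 hy)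
        have h2 := (contMDiffAt_cutMap_interior_iff hU hf h1).1 (hh _)
        have h3 : ContMDiffAt ((𝓡∂ n).prod 𝓘(ℝ, ℂ)) (𝓡∂ n) ∞
            (fun p : M × ℂ => act U (unitPart p.2) p.1) (y, w) :=
          hU.contMDiffWithinAt_act (s := univ)
            ((contMDiffAt_unitPart hw).comp (y, w) contMDiffAt_snd) contMDiffAt_fst
            (hV.subset hyV)
        exact (h2.comp (y, w) h3).contMDiffWithinAt
      · rintro ⟨y, w⟩ ⟨⟨hyV, hy⟩, hw⟩ _ b hb
        simp only at hb ⊢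
        rw [eq_unitPart (Real.sqrt_pos.2 hy) hb]
  obtain ⟨H, hH⟩ := exists_contMDiffMap_forall_mem_convex_of_local ((𝓡∂ n).prod 𝓘(ℝ, ℂ)) ht hloc
  exact ⟨H, H.contMDiff, fun x hx b => hH (x, _) hx b rfl⟩

/-- Averaging `H (a⁻¹ · x, a z)` over `a` produces the required equivariance. At `z = √f` the
integrand is constantly `h (c x)`, which is why the lift was prescribed at all rotations `b √f` and
not just at `√f`. -/
theorem mem_cutFunctions_of_contMDiff {h : CutSpace n U → ℝ}
    (hh : letI := cutChartedSpace hU hf; ContMDiff (𝓡 n) 𝓘(ℝ, ℝ) ∞ h) :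
    h ∈ cutFunctions n U f := by
  have := normalSpace_of_halfSpace n M
  refine ⟨fun x hx => ((contMDiffAt_cutMap_interior_iff hU hf hx).1 (hh _)).contMDiffWithinAt, ?_⟩
  obtain ⟨V₀, hV₀, hVf⟩ := hf.exists_isInvariantNhd
  have hbc : IsClosed ((𝓡∂ n).boundary M) := by
    rw [← ModelWithCorners.compl_interior]; exact isOpen_manifold_interior.isClosed_compl
  obtain ⟨O, hO, hbO, hOV⟩ := normal_exists_closure_subset hbc hV₀.isOpen hV₀.boundary_subset
  obtain ⟨H, hH, hHh⟩ := exists_contMDiff_lift hU hf hh hV₀ isClosed_closure hOV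
  have hV := hU.isInvariantNhd_invariantCore hO hbO
  refine ⟨_, fun p => circleAvg fun a => H (act U a⁻¹ p.1, a * p.2), hV, ?_, ?_, ?_⟩
  · refine contMDiffOn_circleAvg (hV.isOpen.prod isOpen_univ)
      (g := fun (a : Circle) (p : M × ℂ) => H (act U a⁻¹ p.1, a * p.2)) ?_
    rintro a ⟨x, z⟩ ⟨hx, -⟩
    have h1 : ContMDiffAt ((𝓡 1).prod ((𝓡∂ n).prod 𝓘(ℝ, ℂ))) (𝓡∂ n) ∞
        (fun p : Circle × (M × ℂ) => act U p.1⁻¹ p.2.1) (a, (x, z)) :=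
      hU.contMDiffWithinAt_act (s := univ) (contMDiffAt_fst.inv)
        (contMDiffAt_fst.comp _ contMDiffAt_snd) hx.1
    have h2 : ContMDiffAt ((𝓡 1).prod ((𝓡∂ n).prod 𝓘(ℝ, ℂ))) 𝓘(ℝ, ℂ) ∞
        (fun p : Circle × (M × ℂ) => (p.1 : ℂ) * p.2.2) (a, (x, z)) :=
      contMDiffAt_complex_mul ((contMDiff_circle_coe _).comp _ contMDiffAt_fst)
        (contMDiffAt_snd.comp _ contMDiffAt_snd)
    exact (hH _).comp (a, (x, z)) (h1.prodMk h2)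
  · intro b x z hx
    simp only
    rw [← act_coe, ← circleAvg_mul_right _ b]
    congr 1
    ext a
    rw [← act_mul, mul_inv_rev, mul_comm b⁻¹, inv_mul_cancel_right, Circle.coe_mul, mul_assoc]
  · intro x hx
    have h1 : ∀ a : Circle, H (act U a⁻¹ x, a * (Real.sqrt (f x) : ℝ)) = h (cutMap n U x) := by
      intro a
      have h2 := hHh (act U a⁻¹ x) (subset_closure (hx.2 _)) a
      rwa [act_act_inv, hVf x (hOV (subset_closure (invariantCore_subset _ hx)))] at h2
    simp only [h1, circleAvg_const]

theorem smoothFunctions_eq_cutFunctions :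
    letI := cutChartedSpace hU hf
    smoothFunctions n (CutSpace n U) = cutFunctions n U f :=
  Subset.antisymm (fun _ hh => mem_cutFunctions_of_contMDiff hU hf hh)
    fun _ hh => contMDiff_of_mem_cutFunctions hU hf hh

end SmoothFunctions

/-! ### Independence of the boundary defining function -/

section Independence

/-- Both functions are the boundary coordinate times a smooth factor that is positive at `p`; the
ratio of these factors makes sense on the boundary too. -/
theorem IsInvariantBoundaryDefining.exists_local_ratio {f₁ f₂ : M → ℝ}
    (hf₁ : IsInvariantBoundaryDefining n U f₁) (hf₂ : IsInvariantBoundaryDefining n U f₂)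
    {p : M} (hp : p ∈ (𝓡∂ n).boundary M) :
    ∃ N ∈ 𝓝 p, ∃ u : M → ℝ, ContMDiffOn (𝓡∂ n) 𝓘(ℝ, ℝ) ∞ u N ∧
      ∀ x ∈ N, 0 < u x ∧ f₁ x = u x * f₂ x := by
  obtain ⟨O₁, g₁, hO₁, hp₁, -, hg₁, he₁, hpos₁, -⟩ := exists_hadamard_chart hf₁.smooth
    (fun x => (hf₁.zero_iff x).2) hf₁.nonneg hp (hf₁.mfderiv_ne_zero p hp)
  obtain ⟨O₂, g₂, hO₂, hp₂, -, hg₂, he₂, hpos₂, -⟩ := exists_hadamard_chart hf₂.smooth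
    (fun x => (hf₂.zero_iff x).2) hf₂.nonneg hp (hf₂.mfderiv_ne_zero p hp)
  set φ := extChartAt (𝓡∂ n) p with hφ
  have hr : ∀ x, φ x ∈ range (𝓡∂ n) := fun x => mem_range_self _
  have hφc : ContinuousAt φ p := continuousAt_extChartAt p
  have hev : ∀ {O : Set (EuclideanSpace ℝ (Fin n))} {g : EuclideanSpace ℝ (Fin n) → ℝ},
      IsOpen O → φ p ∈ O → ContDiffOn ℝ ∞ g (range (𝓡∂ n) ∩ O) → 0 < g (φ p) →
      ∀ᶠ x in 𝓝 p, φ x ∈ O ∧ 0 < g (φ x) := by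
    intro O g hO hpO hg hpos
    have h1 := hφc.eventually_mem (hO.mem_nhds hpO)
    have h2 : Filter.Tendsto φ (𝓝 p) (𝓝[range (𝓡∂ n) ∩ O] (φ p)) :=
      tendsto_nhdsWithin_iff.2 ⟨hφc, h1.mono fun x hx => ⟨hr x, hx⟩⟩
    have h3 := (hg.continuousOn _ ⟨hr p, hpO⟩).tendsto.comp h2
    exact h1.and (h3.eventually (lt_mem_nhds hpos))
  refine ⟨_, (Filter.inter_mem (extChartAt_source_mem_nhds (I := 𝓡∂ n) p)
    ((hev hO₁ hp₁ hg₁ hpos₁).and (hev hO₂ hp₂ hg₂ hpos₂))),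
    (fun y => g₁ y / g₂ y) ∘ φ, ?_, ?_⟩
  · have h1 : ContDiffOn ℝ ∞ (fun y => g₁ y / g₂ y)
        (((range (𝓡∂ n) ∩ O₁) ∩ (range (𝓡∂ n) ∩ O₂)) ∩ {y | g₂ y ≠ 0}) :=
      (hg₁.mono fun y hy => hy.1.1).div (hg₂.mono fun y hy => hy.1.2) fun y hy => hy.2
    refine h1.contMDiffOn.comp (t := _) (contMDiffOn_extChartAt.mono ?_) ?_
    · intro x hx
      rw [← extChartAt_source (𝓡∂ n)]
      exact hx.1
    · exact fun x hx => ⟨⟨⟨hr x, hx.2.1.1⟩, ⟨hr x, hx.2.2.1⟩⟩, hx.2.2.2.ne'⟩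
  · rintro x ⟨hxs, ⟨hx1, hx1'⟩, ⟨hx2, hx2'⟩⟩
    refine ⟨div_pos hx1' hx2', ?_⟩
    have h1 := he₁ _ ⟨hr x, hx1⟩
    have h2 := he₂ _ ⟨hr x, hx2⟩
    rw [φ.left_inv hxs] at h1 h2
    simp only [Function.comp]
    rw [h1, h2]
    field_simp

variable [T2Space M] [SecondCountableTopology M]

/-- Positive solutions `v` of `f₁ x = v * f₂ x` form a convex set, so local ratios glue. -/
theorem IsInvariantBoundaryDefining.exists_ratio {f₁ f₂ : M → ℝ}
    (hf₁ : IsInvariantBoundaryDefining n U f₁) (hf₂ : IsInvariantBoundaryDefining n U f₂) :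
    ∃ u : M → ℝ, ContMDiff (𝓡∂ n) 𝓘(ℝ, ℝ) ∞ u ∧ ∀ x, 0 < u x ∧ f₁ x = u x * f₂ x := by
  have := sigmaCompactSpace_of_halfSpace n M
  have ht : ∀ x, Convex ℝ {v | 0 < v ∧ f₁ x = v * f₂ x} := by
    rintro x v ⟨hv, hv'⟩ w ⟨hw, hw'⟩ a b ha hb hab
    refine ⟨(convex_Ioi (0 : ℝ)) hv hw ha hb hab, ?_⟩
    simp only [smul_eq_mul]
    calc f₁ x = (a + b) * f₁ x := by rw [hab, one_mul]
      _ = a * (v * f₂ x) + b * (w * f₂ x) := by rw [← hv', ← hw']; ring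
      _ = _ := by ring
  suffices hloc : ∀ p : M, ∃ N ∈ 𝓝 p, ∃ u : M → ℝ, ContMDiffOn (𝓡∂ n) 𝓘(ℝ, ℝ) ∞ u N ∧
      ∀ x ∈ N, 0 < u x ∧ f₁ x = u x * f₂ x by
    obtain ⟨u, hu⟩ := exists_contMDiffMap_forall_mem_convex_of_local (n := (⊤ : ℕ∞)) (𝓡∂ n) ht hloc
    exact ⟨u, u.contMDiff, hu⟩
  intro p
  by_cases hp : p ∈ (𝓡∂ n).interior M
  · refine ⟨_, isOpen_manifold_interior.mem_nhds hp, fun x => f₁ x / f₂ x, fun x hx => ?_,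
      fun x hx => ?_⟩
    · exact (hf₁.smooth.contMDiffAt.div₀ hf₂.smooth.contMDiffAt
        (hf₂.pos_iff.2 hx).ne').contMDiffWithinAt
    · have h1 := hf₁.pos_iff.2 hx
      have h2 := hf₂.pos_iff.2 hx
      exact ⟨div_pos h1 h2, by field_simp⟩
  · rw [← mem_compl_iff, ModelWithCorners.compl_interior] at hp
    exact hf₁.exists_local_ratio hf₂ hp

/-- Near the boundary `f₁ = w f₂`, where `w` is the orbit average of the ratio. Since `√f₁ = √w
√f₂`, the function `H (x, √w z)` serves for `f₂`; it is equivariant because `w` is invariant. -/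
theorem cutFunctions_subset (hU : IsFreeCircleActionNearBoundary n U) {f₁ f₂ : M → ℝ}
    (hf₁ : IsInvariantBoundaryDefining n U f₁) (hf₂ : IsInvariantBoundaryDefining n U f₂) :
    cutFunctions n U f₁ ⊆ cutFunctions n U f₂ := by
  rintro h ⟨hint, V, H, hV, hH, hHa, hhH⟩
  refine ⟨hint, ?_⟩
  obtain ⟨u, hus, hu⟩ := hf₁.exists_ratio hf₂
  obtain ⟨V₁, hV₁, hVf₁⟩ := hf₁.exists_isInvariantNhd
  obtain ⟨V₂, hV₂, hVf₂⟩ := hf₂.exists_isInvariantNhd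
  set W := invariantCore U (V ∩ (V₁ ∩ V₂)) with hWdef
  have hW : IsInvariantNhd n U W := hU.isInvariantNhd_invariantCore
    (hV.isOpen.inter (hV₁.isOpen.inter hV₂.isOpen)) fun x hx =>
      ⟨hV.boundary_subset hx, hV₁.boundary_subset hx, hV₂.boundary_subset hx⟩
  have hWV : W ⊆ V ∩ (V₁ ∩ V₂) := invariantCore_subset _
  set w : M → ℝ := fun x => circleAvg fun a => u (act U a x) with hw
  have hws : ContMDiffOn (𝓡∂ n) 𝓘(ℝ, ℝ) ∞ w U := hU.contMDiffOn_average hus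
  have hwpos : ∀ x ∈ W, 0 < w x := fun x hx =>
    circleAvg_pos (hus.continuous.comp (hU.continuous_act_left hx.1)) (fun a => (hu _).1.le) (hu _).1
  have hwf : ∀ x ∈ W, f₁ x = w x * f₂ x := by
    intro x hx
    have h1 : (fun a => u (act U a x) * f₂ x) = fun _ : Circle => f₁ x := by
      ext a
      rw [← hVf₁ x (hWV hx).2.1 a, (hu (act U a x)).2, hVf₂ x (hWV hx).2.2 a]
    calc f₁ x = circleAvg fun a => u (act U a x) * f₂ x := by rw [h1, circleAvg_const]
      _ = w x * f₂ x := by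
        simp only [hw, circleAvg]
        rw [intervalIntegral.integral_mul_const]
  refine ⟨W, fun p => H (p.1, (Real.sqrt (w p.1) : ℝ) * p.2), hW, ?_, ?_, ?_⟩
  · rintro ⟨x, z⟩ ⟨hx, -⟩
    apply ContMDiffAt.contMDiffWithinAt
    have h1 : ContMDiffAt ((𝓡∂ n).prod 𝓘(ℝ, ℂ)) 𝓘(ℝ, ℝ) ∞
        (fun p : M × ℂ => Real.sqrt (w p.1)) (x, z) :=
      ContMDiffAt.comp (x, z) (g := fun x => Real.sqrt (w x)) (I' := 𝓡∂ n)
        ((Real.contDiffAt_sqrt (hwpos x hx).ne').contMDiffAt.comp x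
          (hws.contMDiffAt (U.isOpen.mem_nhds hx.1))) contMDiffAt_fst
    have h2 : ContMDiffAt ((𝓡∂ n).prod 𝓘(ℝ, ℂ)) 𝓘(ℝ, ℂ) ∞
        (fun p : M × ℂ => ((Real.sqrt (w p.1) : ℝ) : ℂ) * p.2) (x, z) := by
      refine (h1.smul contMDiffAt_snd).congr_of_eventuallyEq
        (Filter.Eventually.of_forall fun p => ?_)
      exact Complex.real_smul.symm
    have h3 : ContMDiffAt ((𝓡∂ n).prod 𝓘(ℝ, ℂ)) 𝓘(ℝ, ℝ) ∞ H (x, (Real.sqrt (w x) : ℝ) * z) :=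
      hH.contMDiffAt ((hV.isOpen.prod isOpen_univ).mem_nhds ⟨(hWV hx).1, mem_univ _⟩)
    exact h3.comp (x, z) (contMDiffAt_fst.prodMk h2)
  · intro a x z hx
    have h1 : w ((a • x : U) : M) = w x := by
      rw [← act_coe]; exact circleAvg_act u a x
    simp only
    rw [h1, hHa a x _ (hWV hx).1, mul_left_comm]
  · intro x hx
    rw [hhH x (hWV hx).1, hwf x hx, Real.sqrt_mul (hwpos x hx).le, Complex.ofReal_mul]

theorem cutFunctions_eq (hU : IsFreeCircleActionNearBoundary n U) {f₁ f₂ : M → ℝ}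
    (hf₁ : IsInvariantBoundaryDefining n U f₁) (hf₂ : IsInvariantBoundaryDefining n U f₂) :
    cutFunctions n U f₁ = cutFunctions n U f₂ :=
  Subset.antisymm (cutFunctions_subset hU hf₁ hf₂) (cutFunctions_subset hU hf₂ hf₁)

end Independence

end

/-! ### Smooth functions determine the structure; topology of the cut space and the reduced space.
-/

section

/-- A surjective continuous closed map from a normal T1 space has Hausdorff target. -/
theorem t2Space_of_isClosedMap {X Y : Type*} [TopologicalSpace X] [TopologicalSpace Y]
    [NormalSpace X] [T1Space X] {q : X → Y} (hc : Continuous q) (hq : IsClosedMap q)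
    (hs : Function.Surjective q) : T2Space Y := by
  have hsing : ∀ y, IsClosed ({y} : Set Y) := by
    intro y
    obtain ⟨x, rfl⟩ := hs y
    rw [← image_singleton]
    exact hq _ isClosed_singleton
  refine ⟨fun y z hyz => ?_⟩
  obtain ⟨u, v, hu, hv, hyu, hzv, huv⟩ := normal_separation ((hsing y).preimage hc)
    ((hsing z).preimage hc) (Disjoint.preimage _ (disjoint_singleton.2 hyz))
  refine ⟨(q '' uᶜ)ᶜ, (q '' vᶜ)ᶜ, (hq _ hu.isClosed_compl).isOpen_compl,
    (hq _ hv.isClosed_compl).isOpen_compl, ?_, ?_, ?_⟩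
  · rintro ⟨x, hx, hxy⟩
    exact hx (hyu hxy)
  · rintro ⟨x, hx, hxz⟩
    exact hx (hzv hxz)
  · rw [disjoint_left]
    intro w hwu hwv
    obtain ⟨x, rfl⟩ := hs w
    exact disjoint_left.1 huv (by_contra fun h => hwu ⟨x, h, rfl⟩)
      (by_contra fun h => hwv ⟨x, h, rfl⟩)

/-- A continuous map to a manifold is smooth if its composites with smooth functions are. -/
theorem contMDiff_of_forall_comp {E H N Y : Type*} [NormedAddCommGroup E] [NormedSpace ℝ E]
    [TopologicalSpace H] {I : ModelWithCorners ℝ E H} [TopologicalSpace N] [ChartedSpace H N]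
    {m : ℕ} [TopologicalSpace Y] [T2Space Y] [ChartedSpace (EuclideanSpace ℝ (Fin m)) Y]
    [IsManifold (𝓡 m) ∞ Y] {F : N → Y} (hc : Continuous F)
    (hF : ∀ h : Y → ℝ, ContMDiff (𝓡 m) 𝓘(ℝ, ℝ) ∞ h → ContMDiff I 𝓘(ℝ, ℝ) ∞ (h ∘ F)) :
    ContMDiff I (𝓡 m) ∞ F := by
  intro x
  refine contMDiffAt_iff_target.2 ⟨hc.continuousAt, ?_⟩
  set φ := extChartAt (𝓡 m) (F x) with hφ
  obtain ⟨ρ⟩ : Nonempty (SmoothBumpFunction (𝓡 m) (F x)) := inferInstance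
  let L := EuclideanSpace.equiv (Fin m) ℝ
  have h1 : ∀ i, ContMDiffAt I 𝓘(ℝ, ℝ) ∞ (fun w => L (φ (F w)) i) x := by
    intro i
    have h2 : ContMDiffOn (𝓡 m) 𝓘(ℝ, ℝ) ∞ (fun y => L (φ y) i)
        (chartAt (EuclideanSpace ℝ (Fin m)) (F x)).source :=
      ((contDiff_apply ℝ ℝ i).comp L.contDiff).contMDiff.comp_contMDiffOn contMDiffOn_extChartAt
    -- Coordinates are only locally defined; multiplied by a bump function they become global smooth
    -- functions with the same germ.
    refine (hF _ (ρ.contMDiff_smul h2) x).congr_of_eventuallyEq ?_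
    filter_upwards [hc.continuousAt.eventually ρ.eventuallyEq_one] with w hw
    simp [hw]
  have h3 : ContMDiffAt I 𝓘(ℝ, Fin m → ℝ) ∞ (fun w => L (φ (F w))) x := contMDiffAt_pi_space.2 h1
  refine (L.symm.contDiff.contMDiff.contMDiffAt.comp x h3).congr_of_eventuallyEq
    (Filter.Eventually.of_forall fun w => ?_)
  simp

/-- The criterion above, applied to the identity in both directions; equality of dimensions is not
assumed. -/
theorem sameSmoothStructure_of_smoothFunctions_eq {m m' : ℕ} {X : Type*} [TopologicalSpace X]
    [T2Space X] (A : ChartedSpace (EuclideanSpace ℝ (Fin m)) X)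
    (B : ChartedSpace (EuclideanSpace ℝ (Fin m')) X)
    (hA : IsManifold (𝓡 m) ∞ X) (hB : IsManifold (𝓡 m') ∞ X)
    (h : @smoothFunctions m X _ A = @smoothFunctions m' X _ B) : SameSmoothStructure A B :=
  ⟨@contMDiff_of_forall_comp _ _ X X _ _ _ _ _ A m' _ _ B _ _ continuous_id
      fun _ hg => (Set.ext_iff.1 h _).2 hg,
    @contMDiff_of_forall_comp _ _ X X _ _ _ _ _ B m _ _ A _ _ continuous_id
      fun _ hg => (Set.ext_iff.1 h _).1 hg⟩

variable {n : ℕ} [NeZero n] {M : Type*} [TopologicalSpace M]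
  [ChartedSpace (EuclideanHalfSpace n) M] {U : Opens M} [MulAction Circle U]
  [IsManifold (𝓡∂ n) ∞ M]

/-! ### Topology of the cut space -/

variable (n M) in
theorem isClosed_manifold_boundary : IsClosed ((𝓡∂ n).boundary M) := by
  rw [← ModelWithCorners.compl_interior]; exact isOpen_manifold_interior.isClosed_compl

/-- The saturation of `K` adds the boundary points whose orbit meets `K`. Their complement is the
interior together with the invariant core of `Kᶜ`, open by compactness of the circle. -/
theorem isClosedMap_cutMap (hU : IsFreeCircleActionNearBoundary n U) :
    IsClosedMap (cutMap n U) := by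
  intro K hK
  rw [← isQuotientMap_cutMap.isClosed_preimage]
  have h : cutMap n U ⁻¹' (cutMap n U '' K)
      = K ∪ ((𝓡∂ n).interior M ∪ invariantCore U Kᶜ)ᶜ := by
    ext x
    rw [mem_preimage, mem_union, mem_compl_iff, mem_union, not_or]
    constructor
    · rintro ⟨y, hy, hyx⟩
      rcases (cutMap_eq_iff hU).1 hyx.symm with rfl | ⟨hxb, a, rfl⟩
      · exact Or.inl hy
      · exact Or.inr ⟨notMem_interior_of_mem_boundary hxb, fun h => h.2 a hy⟩
    · rintro (hx | ⟨hxi, hxc⟩)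
      · exact mem_image_of_mem _ hx
      · rw [← mem_compl_iff, ModelWithCorners.compl_interior] at hxi
        have : ∃ a, act U a x ∈ K := by
          by_contra! h
          exact hxc ⟨hU.boundary_subset hxi, h⟩
        obtain ⟨a, ha⟩ := this
        exact ⟨_, ha, cutMap_act hU hxi a⟩
  rw [h]
  exact hK.union (isOpen_manifold_interior.union
    (hU.isOpen_invariantCore hK.isOpen_compl)).isClosed_compl

theorem t2Space_cutSpace [T2Space M] [SecondCountableTopology M]
    (hU : IsFreeCircleActionNearBoundary n U) : T2Space (CutSpace n U) :=
  have := normalSpace_of_halfSpace n M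
  t2Space_of_isClosedMap continuous_cutMap (isClosedMap_cutMap hU) surjective_cutMap

/-- Second countability does not pass to quotients in general, but σ-compactness does, and with
charts it gives second countability back. -/
theorem sigmaCompactSpace_cutSpace [SecondCountableTopology M] :
    SigmaCompactSpace (CutSpace n U) := by
  have := sigmaCompactSpace_of_halfSpace n M
  have h := isSigmaCompact_range (continuous_cutMap (n := n) (U := U))
  rwa [surjective_cutMap.range_eq, isSigmaCompact_univ_iff] at h

theorem isOpen_image_interior (hU : IsFreeCircleActionNearBoundary n U) :
    IsOpen (cutMap n U '' (𝓡∂ n).interior M) :=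
  isOpen_image_cutMap hU isOpen_manifold_interior
    fun _ hx hb => absurd hx (notMem_interior_of_mem_boundary hb)

/-- If the boundary contained an open set, `f` would vanish there and so would its differential. -/
theorem IsInvariantBoundaryDefining.dense_interior {f : M → ℝ}
    (hf : IsInvariantBoundaryDefining n U f) : Dense ((𝓡∂ n).interior M) := by
  by_contra h
  obtain ⟨x, hx⟩ : ∃ x, x ∉ closure ((𝓡∂ n).interior M) := by
    by_contra! h'
    exact h h'
  have hnhds : ∀ᶠ y in 𝓝 x, y ∈ (𝓡∂ n).boundary M := by
    filter_upwards [isClosed_closure.isOpen_compl.mem_nhds hx] with y hy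
    rw [← ModelWithCorners.compl_interior]
    exact fun h => hy (subset_closure h)
  refine hf.mfderiv_ne_zero x hnhds.self_of_nhds ?_
  have h0 : f =ᶠ[𝓝 x] fun _ => (0 : ℝ) := hnhds.mono fun y hy => (hf.zero_iff y).2 hy
  rw [h0.mfderiv_eq, mfderiv_const]
  rfl

theorem dense_image_interior {f : M → ℝ} (hf : IsInvariantBoundaryDefining n U f) :
    Dense (cutMap n U '' (𝓡∂ n).interior M) :=
  surjective_cutMap.denseRange.dense_image continuous_cutMap hf.dense_interior

theorem isClosed_reducedSet (hU : IsFreeCircleActionNearBoundary n U) :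
    IsClosed (reducedSet n U) :=
  isClosedMap_cutMap hU _ (isClosed_manifold_boundary n M)

theorem cutMap_mem_reducedSet_iff (hU : IsFreeCircleActionNearBoundary n U) {x : M} :
    cutMap n U x ∈ reducedSet n U ↔ x ∈ (𝓡∂ n).boundary M := by
  have h := preimage_image_cutMap (W := (𝓡∂ n).boundary M) hU
    fun x hx _ a => (hU.act_mem_boundary_iff a x).2 hx
  exact Set.ext_iff.1 h x

theorem range_boundaryOrbitMap (hb : (𝓡∂ n).boundary M ⊆ (U : Set M)) :
    Set.range (boundaryOrbitMap n U hb) = reducedSet n U := by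
  ext y
  constructor
  · rintro ⟨q, rfl⟩
    induction q using Quotient.inductionOn with
    | h x => exact mem_image_of_mem _ x.2
  · rintro ⟨x, hx, rfl⟩
    exact ⟨Quotient.mk _ ⟨x, hx⟩, rfl⟩

/-- The induced map is closed because `cutMap` is closed and `∂M` is closed in `M`. -/
theorem isEmbedding_boundaryOrbitMap (hU : IsFreeCircleActionNearBoundary n U) :
    Topology.IsEmbedding (boundaryOrbitMap n U hU.boundary_subset) := by
  refine (Topology.IsClosedEmbedding.of_continuous_injective_isClosedMap ?_ ?_ ?_).isEmbedding
  · exact Continuous.quotient_lift (continuous_cutMap.comp continuous_subtype_val) _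
  · intro p q
    induction p using Quotient.inductionOn with
    | h x =>
      induction q using Quotient.inductionOn with
      | h y =>
        intro hxy
        apply Quotient.sound
        rcases (cutMap_eq_iff hU).1 (show cutMap n U x = cutMap n U y from hxy) with h | ⟨_, a, h⟩
        · exact ⟨1, by rw [one_smul]; exact h⟩
        · refine ⟨a, ?_⟩
          rw [← h, act_of_mem (hU.boundary_subset x.2)]
  · intro K hK
    have h1 : IsClosed (Subtype.val '' (Quotient.mk (boundaryOrbitSetoid n U hU.boundary_subset)
        ⁻¹' K)) :=
      (isClosed_manifold_boundary n M).isClosedEmbedding_subtypeVal.isClosedMap _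
        (hK.preimage continuous_quot_mk)
    convert isClosedMap_cutMap hU _ h1 using 1
    ext y
    constructor
    · rintro ⟨q, hq, rfl⟩
      induction q using Quotient.inductionOn with
      | h x => exact ⟨x, ⟨x, hq, rfl⟩, rfl⟩
    · rintro ⟨_, ⟨x, hx, rfl⟩, rfl⟩
      exact ⟨_, hx, rfl⟩

/-- In a slice chart the complex coordinate is `α √f`, which vanishes exactly on the boundary; its
kernel has real codimension two. -/
theorem isEmbeddedSubmanifold_reducedSet [T2Space M] [SecondCountableTopology M]
    (hU : IsFreeCircleActionNearBoundary n U) {f : M → ℝ}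
    (hf : IsInvariantBoundaryDefining n U f) :
    letI := cutChartedSpace hU hf
    IsEmbeddedSubmanifold n 2 (reducedSet n U) := by
  let _ := cutChartedSpace hU hf
  have := isManifold_cutChartedSpace hU hf
  rintro _ ⟨x, hx, rfl⟩
  obtain ⟨hn, S, hS⟩ := hU.exists_cutSlice hf hx
  let D := sliceChart hU hf hn S
  let Q : EuclideanSpace ℝ (Fin n) →ₗ[ℝ] ℂ :=
    (LinearMap.snd ℝ (EuclideanSpace ℝ (Fin (n - 2))) ℂ).comp
      ((sliceModelEquiv n hn).symm.toLinearEquiv : EuclideanSpace ℝ (Fin n) →ₗ[ℝ] _)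
  refine ⟨D.toHomeo hU, IsManifold.subset_maximalAtlas (Or.inr ⟨hn, S, rfl⟩),
    mem_image_of_mem _ hS, LinearMap.ker Q, ?_, ?_⟩
  · have hQ : LinearMap.range Q = ⊤ := by
      rw [LinearMap.range_eq_top]
      intro z
      refine ⟨sliceModelEquiv n hn (0, z), ?_⟩
      simp [Q]
    have h := LinearMap.finrank_range_add_finrank_ker Q
    rw [hQ, finrank_top, Complex.finrank_real_complex, finrank_euclideanSpace_fin] at h
    omega
  · rintro _ ⟨y, hy, rfl⟩
    have hQ : Q (D.k y) = S.α y * (Real.sqrt (f y) : ℝ) := by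
      simp [Q, D, sliceChart, CutSlice.κ]
    rw [cutMap_mem_reducedSet_iff hU, D.toHomeo_apply hU hy, LinearMap.mem_ker, hQ, mul_eq_zero,
      or_iff_right (Circle.coe_ne_zero _), Complex.ofReal_eq_zero, Real.sqrt_eq_zero (hf.nonneg y),
      hf.zero_iff]

end

end SmoothCut

end

/-! ### Assembly of the main theorem. -/

theorem mainTheorem1 {n : ℕ} [NeZero n] {M : Type*} [TopologicalSpace M] [T2Space M]
    [SecondCountableTopology M] [ChartedSpace (EuclideanHalfSpace n) M]
    [IsManifold (𝓡∂ n) ∞ M] (U : Opens M) [MulAction Circle U]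
    (hU : SmoothCut.IsFreeCircleActionNearBoundary n U) :
    T2Space (SmoothCut.CutSpace n U) ∧
    SecondCountableTopology (SmoothCut.CutSpace n U) ∧
    (∃ f : M → ℝ, SmoothCut.IsInvariantBoundaryDefining n U f) ∧
    ∃ A : ChartedSpace (EuclideanSpace ℝ (Fin n)) (SmoothCut.CutSpace n U),
      IsManifold (𝓡 n) ∞ (SmoothCut.CutSpace n U) ∧
      (∀ f : M → ℝ, SmoothCut.IsInvariantBoundaryDefining n U f →
        SmoothCut.smoothFunctions n (SmoothCut.CutSpace n U) = SmoothCut.cutFunctions n U f) ∧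
      (∀ (m : ℕ) (B : ChartedSpace (EuclideanSpace ℝ (Fin m)) (SmoothCut.CutSpace n U)),
        IsManifold (𝓡 m) ∞ (SmoothCut.CutSpace n U) →
        (∃ f : M → ℝ, SmoothCut.IsInvariantBoundaryDefining n U f ∧
          SmoothCut.smoothFunctions m (SmoothCut.CutSpace n U) =
            SmoothCut.cutFunctions n U f) →
        SmoothCut.SameSmoothStructure A B) ∧
      IsOpen (SmoothCut.cutMap n U '' (𝓡∂ n).interior M) ∧
      Dense (SmoothCut.cutMap n U '' (𝓡∂ n).interior M) ∧
      Set.range (SmoothCut.boundaryOrbitMap n U hU.boundary_subset) =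
        SmoothCut.reducedSet n U ∧
      Topology.IsEmbedding (SmoothCut.boundaryOrbitMap n U hU.boundary_subset) ∧
      IsClosed (SmoothCut.reducedSet n U) ∧
      SmoothCut.IsEmbeddedSubmanifold n 2 (SmoothCut.reducedSet n U) := by
  obtain ⟨f₀, hf₀⟩ := hU.exists_isInvariantBoundaryDefining
  have hT2 := SmoothCut.t2Space_cutSpace hU
  let A := SmoothCut.cutChartedSpace hU hf₀
  have hA := SmoothCut.isManifold_cutChartedSpace hU hf₀
  have hσ := SmoothCut.sigmaCompactSpace_cutSpace (n := n) (U := U)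
  -- The atlas is built from one chosen `f₀`; independence of the function space transfers the
  -- description to every `f`.
  have hfun : ∀ f : M → ℝ, SmoothCut.IsInvariantBoundaryDefining n U f →
      SmoothCut.smoothFunctions n (SmoothCut.CutSpace n U) = SmoothCut.cutFunctions n U f :=
    fun f hf => (SmoothCut.smoothFunctions_eq_cutFunctions hU hf₀).trans
      (SmoothCut.cutFunctions_eq hU hf₀ hf)
  refine ⟨hT2, ChartedSpace.secondCountable_of_sigmaCompact (EuclideanSpace ℝ (Fin n)) _,
    ⟨f₀, hf₀⟩, A, hA, hfun, ?_, SmoothCut.isOpen_image_interior hU,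
    SmoothCut.dense_image_interior hf₀, SmoothCut.range_boundaryOrbitMap hU.boundary_subset,
    SmoothCut.isEmbedding_boundaryOrbitMap hU, SmoothCut.isClosed_reducedSet hU,
    SmoothCut.isEmbeddedSubmanifold_reducedSet hU hf₀⟩
  rintro m B hB ⟨f, hf, hBf⟩
  exact SmoothCut.sameSmoothStructure_of_smoothFunctions_eq A B hA hB ((hfun f hf).trans hBf.symm)
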